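/- Let $m,n,k\in\mathbb{N}=\{0,1,2,\dots\}$ with $m>1$, and put $M=m-2n$. Let $\mathcal{P}=\mathbb{C}[x_1,\dots,x_m]\otimes\Lambda_{2n}$ be the algebra of superpolynomials, where $\Lambda_{2n}$ is the Grassmann algebra generated by anticommuting $\theta_1,\dots,\theta_{2n}$. Write $$R^2=\sum_{i=1}^m x_i^2-\sum_{j=1}^n\theta_{2j-1}\theta_{2j},\qquad \nabla^2=\sum_{i=1}^m\partial_{x_i}^2-4\sum_{j=1}^n\partial_{\theta_{2j-1}}\partial_{\theta_{2j}},$$ let $\mathcal{P}_d$ be the space of superpolynomials homogeneous of degree $d$ (so $\mathcal{P}_d=0$ for $d<0$), and let $\mathcal{H}_k=\mathcal{P}_k\cap\ker\nabla^2$ be the space of spherical harmonics of degree $k$. Let $\mathfrak{osp}(m|2n)$ be the complex orthosymplectic Lie superalgebra of the supersymmetric bilinear form on the span of the coordinates with $\langle x_i,x_j\rangle=\delta_{ij}$, $\langle\theta_{2j-1},\theta_{2j}\rangle=2=-\langle\theta_{2j},\theta_{2j-1}\rangle$ and all other pairings of coordinates zero. It acts on $\mathcal{P}$ by superderivations extending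 its action on the coordinates; this action preserves $\mathcal{P}_d$ and commutes with $R^2$ and $\nabla^2$, so $\mathcal{H}_k$ and $\mathcal{H}_k\cap R^2\mathcal{P}_{k-2}$ are $\mathfrak{osp}(m|2n)$-modules. Weights are taken in the basis $\epsilon_1,\dots,\epsilon_{\lfloor m/2\rfloor},\delta_1,\dots,\delta_n$, where $x_{2j-1}+\mathrm{i}x_{2j}$ has weight $\epsilon_j$, $\theta_{2j-1}$ has weight $\delta_j$ and $\theta_{2j}$ has weight $-\delta_j$. The positive roots are $\epsilon_i\pm\epsilon_j$ and $\delta_i\pm\delta_j$ ($i<j$), $2\delta_i$, $\epsilon_i\pm\delta_j$ and, for $m$ odd, also $\epsilon_i$ and $\delta_j$. Let $L_{(k,0,\dots,0)}$ denote the simple highest weight $\mathfrak{osp}(m|2n)$-module with highest weight $k\epsilon_1$ (unique up to isomorphism and parity shift). **(a)** If $m\ge 3$, or if $m=2$ and $k\le n$, then $$L_{(k,0,\dots,0)}\;\cong\;\mathcal{H}_k/\left(\mathcal{H}_k\cap R^2\mathcal{P}_{k-2}\right).$$ **(b)** For all $m>1$ the quotient $Q_k=\mathcal{H}_k/(\mathcal{H}_k\cap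 R^2\mathcal{P}_{k-2})$ is finite dimensional. If $M\in-2\mathbb{N}$ and $2-\frac M2\le k\le 2-M$, then $$\begin{aligned}\dim Q_k=&\sum_{i=0}^{\min(k,2n)}\binom{2n}{i}\binom{k-i+m-1}{m-1}-\sum_{i=0}^{\min(k-2,2n)}\binom{2n}{i}\binom{k-i+m-3}{m-1}\\&+\sum_{i=0}^{\min(-M-k,2n)}\binom{2n}{i}\binom{2n-k-i-1}{m-1}-\sum_{i=0}^{\min(2-M-k,2n)}\binom{2n}{i}\binom{2n-k-i+1}{m-1}.\end{aligned}$$ In all other cases $\mathcal{H}_k\cap R^2\mathcal{P}_{k-2}=0$, so that $Q_k=\mathcal{H}_k$, and $$\dim Q_k=\sum_{i=0}^{\min(k,2n)}\binom{2n}{i}\binom{k-i+m-1}{m-1}-\sum_{i=0}^{\min(k-2,2n)}\binom{2n}{i}\binom{k-i+m-3}{m-1}.$$ A sum whose upper limit is negative is empty. Consequently, in the situation of (a), $L_{(k,0,\dots,0)}$ is finite dimensional and these formulas give $\dim L_{(k,0,\dots,0)}$. -/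

import Mathlib

open scoped TensorProduct Kronecker

/-! # Superpolynomials, the orthosymplectic Lie superalgebra, spherical harmonics -/

namespace SuperHarm

noncomputable section

/-- Indices of the coordinates of `m|2n`-dimensional superspace: `inl i` is the bosonic variable
`x_i`; `inr (j, 0)` and `inr (j, 1)` are the two members of the `j`-th pair of Grassmann
variables. -/
abbrev Idx (m n : ℕ) : Type := Fin m ⊕ (Fin n × Fin 2)

/-- The parity `[i]` of a coordinate. -/
def par {m n : ℕ} : Idx m n → ZMod 2 := Sum.elim (fun _ => 0) (fun _ => 1)

/-- The sign `(-1)^(p q)`. -/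
def sgn (p q : ZMod 2) : ℂ := if p = 1 ∧ q = 1 then -1 else 1

/-- The superpolynomials `𝒫 = ℂ[x_1, …, x_m] ⊗ Λ_{2n}`. -/
def SPoly (m n : ℕ) : Type :=
  MvPolynomial (Fin m) ℂ ⊗[ℂ] ExteriorAlgebra ℂ (Fin n × Fin 2 → ℂ)

instance (m n : ℕ) : Ring (SPoly m n) :=
  inferInstanceAs (Ring (MvPolynomial (Fin m) ℂ ⊗[ℂ] ExteriorAlgebra ℂ (Fin n × Fin 2 → ℂ)))

instance (m n : ℕ) : Algebra ℂ (SPoly m n) :=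
  inferInstanceAs (Algebra ℂ (MvPolynomial (Fin m) ℂ ⊗[ℂ] ExteriorAlgebra ℂ (Fin n × Fin 2 → ℂ)))

variable {m n : ℕ}

/-- The superpolynomial `f ⊗ g`. -/
def tm (f : MvPolynomial (Fin m) ℂ) (g : ExteriorAlgebra ℂ (Fin n × Fin 2 → ℂ)) : SPoly m n :=
  f ⊗ₜ[ℂ] g

/-- The linear map `φ ⊗ ψ` on superpolynomials. -/
def tmap (φ : Module.End ℂ (MvPolynomial (Fin m) ℂ))
    (ψ : Module.End ℂ (ExteriorAlgebra ℂ (Fin n × Fin 2 → ℂ))) : Module.End ℂ (SPoly m n) :=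
  TensorProduct.map φ ψ

lemma tmap_tm (φ : Module.End ℂ (MvPolynomial (Fin m) ℂ))
    (ψ : Module.End ℂ (ExteriorAlgebra ℂ (Fin n × Fin 2 → ℂ))) (f g) :
    tmap φ ψ (tm f g) = tm (φ f) (ψ g) := TensorProduct.map_tmul φ ψ f g

lemma spoly_ext {φ ψ : Module.End ℂ (SPoly m n)} (h : ∀ f g, φ (tm f g) = ψ (tm f g)) : φ = ψ :=
  TensorProduct.ext' h

lemma tm_mul_tm (f f' : MvPolynomial (Fin m) ℂ) (g g' : ExteriorAlgebra ℂ (Fin n × Fin 2 → ℂ)) :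
    tm f g * tm f' g' = tm (f * f') (g * g') := Algebra.TensorProduct.tmul_mul_tmul f f' g g'

lemma tm_add_left (f f' : MvPolynomial (Fin m) ℂ) (g : ExteriorAlgebra ℂ (Fin n × Fin 2 → ℂ)) :
    tm (f + f') g = tm f g + tm f' g := TensorProduct.add_tmul f f' g

lemma tm_sub_right (f : MvPolynomial (Fin m) ℂ) (g g' : ExteriorAlgebra ℂ (Fin n × Fin 2 → ℂ)) :
    tm f (g - g') = tm f g - tm f g' := TensorProduct.tmul_sub f g g'

lemma tm_neg_right (f : MvPolynomial (Fin m) ℂ) (g : ExteriorAlgebra ℂ (Fin n × Fin 2 → ℂ)) :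
    tm f (-g) = - tm f g := TensorProduct.tmul_neg f g

/-- The coordinate functions `X_i`. -/
def coord : Idx m n → SPoly m n :=
  Sum.elim (fun i => tm (MvPolynomial.X i) 1)
    (fun a => tm 1 (ExteriorAlgebra.ι ℂ (Pi.single a (1 : ℂ))))

/-- Left multiplication by `X_i`. -/
def mulX (i : Idx m n) : Module.End ℂ (SPoly m n) := LinearMap.mulLeft ℂ (coord i)

/-- The (left) derivatives `∂_{X_i}`. On the Grassmann algebra the derivative is the contraction
with a dual basis vector, i.e. the antiderivation with `∂_{θ_a} θ_b = δ_{ab}`. -/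
def der : Idx m n → Module.End ℂ (SPoly m n) :=
  Sum.elim
    (fun i => tmap (MvPolynomial.pderiv i).toLinearMap LinearMap.id)
    (fun a => tmap LinearMap.id
      (CliffordAlgebra.contractLeft (Q := (0 : QuadraticForm ℂ (Fin n × Fin 2 → ℂ)))
        (LinearMap.proj a)))

/-- The parity operator of superpolynomials: `+1` on even and `-1` on odd ones. -/
def parityP : Module.End ℂ (SPoly m n) :=
  tmap LinearMap.id
    (CliffordAlgebra.involute (Q := (0 : QuadraticForm ℂ (Fin n × Fin 2 → ℂ)))).toLinearMap

lemma mulX_inl (i : Fin m) (f : MvPolynomial (Fin m) ℂ)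
    (g : ExteriorAlgebra ℂ (Fin n × Fin 2 → ℂ)) :
    mulX (.inl i) (tm f g) = tm (MvPolynomial.X i * f) g := by
  rw [mulX, LinearMap.mulLeft_apply, coord, Sum.elim_inl, tm_mul_tm, one_mul]

lemma mulX_inr (a : Fin n × Fin 2) (f : MvPolynomial (Fin m) ℂ)
    (g : ExteriorAlgebra ℂ (Fin n × Fin 2 → ℂ)) :
    mulX (.inr a) (tm f g) = tm f (ExteriorAlgebra.ι ℂ (Pi.single a (1 : ℂ)) * g) := by
  rw [mulX, LinearMap.mulLeft_apply, coord, Sum.elim_inr, tm_mul_tm, one_mul]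

lemma der_inl (i : Fin m) (f : MvPolynomial (Fin m) ℂ)
    (g : ExteriorAlgebra ℂ (Fin n × Fin 2 → ℂ)) :
    der (.inl i) (tm f g) = tm (MvPolynomial.pderiv i f) g := tmap_tm _ _ _ _

lemma der_inr (a : Fin n × Fin 2) (f : MvPolynomial (Fin m) ℂ)
    (g : ExteriorAlgebra ℂ (Fin n × Fin 2 → ℂ)) :
    der (.inr a) (tm f g) = tm f (CliffordAlgebra.contractLeft (LinearMap.proj a) g) :=
  tmap_tm _ _ _ _

lemma parityP_tm (f : MvPolynomial (Fin m) ℂ) (g : ExteriorAlgebra ℂ (Fin n × Fin 2 → ℂ)) :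
    parityP (tm f g) = tm f (CliffordAlgebra.involute g) := tmap_tm _ _ _ _

/-- The generalized norm squared `R² = ∑ x_i² - ∑ θ_{2j-1} θ_{2j}`. -/
def R2 (m n : ℕ) : SPoly m n :=
  ∑ i : Fin m, coord (.inl i) * coord (.inl i)
    - ∑ j : Fin n, coord (.inr (j, 0)) * coord (.inr (j, 1))

/-- The super Laplace operator `∇² = ∑ ∂_{x_i}² - 4 ∑ ∂_{θ_{2j-1}} ∂_{θ_{2j}}`. -/
def laplace (m n : ℕ) : Module.End ℂ (SPoly m n) :=
  ∑ i : Fin m, der (.inl i) * der (.inl i)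
    - (4 : ℂ) • ∑ j : Fin n, der (.inr (j, 0)) * der (.inr (j, 1))

/-- The super Euler operator `𝔼 = ∑ X_i ∂_{X_i}`. -/
def euler (m n : ℕ) : Module.End ℂ (SPoly m n) := ∑ i : Idx m n, mulX i * der i

/-- The space `𝒫_d` of superpolynomials with `𝔼 P = d P`, for any integer `d`
(it is zero for `d < 0`). -/
def homog (m n : ℕ) (d : ℤ) : Submodule ℂ (SPoly m n) :=
  LinearMap.ker (euler m n - (d : ℂ) • LinearMap.id)

/-- The spherical harmonics `ℋ_k = 𝒫_k ∩ ker ∇²`. -/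
def harm (m n k : ℕ) : Submodule ℂ (SPoly m n) := homog m n k ⊓ LinearMap.ker (laplace m n)

/-- The space `R² 𝒫_{k-2}`. -/
def R2homog (m n k : ℕ) : Submodule ℂ (SPoly m n) :=
  (homog m n ((k : ℤ) - 2)).map (LinearMap.mulLeft ℂ (R2 m n))

/-! ## The Lie superalgebra `𝔬𝔰𝔭(m|2n)` -/

/-- Supermatrices. -/
abbrev SMat (m n : ℕ) : Type := Matrix (Idx m n) (Idx m n) ℂ

/-- The orthosymplectic metric `g = diag(I_m, J)`, where `J` has diagonal blocks `½ (0, -1; 1, 0)`.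
Then `R² = ∑ X_i g_{ij} X_j`. -/
def metric (m n : ℕ) : SMat m n :=
  Matrix.fromBlocks 1 0 0 ((1 : Matrix (Fin n) (Fin n) ℂ) ⊗ₖ !![0, -1/2; 1/2, 0])

/-- The supersymmetric form on the span of the coordinates `X_i`, given by the inverse of the
metric: `⟨x_i, x_j⟩ = δ_{ij}` and `⟨θ_{2j-1}, θ_{2j}⟩ = 2 = -⟨θ_{2j}, θ_{2j-1}⟩`. -/
def gram (m n : ℕ) : SMat m n :=
  Matrix.fromBlocks 1 0 0 ((1 : Matrix (Fin n) (Fin n) ℂ) ⊗ₖ !![0, 2; -2, 0])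

/-- A supermatrix is homogeneous of parity `p` if `X_{ij} = 0` unless `[i] + [j] = p`. -/
def IsHomog (p : ZMod 2) (X : SMat m n) : Prop := ∀ i j, X i j ≠ 0 → par i + par j = p

/-- `𝔬𝔰𝔭(m|2n)`: the supermatrices both of whose homogeneous parts satisfy
`⟨X v, w⟩ + (-1)^{|X||v|} ⟨v, X w⟩ = 0`. Written for basis vectors `v = e_i`, `w = e_j`, where
`X e_i = ∑_k X_{ki} e_k`; only the part of `X` of parity `[i] + [j]` enters then. -/
def osp (m n : ℕ) : Submodule ℂ (SMat m n) where
  carrier := {X | ∀ i j, ∑ k, X k i * gram m n k j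
    + sgn (par i + par j) (par i) * ∑ k, gram m n i k * X k j = 0}
  add_mem' := by
    intro X Y hX hY i j
    have h1 := hX i j
    have h2 := hY i j
    simp only [Matrix.add_apply, add_mul, mul_add, Finset.sum_add_distrib]
    linear_combination h1 + h2
  zero_mem' := by intro i j; simp
  smul_mem' := by
    intro c X hX i j
    have h1 := hX i j
    have e1 : ∑ k, (c • X) k i * gram m n k j = c * ∑ k, X k i * gram m n k j := by
      rw [Finset.mul_sum]
      exact Finset.sum_congr rfl fun k _ => by simp [mul_assoc]
    have e2 : ∑ k, gram m n i k * (c • X) k j = c * ∑ k, gram m n i k * X k j := by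
      rw [Finset.mul_sum]
      exact Finset.sum_congr rfl fun k _ => by simp [mul_left_comm]
    rw [e1, e2]
    linear_combination c * h1

/-- The superbracket of homogeneous supermatrices of parities `p` and `q`. -/
def sbracket (p q : ZMod 2) (X Y : SMat m n) : SMat m n := X * Y - sgn p q • (Y * X)

lemma zmod2_cases (p : ZMod 2) : p = 0 ∨ p = 1 := by
  revert p; decide

lemma sgn_add_left (p q r : ZMod 2) : sgn (p + q) r = sgn p r * sgn q r := by
  have h : (1 + 1 : ZMod 2) = 0 := rfl
  rcases zmod2_cases p with rfl | rfl <;> rcases zmod2_cases q with rfl | rfl <;>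
    rcases zmod2_cases r with rfl | rfl <;> simp [sgn, h]

lemma sgn_comm (p q : ZMod 2) : sgn p q = sgn q p := by
  simp only [sgn, and_comm]

lemma sgn_add_right (p q r : ZMod 2) : sgn r (p + q) = sgn r p * sgn r q := by
  rw [sgn_comm, sgn_add_left, sgn_comm p, sgn_comm q]

lemma sgn_mul_self (p q : ZMod 2) : sgn p q * sgn p q = 1 := by
  unfold sgn; split_ifs <;> norm_num

lemma sgn_zero_left (q : ZMod 2) : sgn 0 q = 1 := by simp [sgn]

lemma sgn_zero_right (q : ZMod 2) : sgn q 0 = 1 := by simp [sgn]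

/-! ### Canonical (anti)commutation relations -/

lemma neg_smul_end (c : ℂ) (x : Module.End ℂ (SPoly m n)) : (-c) • x = -(c • x) := neg_smul c x

lemma ι_mul_ι (a b : Fin n × Fin 2) (g : ExteriorAlgebra ℂ (Fin n × Fin 2 → ℂ)) :
    ExteriorAlgebra.ι ℂ (Pi.single a (1 : ℂ)) * (ExteriorAlgebra.ι ℂ (Pi.single b (1 : ℂ)) * g)
      = -(ExteriorAlgebra.ι ℂ (Pi.single b (1 : ℂ)) *
          (ExteriorAlgebra.ι ℂ (Pi.single a (1 : ℂ)) * g)) := by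
  have h : ∀ u v : Fin n × Fin 2 → ℂ, ExteriorAlgebra.ι ℂ u * ExteriorAlgebra.ι ℂ v
      + ExteriorAlgebra.ι ℂ v * ExteriorAlgebra.ι ℂ u = 0 :=
    fun u v => ExteriorAlgebra.ι_add_mul_swap u v
  rw [← mul_assoc, eq_neg_of_add_eq_zero_left (h _ _), neg_mul, mul_assoc]

lemma mulX_mulX (i j : Idx m n) :
    mulX i * mulX j = sgn (par i) (par j) • (mulX j * mulX i : Module.End ℂ (SPoly m n)) := by
  refine spoly_ext fun f g => ?_
  rcases i with i | a <;> rcases j with j | b <;>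
    simp only [par, sgn, Sum.elim_inl, Sum.elim_inr, Module.End.mul_apply, LinearMap.smul_apply,
      mulX_inl, mulX_inr]
  · simp [mul_left_comm]
  · simp
  · simp
  · rw [ι_mul_ι]; simp [tm_neg_right]

lemma pderiv_comm (i j : Fin m) (f : MvPolynomial (Fin m) ℂ) :
    MvPolynomial.pderiv i (MvPolynomial.pderiv j f)
      = MvPolynomial.pderiv j (MvPolynomial.pderiv i f) := by
  have h : ⁅MvPolynomial.pderiv (R := ℂ) i, MvPolynomial.pderiv (R := ℂ) j⁆ = 0 := by
    refine MvPolynomial.derivation_ext fun l => ?_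
    rw [Derivation.commutator_apply]
    simp [MvPolynomial.pderiv_X, Pi.single_apply, apply_ite]
  have h2 := DFunLike.congr_fun h f
  rw [Derivation.commutator_apply] at h2
  exact sub_eq_zero.mp h2

lemma der_der (i j : Idx m n) :
    der i * der j = sgn (par i) (par j) • (der j * der i : Module.End ℂ (SPoly m n)) := by
  refine spoly_ext fun f g => ?_
  rcases i with i | a <;> rcases j with j | b <;>
    simp only [par, sgn, Sum.elim_inl, Sum.elim_inr, Module.End.mul_apply, LinearMap.smul_apply,
      der_inl, der_inr]
  · rw [pderiv_comm]; simp
  · simp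
  · simp
  · rw [CliffordAlgebra.contractLeft_comm]; simp [tm_neg_right]

lemma der_mulX (i j : Idx m n) :
    der i * mulX j = (if i = j then 1 else 0)
      + sgn (par i) (par j) • (mulX j * der i : Module.End ℂ (SPoly m n)) := by
  refine spoly_ext fun f g => ?_
  rcases i with i | a <;> rcases j with j | b <;>
    simp only [par, sgn, Sum.elim_inl, Sum.elim_inr, Module.End.mul_apply, LinearMap.smul_apply,
      LinearMap.add_apply, der_inl, der_inr, mulX_inl, mulX_inr]
  · by_cases h : i = j
    · subst h
      simp [tm_add_left, add_comm]
    · simp [MvPolynomial.pderiv_X_of_ne (Ne.symm h), h]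
  · simp
  · simp
  · have h2 := CliffordAlgebra.contractLeft_ι_mul
      (Q := (0 : QuadraticForm ℂ (Fin n × Fin 2 → ℂ)))
      (LinearMap.proj a) (Pi.single b (1 : ℂ)) g
    rw [ExteriorAlgebra.ι, h2, tm_sub_right, sub_eq_add_neg]
    by_cases h : a = b
    · subst h
      simp
    · have h0 : tm f 0 = (0 : SPoly m n) := TensorProduct.tmul_zero _ f
      simp [h, h0]

lemma parityP_mulX (i : Idx m n) :
    parityP * mulX i = sgn 1 (par i) • (mulX i * parityP : Module.End ℂ (SPoly m n)) := by
  refine spoly_ext fun f g => ?_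
  rcases i with i | a <;>
    simp only [par, sgn, Sum.elim_inl, Sum.elim_inr, Module.End.mul_apply, LinearMap.smul_apply,
      mulX_inl, mulX_inr, parityP_tm]
  · simp
  · simp [ExteriorAlgebra.ι, tm_neg_right]

lemma involute_contractLeft (d : Module.Dual ℂ (Fin n × Fin 2 → ℂ))
    (g : CliffordAlgebra (0 : QuadraticForm ℂ (Fin n × Fin 2 → ℂ))) :
    CliffordAlgebra.involute (CliffordAlgebra.contractLeft d g)
      = - CliffordAlgebra.contractLeft d (CliffordAlgebra.involute g) := by
  induction g using CliffordAlgebra.left_induction with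
  | algebraMap r => simp
  | add x y hx hy => simp only [map_add, hx, hy, neg_add]
  | ι_mul x v hx =>
    simp [CliffordAlgebra.contractLeft_ι_mul, hx]

lemma parityP_der (i : Idx m n) :
    parityP * der i = sgn 1 (par i) • (der i * parityP : Module.End ℂ (SPoly m n)) := by
  refine spoly_ext fun f g => ?_
  rcases i with i | a <;>
    simp only [par, sgn, Sum.elim_inl, Sum.elim_inr, Module.End.mul_apply, LinearMap.smul_apply,
      der_inl, der_inr, parityP_tm]
  · simp
  · rw [involute_contractLeft]; simp [tm_neg_right]

lemma parityP_sq : (parityP * parityP : Module.End ℂ (SPoly m n)) = 1 := by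
  refine spoly_ext fun f g => ?_
  simp [parityP_tm]

/-! ### The action of supermatrices on superpolynomials -/

/-- The action `E_{ij} ↦ X_i ∂_{X_j}` of supermatrices on superpolynomials. -/
def glAct (m n : ℕ) : SMat m n →ₗ[ℂ] Module.End ℂ (SPoly m n) where
  toFun X := ∑ i, ∑ j, X i j • (mulX i * der j)
  map_add' X Y := by simp [add_smul, Finset.sum_add_distrib]
  map_smul' c X := by simp [Finset.smul_sum, mul_smul]

lemma glAct_apply (X : SMat m n) :
    glAct m n X = ∑ i, ∑ j, X i j • (mulX i * der j) := rfl

/-- Product of two elementary operators, normally ordered. -/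
lemma elem_mul_elem (i j k l : Idx m n) :
    (mulX i * der j) * (mulX k * der l)
      = (if j = k then (1 : ℂ) else 0) • (mulX i * der l)
        + sgn (par j) (par k) • (mulX i * mulX k * (der j * der l) :
            Module.End ℂ (SPoly m n)) := by
  have h : (mulX i * der j) * (mulX k * der l)
      = mulX i * (der j * mulX k) * (der l : Module.End ℂ (SPoly m n)) := by
    simp only [mul_assoc]
  rw [h, der_mulX]
  split_ifs <;> simp [mul_add, add_mul, mul_assoc]

lemma sum_swap {α : Type*} [AddCommMonoid α] (F : Idx m n → Idx m n → Idx m n → Idx m n → α) :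
    ∑ i, ∑ j, ∑ k, ∑ l, F i j k l = ∑ i, ∑ j, ∑ k, ∑ l, F k l i j := by
  calc ∑ i, ∑ j, ∑ k, ∑ l, F i j k l
      = ∑ i, ∑ k, ∑ j, ∑ l, F i j k l :=
        Finset.sum_congr rfl fun _ _ => Finset.sum_comm
    _ = ∑ k, ∑ i, ∑ j, ∑ l, F i j k l := Finset.sum_comm
    _ = ∑ k, ∑ i, ∑ l, ∑ j, F i j k l :=
        Finset.sum_congr rfl fun _ _ => Finset.sum_congr rfl fun _ _ => Finset.sum_comm
    _ = ∑ k, ∑ l, ∑ i, ∑ j, F i j k l :=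
        Finset.sum_congr rfl fun _ _ => Finset.sum_comm

lemma glAct_mul (X Y : SMat m n) :
    glAct m n X * glAct m n Y = glAct m n (X * Y)
      + ∑ i, ∑ j, ∑ k, ∑ l, (X i j * Y k l * sgn (par j) (par k)) •
          (mulX i * mulX k * (der j * der l) : Module.End ℂ (SPoly m n)) := by
  have h1 : glAct m n X * glAct m n Y = ∑ i, ∑ j, ∑ k, ∑ l, (X i j * Y k l) •
      ((mulX i * der j) * (mulX k * der l) : Module.End ℂ (SPoly m n)) := by
    simp only [glAct_apply, Finset.sum_mul, Finset.mul_sum, smul_mul_smul_comm]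
    exact sum_swap _
  have h2 : glAct m n (X * Y) = ∑ i, ∑ j, ∑ k, ∑ l, (X i j * Y k l) •
      ((if j = k then (1 : ℂ) else 0) • (mulX i * der l) : Module.End ℂ (SPoly m n)) := by
    simp only [glAct_apply, Matrix.mul_apply, Finset.sum_smul]
    refine Finset.sum_congr rfl fun i _ => ?_
    rw [Finset.sum_comm]
    refine Finset.sum_congr rfl fun j _ => ?_
    rw [Finset.sum_comm]
    refine Finset.sum_congr rfl fun l _ => ?_
    rw [Finset.sum_eq_single j]
    · simp
    · intro k _ hk; simp [Ne.symm hk]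
    · simp
  rw [h1, h2]
  simp only [elem_mul_elem, smul_add, Finset.sum_add_distrib, smul_smul]

lemma glAct_sbracket {p q : ZMod 2} {X Y : SMat m n} (hX : IsHomog p X) (hY : IsHomog q Y) :
    glAct m n (sbracket p q X Y)
      = glAct m n X * glAct m n Y - sgn p q • (glAct m n Y * glAct m n X) := by
  rw [glAct_mul X Y, glAct_mul Y X, sbracket, map_sub, map_smul]
  have key : ∑ i, ∑ j, ∑ k, ∑ l, (X i j * Y k l * sgn (par j) (par k)) •
          (mulX i * mulX k * (der j * der l) : Module.End ℂ (SPoly m n))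
      = sgn p q • ∑ i, ∑ j, ∑ k, ∑ l, (Y i j * X k l * sgn (par j) (par k)) •
          (mulX i * mulX k * (der j * der l) : Module.End ℂ (SPoly m n)) := by
    simp only [Finset.smul_sum]
    rw [sum_swap fun i j k l => sgn p q • (Y i j * X k l * sgn (par j) (par k)) •
          (mulX i * mulX k * (der j * der l) : Module.End ℂ (SPoly m n))]
    refine Finset.sum_congr rfl fun i _ => Finset.sum_congr rfl fun j _ =>
      Finset.sum_congr rfl fun k _ => Finset.sum_congr rfl fun l _ => ?_
    by_cases h1 : X i j = 0
    · simp [h1]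
    by_cases h2 : Y k l = 0
    · simp [h2]
    rw [mulX_mulX i k, der_der j l, ← hX i j h1, ← hY k l h2]
    simp only [smul_mul_smul_comm, smul_smul]
    congr 1
    simp only [sgn_add_left, sgn_add_right]
    rw [sgn_comm (par l) (par i)]
    have a2 := sgn_mul_self (par i) (par l)
    linear_combination (-(X i j * Y k l * sgn (par j) (par k) * sgn (par i) (par k)
      * sgn (par j) (par l))) * a2
  rw [key, smul_add]
  abel


/-! ### Invariance of `R²`, `∇²` and `𝔼` under `𝔬𝔰𝔭(m|2n)` -/

lemma gram_mul_metric : gram m n * metric m n = 1 := by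
  have h : (!![0, 2; -2, 0] * !![0, -1/2; 1/2, 0] : Matrix (Fin 2) (Fin 2) ℂ) = 1 := by
    ext i j; fin_cases i <;> fin_cases j <;> simp [Matrix.mul_apply]; try norm_num
  rw [gram, metric, Matrix.fromBlocks_multiply, ← Matrix.mul_kronecker_mul, h]
  simp

lemma metric_mul_gram : metric m n * gram m n = 1 :=
  mul_eq_one_comm.mp gram_mul_metric

lemma gram_symm (i j : Idx m n) : gram m n i j = sgn (par i) (par j) * gram m n j i := by
  rcases i with i | ⟨a, r⟩ <;> rcases j with j | ⟨b, s⟩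
  · simp [gram, par, sgn, Matrix.one_apply, eq_comm]
  · simp [gram]
  · simp [gram]
  · by_cases h : a = b
    · subst h
      fin_cases r <;> fin_cases s <;> simp [gram, par, sgn]
    · simp [gram, h, Ne.symm h]

lemma metric_symm (i j : Idx m n) : metric m n i j = sgn (par i) (par j) * metric m n j i := by
  rcases i with i | ⟨a, r⟩ <;> rcases j with j | ⟨b, s⟩
  · simp [metric, par, sgn, Matrix.one_apply, eq_comm]
  · simp [metric]
  · simp [metric]
  · by_cases h : a = b
    · subst h
      fin_cases r <;> fin_cases s <;> simp [metric, par, sgn] <;> norm_num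
    · simp [metric, h, Ne.symm h]

lemma gram_even {i j : Idx m n} (h : gram m n i j ≠ 0) : par i = par j := by
  rcases i with i | a <;> rcases j with j | b <;> simp_all [gram, par]

lemma metric_even {i j : Idx m n} (h : metric m n i j ≠ 0) : par i = par j := by
  rcases i with i | a <;> rcases j with j | b <;> simp_all [metric, par]

lemma sum_mul_gram (X : SMat m n) (i j : Idx m n) :
    ∑ k, X k i * gram m n k j = sgn (par j) (par j) * (gram m n * X) j i := by
  rw [Matrix.mul_apply, Finset.mul_sum]
  refine Finset.sum_congr rfl fun k _ => ?_
  by_cases h : gram m n k j = 0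
  · have : gram m n j k = 0 := by rw [gram_symm, h, mul_zero]
    simp [h, this]
  · rw [gram_symm k j, gram_even h]; ring

lemma mem_osp_iff {X : SMat m n} : X ∈ osp m n ↔ ∀ i j : Idx m n,
    sgn (par i) (par i) * (gram m n * X) i j
      + sgn (par i) (par j) * (sgn (par j) (par j) * (gram m n * X) j i) = 0 := by
  have key : ∀ i j, (∑ k, X k i * gram m n k j
      + sgn (par i + par j) (par i) * ∑ k, gram m n i k * X k j)
      = sgn (par i) (par j) * (sgn (par i) (par i) * (gram m n * X) i j
      + sgn (par i) (par j) * (sgn (par j) (par j) * (gram m n * X) j i)) := by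
    intro i j
    rw [sum_mul_gram, ← Matrix.mul_apply, sgn_add_left, sgn_comm (par j) (par i)]
    linear_combination (-(sgn (par j) (par j) * (gram m n * X) j i))
      * sgn_mul_self (par i) (par j)
  constructor
  · intro hX i j
    have h := hX i j
    rw [key] at h
    linear_combination sgn (par i) (par j) * h
      - (sgn (par i) (par i) * (gram m n * X) i j
      + sgn (par i) (par j) * (sgn (par j) (par j) * (gram m n * X) j i))
      * sgn_mul_self (par i) (par j)
  · intro h i j
    rw [key, h i j, mul_zero]

lemma gram_mul_mul (X Y : SMat m n) (i j : Idx m n) :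
    (gram m n * (X * Y)) i j
      = ∑ a, ∑ b, (gram m n * X) i a * metric m n a b * (gram m n * Y) b j := by
  have h : gram m n * (X * Y) = (gram m n * X) * metric m n * (gram m n * Y) := by
    rw [Matrix.mul_assoc (gram m n * X), ← Matrix.mul_assoc (metric m n), metric_mul_gram,
      Matrix.one_mul, Matrix.mul_assoc]
  rw [h, Matrix.mul_apply, Finset.sum_comm]
  exact Finset.sum_congr rfl fun b _ => by rw [Matrix.mul_apply, Finset.sum_mul]

lemma gram_mul_homog {p : ZMod 2} {X : SMat m n} (hp : IsHomog p X) {i j : Idx m n}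
    (h : (gram m n * X) i j ≠ 0) : par i + par j = p := by
  rw [Matrix.mul_apply] at h
  obtain ⟨k, -, hk⟩ := Finset.exists_ne_zero_of_sum_ne_zero h
  rw [gram_even (left_ne_zero_of_mul hk)]
  exact hp k j (right_ne_zero_of_mul hk)

lemma gram_mul_mul_transpose {p q : ZMod 2} {X Y : SMat m n} (hX : X ∈ osp m n)
    (hY : Y ∈ osp m n) (hp : IsHomog p X) (hq : IsHomog q Y) (i j : Idx m n) :
    sgn (par i) (par i) * (gram m n * (X * Y)) i j
      = sgn (par i) (par j) * (sgn (par j) (par j) * (sgn p q * (gram m n * (Y * X)) j i)) := by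
  rw [gram_mul_mul, gram_mul_mul]
  conv_rhs => rw [Finset.sum_comm]
  simp only [Finset.mul_sum]
  refine Finset.sum_congr rfl fun a _ => Finset.sum_congr rfl fun b _ => ?_
  have h1 := mem_osp_iff.1 hX i a
  have h2 := mem_osp_iff.1 hY j b
  by_cases hg : metric m n b a = 0
  · have : metric m n a b = 0 := by rw [metric_symm, hg, mul_zero]
    simp [hg, this]
  have hab := metric_even hg
  rw [metric_symm a b]
  rw [hab] at h2 ⊢
  by_cases hA : (gram m n * X) a i = 0
  · have hA' : (gram m n * X) i a = 0 := by
      rw [hA] at h1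
      linear_combination sgn (par i) (par i) * h1
        - (gram m n * X) i a * sgn_mul_self (par i) (par i)
    simp [hA, hA']
  by_cases hB : (gram m n * Y) j b = 0
  · have hB' : (gram m n * Y) b j = 0 := by
      rw [hB] at h2
      linear_combination sgn (par a) (par a) * sgn (par j) (par a) * h2
        - (gram m n * Y) b j * sgn_mul_self (par a) (par a)
        - (gram m n * Y) b j * sgn (par a) (par a) * sgn (par a) (par a)
          * sgn_mul_self (par j) (par a)
    simp [hB, hB']
  rw [← gram_mul_homog hp hA, ← gram_mul_homog hq hB, hab]
  simp only [sgn_add_left, sgn_add_right]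
  rw [sgn_comm (par j) (par a)] at h2
  have c1 := sgn_mul_self (par i) (par j)
  have c2 := sgn_mul_self (par a) (par j)
  generalize sgn (par i) (par j) = ij at *
  generalize sgn (par a) (par j) = aj at *
  generalize sgn (par i) (par a) = ia at *
  generalize sgn (par a) (par a) = aa at *
  linear_combination (aa * metric m n b a * (gram m n * Y) b j) * h1
    - (ij * ij * aa * aj * ia * metric m n b a * (gram m n * X) a i) * h2
    + (ia * metric m n b a * (gram m n * X) a i * (gram m n * Y) b j * aa * aa)
      * (aj * aj * c1 + c2)

/-- The super-commutator of homogeneous elements of `𝔬𝔰𝔭(m|2n)` lies in `𝔬𝔰𝔭(m|2n)`. -/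
lemma sbracket_mem {p q : ZMod 2} {X Y : SMat m n} (hX : X ∈ osp m n) (hY : Y ∈ osp m n)
    (hp : IsHomog p X) (hq : IsHomog q Y) : sbracket p q X Y ∈ osp m n := by
  rw [mem_osp_iff]
  intro i j
  have h1 := gram_mul_mul_transpose hX hY hp hq i j
  have h2 := gram_mul_mul_transpose hY hX hq hp i j
  rw [sgn_comm q p] at h2
  simp only [sbracket, Matrix.mul_sub, Matrix.mul_smul, Matrix.sub_apply, Matrix.smul_apply,
    smul_eq_mul]
  linear_combination h1 - sgn p q * h2
    - sgn (par i) (par j) * sgn (par j) (par j) * (gram m n * (X * Y)) j i * sgn_mul_self p q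

lemma laplace_eq : laplace m n = ∑ i, ∑ j, gram m n j i • (der i * der j) := by
  have h : ∀ j : Fin n, (der (.inr (j, 1)) * der (.inr (j, 0)) : Module.End ℂ (SPoly m n))
      = - (der (.inr (j, 0)) * der (.inr (j, 1))) := by
    intro j
    have h1 : sgn (par (.inr (j, 1) : Idx m n)) (par (.inr (j, 0) : Idx m n)) = -1 := by
      simp [par, sgn]
    rw [der_der, h1, neg_smul_end, one_smul]
  have h2 : ∀ x : Module.End ℂ (SPoly m n), -((2 : ℂ) • x) + -((2 : ℂ) • x) = -((4 : ℂ) • x) := by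
    intro x
    rw [← neg_add, ← add_smul]; norm_num
  simp only [laplace, gram, Fintype.sum_sum_type, Fintype.sum_prod_type]
  simp [Matrix.one_apply, h, neg_smul_end, h2, sub_eq_add_neg, Finset.smul_sum]

lemma mulR2_eq : LinearMap.mulLeft ℂ (R2 m n)
    = ∑ i, ∑ j, metric m n i j • (mulX i * mulX j) := by
  have h : ∀ j : Fin n, (mulX (.inr (j, 1)) * mulX (.inr (j, 0)) : Module.End ℂ (SPoly m n))
      = - (mulX (.inr (j, 0)) * mulX (.inr (j, 1))) := by
    intro j
    have h1 : sgn (par (.inr (j, 1) : Idx m n)) (par (.inr (j, 0) : Idx m n)) = -1 := by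
      simp [par, sgn]
    rw [mulX_mulX, h1, neg_smul_end, one_smul]
  have h2 : LinearMap.mulLeft ℂ (R2 m n) = ∑ i : Fin m, mulX (.inl i) * mulX (.inl i)
      - ∑ j : Fin n, mulX (.inr (j, 0)) * mulX (.inr (j, 1)) := by
    refine LinearMap.ext fun f => ?_
    simp [R2, mulX, sub_mul, Finset.sum_mul, mul_assoc]
  have h3 : ∀ x : Module.End ℂ (SPoly m n), -((2⁻¹ : ℂ) • x) + -((2⁻¹ : ℂ) • x) = -x := by
    intro x
    rw [← neg_add, ← add_smul]; norm_num
  simp only [h2, metric, Fintype.sum_sum_type, Fintype.sum_prod_type]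
  simp [Matrix.one_apply, h, neg_div, neg_smul_end, h3, sub_eq_add_neg]

lemma der_der_elem {i j : Idx m n} (hij : par i = par j) (k l : Idx m n) :
    (der i * der j) * (mulX k * der l) = (mulX k * der l) * (der i * der j)
      + (if j = k then (1 : ℂ) else 0) • (der i * der l)
      + (sgn (par j) (par k) * if i = k then (1 : ℂ) else 0) •
          (der j * der l : Module.End ℂ (SPoly m n)) := by
  have h1 : (mulX k * der l) * (der i * der j)
      = (mulX k * (der i * der j * der l) : Module.End ℂ (SPoly m n)) := by
    rw [mul_assoc, ← mul_assoc (der l), der_der l i, smul_mul_assoc, mul_assoc (der i), der_der l j,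
      mul_smul_comm, mul_smul_comm, mul_smul_comm, smul_smul, hij, sgn_mul_self, one_smul]
    simp only [mul_assoc]
  have h2 : (der i * der j) * (mulX k * der l)
      = der i * (der j * mulX k) * (der l : Module.End ℂ (SPoly m n)) := by
    simp only [mul_assoc]
  have h3 : ∀ x : Module.End ℂ (SPoly m n), der i * (sgn (par j) (par k) • (mulX k * x))
      = (sgn (par j) (par k) * if i = k then (1 : ℂ) else 0) • x + mulX k * (der i * x) := by
    intro x
    rw [mul_smul_comm, ← mul_assoc, der_mulX, add_mul, smul_add, smul_mul_assoc, smul_smul, hij,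
      sgn_mul_self, one_smul, mul_assoc]
    split_ifs <;> simp
  rw [h1, h2, der_mulX, mul_add, add_mul, h3, add_mul]
  split_ifs <;> simp [mul_assoc] <;> abel

lemma elem_mulX_mulX {i j : Idx m n} (hij : par i = par j) (k l : Idx m n) :
    (mulX k * der l) * (mulX i * mulX j) = (mulX i * mulX j) * (mulX k * der l)
      + (if l = i then (1 : ℂ) else 0) • (mulX k * mulX j)
      + (sgn (par l) (par i) * if l = j then (1 : ℂ) else 0) •
          (mulX k * mulX i : Module.End ℂ (SPoly m n)) := by
  have h1 : (mulX i * mulX j) * (mulX k * der l)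
      = (mulX k * (mulX i * mulX j * der l) : Module.End ℂ (SPoly m n)) := by
    rw [← mul_assoc, mul_assoc (mulX i), mulX_mulX j k, mul_smul_comm, ← mul_assoc, mulX_mulX i k,
      smul_mul_assoc, smul_mul_assoc, smul_mul_assoc, smul_smul, hij, sgn_mul_self, one_smul]
    simp only [mul_assoc]
  have h2 : (mulX k * der l) * (mulX i * mulX j)
      = mulX k * ((der l * mulX i) * mulX j : Module.End ℂ (SPoly m n)) := by
    simp only [mul_assoc]
  have h3 : (sgn (par l) (par i) • (mulX i * der l)) * mulX j
      = (sgn (par l) (par i) * if l = j then (1 : ℂ) else 0) • mulX i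
        + (mulX i * mulX j * der l : Module.End ℂ (SPoly m n)) := by
    rw [smul_mul_assoc, mul_assoc, der_mulX, mul_add, smul_add, mul_smul_comm, smul_smul, ← hij,
      sgn_mul_self, one_smul, mul_assoc]
    split_ifs <;> simp
  rw [h1, h2, der_mulX, add_mul, h3, mul_add, mul_add, mul_smul_comm]
  split_ifs <;> simp <;> abel

lemma sum_gram_der_der {X : SMat m n} (hX : X ∈ osp m n) :
    ∑ i, ∑ l, (sgn (par i) (par i) * (gram m n * X) i l) •
      (der i * der l : Module.End ℂ (SPoly m n)) = 0 := by
  have h : ∑ i, ∑ l, (sgn (par i) (par i) * (gram m n * X) i l) •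
      (der i * der l : Module.End ℂ (SPoly m n))
      = - ∑ i, ∑ l, (sgn (par i) (par i) * (gram m n * X) i l) •
      (der i * der l : Module.End ℂ (SPoly m n)) := by
    conv_lhs => rw [Finset.sum_comm]
    simp only [← Finset.sum_neg_distrib]
    refine Finset.sum_congr rfl fun i _ => Finset.sum_congr rfl fun l _ => ?_
    rw [der_der l i, smul_smul, ← neg_smul_end]
    congr 1
    rw [sgn_comm (par l) (par i)]
    linear_combination mem_osp_iff.1 hX i l
  have h2 : (2 : ℂ) • ∑ i, ∑ l, (sgn (par i) (par i) * (gram m n * X) i l) •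
      (der i * der l : Module.End ℂ (SPoly m n)) = 0 := by
    rw [two_smul]
    exact add_eq_zero_iff_eq_neg.2 h
  exact (smul_eq_zero.1 h2).resolve_left two_ne_zero

/-- The operator `∇²` is `𝔬𝔰𝔭(m|2n)`-invariant. -/
lemma laplace_glAct {X : SMat m n} (hX : X ∈ osp m n) :
    laplace m n * glAct m n X = glAct m n X * laplace m n := by
  have h1 : laplace m n * glAct m n X = ∑ i, ∑ j, ∑ k, ∑ l, (gram m n j i * X k l) •
      ((der i * der j) * (mulX k * der l) : Module.End ℂ (SPoly m n)) := by
    simp only [laplace_eq, glAct_apply, Finset.sum_mul, Finset.mul_sum, smul_mul_smul_comm]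
    exact sum_swap _
  have h2 : glAct m n X * laplace m n = ∑ i, ∑ j, ∑ k, ∑ l, (gram m n j i * X k l) •
      ((mulX k * der l) * (der i * der j) : Module.End ℂ (SPoly m n)) := by
    simp only [laplace_eq, glAct_apply, Finset.sum_mul, Finset.mul_sum, smul_mul_smul_comm,
      mul_comm (X _ _)]
  have h3 : ∀ i j k l, (gram m n j i * X k l) •
        ((der i * der j) * (mulX k * der l) : Module.End ℂ (SPoly m n))
      = (gram m n j i * X k l) • ((mulX k * der l) * (der i * der j))
        + (gram m n j i * X k l * if j = k then (1 : ℂ) else 0) • (der i * der l)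
        + (gram m n j i * X k l * (sgn (par j) (par k) * if i = k then (1 : ℂ) else 0)) •
          (der j * der l) := by
    intro i j k l
    by_cases hg : gram m n j i = 0
    · simp [hg]
    · rw [der_der_elem (gram_even hg).symm, smul_add, smul_add, smul_smul, smul_smul]
  have h4 : ∑ i, ∑ j, ∑ k, ∑ l, (gram m n j i * X k l * if j = k then (1 : ℂ) else 0) •
      (der i * der l : Module.End ℂ (SPoly m n)) = 0 := by
    rw [← sum_gram_der_der hX]
    refine Finset.sum_congr rfl fun i _ => ?_
    have e : ∀ j, ∑ k, ∑ l, (gram m n j i * X k l * if j = k then (1 : ℂ) else 0) •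
        (der i * der l : Module.End ℂ (SPoly m n))
        = ∑ l, (gram m n j i * X j l) • (der i * der l) := by
      intro j
      rw [Finset.sum_eq_single j]
      · simp
      · intro k _ hk; simp [Ne.symm hk]
      · simp
    simp only [e]
    rw [Finset.sum_comm]
    refine Finset.sum_congr rfl fun l _ => ?_
    rw [← Finset.sum_smul, Matrix.mul_apply, Finset.mul_sum]
    congr 1
    refine Finset.sum_congr rfl fun j _ => ?_
    by_cases hg : gram m n j i = 0
    · have : gram m n i j = 0 := by rw [gram_symm, hg, mul_zero]
      simp [hg, this]
    · rw [gram_symm j i, gram_even hg, mul_assoc]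
  have h5 : ∑ i, ∑ j, ∑ k, ∑ l,
      (gram m n j i * X k l * (sgn (par j) (par k) * if i = k then (1 : ℂ) else 0)) •
        (der j * der l : Module.End ℂ (SPoly m n)) = 0 := by
    rw [← sum_gram_der_der hX, Finset.sum_comm]
    refine Finset.sum_congr rfl fun j _ => ?_
    have e : ∀ i, ∑ k, ∑ l,
        (gram m n j i * X k l * (sgn (par j) (par k) * if i = k then (1 : ℂ) else 0)) •
          (der j * der l : Module.End ℂ (SPoly m n))
        = ∑ l, (gram m n j i * X i l * sgn (par j) (par i)) • (der j * der l) := by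
      intro i
      rw [Finset.sum_eq_single i]
      · simp
      · intro k _ hk; simp [Ne.symm hk]
      · simp
    simp only [e]
    rw [Finset.sum_comm]
    refine Finset.sum_congr rfl fun l _ => ?_
    rw [← Finset.sum_smul, Matrix.mul_apply, Finset.mul_sum]
    congr 1
    refine Finset.sum_congr rfl fun i _ => ?_
    by_cases hg : gram m n j i = 0
    · simp [hg]
    · rw [← gram_even hg]; ring
  rw [h1, h2]
  simp only [h3, Finset.sum_add_distrib, h4, h5, add_zero]

lemma mul_metric_symm {X : SMat m n} (hX : X ∈ osp m n) (k j : Idx m n) :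
    (X * metric m n) k j + sgn (par k) (par j) * (X * metric m n) j k = 0 := by
  have e : ∀ k j, (X * metric m n) k j
      = ∑ a, ∑ b, metric m n k a * (gram m n * X) a b * metric m n b j := by
    intro k j
    have h : X * metric m n = metric m n * (gram m n * X) * metric m n := by
      rw [← Matrix.mul_assoc, metric_mul_gram, Matrix.one_mul]
    rw [h, Matrix.mul_apply, Finset.sum_comm]
    exact Finset.sum_congr rfl fun b _ => by rw [Matrix.mul_apply, Finset.sum_mul]
  rw [e k j, e j k]
  conv_lhs => enter [2, 2]; rw [Finset.sum_comm]
  simp only [Finset.mul_sum, ← Finset.sum_add_distrib]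
  refine Finset.sum_eq_zero fun a _ => Finset.sum_eq_zero fun b _ => ?_
  by_cases h1 : metric m n k a = 0
  · have : metric m n a k = 0 := by rw [metric_symm, h1, mul_zero]
    simp [h1, this]
  by_cases h2 : metric m n b j = 0
  · have : metric m n j b = 0 := by rw [metric_symm, h2, mul_zero]
    simp [h2, this]
  have h3 := mem_osp_iff.1 hX a b
  rw [metric_symm j b, metric_symm a k, metric_even h1, ← metric_even h2]
  linear_combination (sgn (par a) (par a) * metric m n k a * metric m n b j) * h3
    - metric m n k a * (gram m n * X) a b * metric m n b j * sgn_mul_self (par a) (par a)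

lemma sum_metric_mulX_mulX {X : SMat m n} (hX : X ∈ osp m n) :
    ∑ k, ∑ j, (X * metric m n) k j • (mulX k * mulX j : Module.End ℂ (SPoly m n)) = 0 := by
  have h : ∑ k, ∑ j, (X * metric m n) k j • (mulX k * mulX j : Module.End ℂ (SPoly m n))
      = - ∑ k, ∑ j, (X * metric m n) k j • (mulX k * mulX j : Module.End ℂ (SPoly m n)) := by
    conv_lhs => rw [Finset.sum_comm]
    simp only [← Finset.sum_neg_distrib]
    refine Finset.sum_congr rfl fun i _ => Finset.sum_congr rfl fun l _ => ?_
    rw [mulX_mulX l i, smul_smul, ← neg_smul_end]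
    congr 1
    rw [sgn_comm (par l) (par i)]
    linear_combination mul_metric_symm hX i l
  have h2 : (2 : ℂ) • ∑ k, ∑ j, (X * metric m n) k j •
      (mulX k * mulX j : Module.End ℂ (SPoly m n)) = 0 := by
    rw [two_smul]
    exact add_eq_zero_iff_eq_neg.2 h
  exact (smul_eq_zero.1 h2).resolve_left two_ne_zero

/-- Multiplication by `R²` is `𝔬𝔰𝔭(m|2n)`-invariant. -/
lemma mulR2_glAct {X : SMat m n} (hX : X ∈ osp m n) :
    LinearMap.mulLeft ℂ (R2 m n) * glAct m n X = glAct m n X * LinearMap.mulLeft ℂ (R2 m n) := by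
  have h1 : LinearMap.mulLeft ℂ (R2 m n) * glAct m n X
      = ∑ i, ∑ j, ∑ k, ∑ l, (X k l * metric m n i j) •
      ((mulX i * mulX j) * (mulX k * der l) : Module.End ℂ (SPoly m n)) := by
    simp only [mulR2_eq, glAct_apply, Finset.sum_mul, Finset.mul_sum, smul_mul_smul_comm,
      mul_comm (X _ _)]
    exact sum_swap _
  have h2 : glAct m n X * LinearMap.mulLeft ℂ (R2 m n)
      = ∑ i, ∑ j, ∑ k, ∑ l, (X k l * metric m n i j) •
      ((mulX k * der l) * (mulX i * mulX j) : Module.End ℂ (SPoly m n)) := by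
    simp only [mulR2_eq, glAct_apply, Finset.sum_mul, Finset.mul_sum, smul_mul_smul_comm]
  have h3 : ∀ i j k l, (X k l * metric m n i j) •
        ((mulX k * der l) * (mulX i * mulX j) : Module.End ℂ (SPoly m n))
      = (X k l * metric m n i j) • ((mulX i * mulX j) * (mulX k * der l))
        + (X k l * metric m n i j * if l = i then (1 : ℂ) else 0) • (mulX k * mulX j)
        + (X k l * metric m n i j * (sgn (par l) (par i) * if l = j then (1 : ℂ) else 0)) •
          (mulX k * mulX i) := by
    intro i j k l
    by_cases hg : metric m n i j = 0
    · simp [hg]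
    · rw [elem_mulX_mulX (metric_even hg), smul_add, smul_add, smul_smul, smul_smul]
  have h4 : ∑ i, ∑ j, ∑ k, ∑ l, (X k l * metric m n i j * if l = i then (1 : ℂ) else 0) •
      (mulX k * mulX j : Module.End ℂ (SPoly m n)) = 0 := by
    rw [← sum_metric_mulX_mulX hX, sum_swap]
    refine Finset.sum_congr rfl fun k _ => ?_
    have e : ∀ l, ∑ i, ∑ j, (X k l * metric m n i j * if l = i then (1 : ℂ) else 0) •
        (mulX k * mulX j : Module.End ℂ (SPoly m n))
        = ∑ j, (X k l * metric m n l j) • (mulX k * mulX j) := by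
      intro l
      rw [Finset.sum_eq_single l]
      · simp
      · intro i _ hi; simp [Ne.symm hi]
      · simp
    simp only [e]
    rw [Finset.sum_comm]
    refine Finset.sum_congr rfl fun j _ => ?_
    rw [← Finset.sum_smul, Matrix.mul_apply]
  have h5 : ∑ i, ∑ j, ∑ k, ∑ l,
      (X k l * metric m n i j * (sgn (par l) (par i) * if l = j then (1 : ℂ) else 0)) •
        (mulX k * mulX i : Module.End ℂ (SPoly m n)) = 0 := by
    rw [← sum_metric_mulX_mulX hX, sum_swap]
    refine Finset.sum_congr rfl fun k _ => ?_
    have e : ∀ l i, ∑ j,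
        (X k l * metric m n i j * (sgn (par l) (par i) * if l = j then (1 : ℂ) else 0)) •
          (mulX k * mulX i : Module.End ℂ (SPoly m n))
        = (X k l * metric m n l i) • (mulX k * mulX i) := by
      intro l i
      rw [Finset.sum_eq_single l]
      · rw [metric_symm l i]
        simp only [if_true, mul_one]
        congr 1; ring
      · intro j _ hj; simp [Ne.symm hj]
      · simp
    simp only [e]
    rw [Finset.sum_comm]
    refine Finset.sum_congr rfl fun i _ => ?_
    rw [← Finset.sum_smul, Matrix.mul_apply]
  rw [h1, h2]
  simp only [h3, Finset.sum_add_distrib, h4, h5, add_zero]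

lemma euler_eq : euler m n = glAct m n 1 := by
  simp [euler, glAct_apply, Matrix.one_apply]

lemma isHomog_one : IsHomog 0 (1 : SMat m n) := by
  intro i j h
  have : i = j := by
    by_contra h2
    exact h (Matrix.one_apply_ne h2)
  subst this
  rcases zmod2_cases (par i) with h | h <;> rw [h] <;> rfl

lemma isHomog_add_isHomog (X : SMat m n) :
    ∃ X0 X1 : SMat m n, IsHomog 0 X0 ∧ IsHomog 1 X1 ∧ X = X0 + X1 := by
  refine ⟨Matrix.of fun i j => if par i + par j = 0 then X i j else 0,
    Matrix.of fun i j => if par i + par j = 1 then X i j else 0, ?_, ?_, ?_⟩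
  · intro i j h
    by_contra h2
    simp [h2] at h
  · intro i j h
    by_contra h2
    simp [h2] at h
  · ext i j
    rcases zmod2_cases (par i + par j) with h | h <;> simp [h]

lemma euler_glAct (X : SMat m n) : euler m n * glAct m n X = glAct m n X * euler m n := by
  have key : ∀ p (Y : SMat m n), IsHomog p Y →
      euler m n * glAct m n Y = glAct m n Y * euler m n := by
    intro p Y hY
    have h := glAct_sbracket isHomog_one hY
    rw [sbracket, sgn_zero_left, one_smul, one_smul, Matrix.one_mul, Matrix.mul_one, sub_self,
      map_zero] at h
    rw [euler_eq]
    exact (sub_eq_zero.1 h.symm)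
  obtain ⟨X0, X1, h0, h1, rfl⟩ := isHomog_add_isHomog X
  rw [map_add, mul_add, add_mul, key _ _ h0, key _ _ h1]

lemma parityP_glAct {p : ZMod 2} {X : SMat m n} (hX : IsHomog p X) :
    parityP * glAct m n X = sgn 1 p • (glAct m n X * parityP) := by
  simp only [glAct_apply, Finset.mul_sum, Finset.sum_mul, Finset.smul_sum]
  refine Finset.sum_congr rfl fun i _ => Finset.sum_congr rfl fun j _ => ?_
  by_cases h : X i j = 0
  · simp [h]
  rw [← hX i j h, mul_smul_comm, smul_mul_assoc, smul_comm, ← mul_assoc, parityP_mulX,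
    smul_mul_assoc, mul_assoc, parityP_der, mul_smul_comm, sgn_add_right]
  simp only [smul_smul, mul_assoc]

lemma parityP_even (x y : Idx m n → Module.End ℂ (SPoly m n))
    (hx : ∀ i, parityP * x i = sgn 1 (par i) • (x i * parityP))
    (hy : ∀ i, parityP * y i = sgn 1 (par i) • (y i * parityP)) {i j : Idx m n}
    (h : par i = par j) : parityP * (x i * y j) = x i * y j * parityP := by
  rw [← mul_assoc, hx, smul_mul_assoc, mul_assoc, hy, mul_smul_comm, smul_smul, h, sgn_mul_self,
    one_smul, mul_assoc]

lemma parityP_laplace : parityP * laplace m n = laplace m n * parityP := by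
  rw [laplace_eq]
  simp only [Finset.mul_sum, Finset.sum_mul]
  refine Finset.sum_congr rfl fun i _ => Finset.sum_congr rfl fun j _ => ?_
  by_cases h : gram m n j i = 0
  · simp [h]
  rw [mul_smul_comm, smul_mul_assoc,
    parityP_even der der parityP_der parityP_der (gram_even h).symm]

lemma parityP_mulR2 :
    parityP * LinearMap.mulLeft ℂ (R2 m n) = LinearMap.mulLeft ℂ (R2 m n) * parityP := by
  rw [mulR2_eq]
  simp only [Finset.mul_sum, Finset.sum_mul]
  refine Finset.sum_congr rfl fun i _ => Finset.sum_congr rfl fun j _ => ?_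
  by_cases h : metric m n i j = 0
  · simp [h]
  rw [mul_smul_comm, smul_mul_assoc,
    parityP_even mulX mulX parityP_mulX parityP_mulX (metric_even h)]

lemma parityP_euler : parityP * euler m n = euler m n * parityP := by
  rw [euler_eq, parityP_glAct isHomog_one, sgn_zero_right, one_smul]

/-! ## Representations of `𝔬𝔰𝔭(m|2n)` -/

/-- A representation of the Lie superalgebra `𝔬𝔰𝔭(m|2n)` on a complex super vector space `V`.
The `ℤ/2`-grading of `V` is recorded by its parity operator: an involution, whose eigenspaces for
`1` and `-1` are the even and the odd part of `V`. -/
structure OspRep (m n : ℕ) (V : Type*) [AddCommGroup V] [Module ℂ V] where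
  /-- the parity operator -/
  parity : Module.End ℂ V
  parity_sq : parity * parity = 1
  /-- the action -/
  act : osp m n →ₗ[ℂ] Module.End ℂ V
  parity_act : ∀ (p : ZMod 2) (X : osp m n), IsHomog p (X : SMat m n) →
    parity * act X = sgn 1 p • (act X * parity)
  act_bracket : ∀ (p q : ZMod 2) (X Y : osp m n) (hX : IsHomog p (X : SMat m n))
    (hY : IsHomog q (Y : SMat m n)),
    act ⟨sbracket p q X Y, sbracket_mem X.2 Y.2 hX hY⟩
      = act X * act Y - sgn p q • (act Y * act X)

namespace OspRep

variable {V W : Type*} [AddCommGroup V] [Module ℂ V] [AddCommGroup W] [Module ℂ W]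

/-- Subrepresentations: graded subspaces stable under the action. -/
def IsSubrep (ρ : OspRep m n V) (U : Submodule ℂ V) : Prop :=
  (∀ v ∈ U, ρ.parity v ∈ U) ∧ ∀ X, ∀ v ∈ U, ρ.act X v ∈ U

/-- Irreducibility. -/
def IsSimple (ρ : OspRep m n V) : Prop :=
  Nontrivial V ∧ ∀ U : Submodule ℂ V, ρ.IsSubrep U → U = ⊥ ∨ U = ⊤

/-- Isomorphism of representations, up to parity shift: a linear isomorphism that intertwines the
actions and either preserves or reverses the parity. -/
def Isomorphic (ρ : OspRep m n V) (σ : OspRep m n W) : Prop :=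
  ∃ e : V ≃ₗ[ℂ] W, (∀ X v, e (ρ.act X v) = σ.act X (e v)) ∧
    ((∀ v, e (ρ.parity v) = σ.parity (e v)) ∨ ∀ v, e (ρ.parity v) = -σ.parity (e v))

/-- The restriction of a representation to a subrepresentation. -/
def restrict (ρ : OspRep m n V) (U : Submodule ℂ V) (hU : ρ.IsSubrep U) : OspRep m n U where
  parity := ρ.parity.restrict hU.1
  parity_sq := by
    ext v
    exact LinearMap.congr_fun ρ.parity_sq (v : V)
  act :=
    { toFun := fun X => (ρ.act X).restrict (hU.2 X)
      map_add' := fun X Y => by ext v; simp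
      map_smul' := fun c X => by ext v; simp }
  parity_act := fun p X hX => by
    ext v
    exact LinearMap.congr_fun (ρ.parity_act p X hX) (v : V)
  act_bracket := fun p q X Y hX hY => by
    ext v
    exact LinearMap.congr_fun (ρ.act_bracket p q X Y hX hY) (v : V)

/-- The quotient of a representation by a subrepresentation. -/
def quotient (ρ : OspRep m n V) (U : Submodule ℂ V) (hU : ρ.IsSubrep U) : OspRep m n (V ⧸ U) where
  parity := U.mapQ U ρ.parity hU.1
  parity_sq := by
    ext v
    exact congrArg U.mkQ (LinearMap.congr_fun ρ.parity_sq v)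
  act :=
    { toFun := fun X => U.mapQ U (ρ.act X) (hU.2 X)
      map_add' := fun X Y => by ext v; simp
      map_smul' := fun c X => by ext v; simp }
  parity_act := fun p X hX => by
    ext v
    exact congrArg U.mkQ (LinearMap.congr_fun (ρ.parity_act p X hX) v)
  act_bracket := fun p q X Y hX hY => by
    ext v
    exact congrArg U.mkQ (LinearMap.congr_fun (ρ.act_bracket p q X Y hX hY) v)

end OspRep

/-! ### Weights -/

/-- Indices of the coordinates `ε_1, …, ε_{⌊m/2⌋}` and `δ_1, …, δ_n` of a weight. -/
abbrev WIdx (m n : ℕ) : Type := Fin (m / 2) ⊕ Fin n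

/-- The first and the second coordinate of the `j`-th pair of bosonic variables. -/
def bosFst (j : Fin (m / 2)) : Idx m n := .inl ⟨2 * j.1, by omega⟩

/-- See `bosFst`. -/
def bosSnd (j : Fin (m / 2)) : Idx m n := .inl ⟨2 * j.1 + 1, by omega⟩

/-- The basis of the Cartan subalgebra dual to the `ε_j` and `δ_j`. For the `j`-th pair of bosonic
variables, `x, y` say, it is the operator `i (y ∂_x - x ∂_y)`, for which `x + i y` has weight `ε_j`;
for the `j`-th pair of Grassmann variables, `θ, η` say, it is `θ ∂_θ - η ∂_η`. -/
def cartan (m n : ℕ) : WIdx m n → SMat m n :=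
  Sum.elim
    (fun j => Complex.I • (Matrix.single (bosSnd j) (bosFst j) (1 : ℂ)
      - Matrix.single (bosFst j) (bosSnd j) (1 : ℂ)))
    (fun j => Matrix.single (.inr (j, 0)) (.inr (j, 0)) (1 : ℂ)
      - Matrix.single (.inr (j, 1)) (.inr (j, 1)) (1 : ℂ))

lemma cartan_mem (a : WIdx m n) : cartan m n a ∈ osp m n := by
  rw [mem_osp_iff]
  rcases a with a | a
  · have h : gram m n * cartan m n (.inl a) = cartan m n (.inl a) := by
      ext i j
      rcases i with i | i <;>
        simp [cartan, bosFst, bosSnd, gram, Matrix.mul_apply, Matrix.single_apply,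
          Fintype.sum_sum_type, Matrix.one_apply]
    rw [h]
    intro i j
    rcases i with i | i <;> rcases j with j | j <;>
      simp [cartan, bosFst, bosSnd, Matrix.single_apply, par, sgn, and_comm]
    ring
  · intro i j
    rcases i with i | ⟨b, r⟩ <;> rcases j with j | ⟨c, s⟩ <;>
      simp [cartan, gram, Matrix.mul_apply, Matrix.single_apply, Fintype.sum_sum_type,
        Fintype.sum_prod_type, Matrix.one_apply, par, sgn]
    by_cases h1 : a = b
    · by_cases h2 : a = c
      · subst h1 h2
        fin_cases r <;> fin_cases s <;> simp
      · simp [h2]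
    · simp [h1]

/-- The weight `ε_j`. -/
def eps (j : Fin (m / 2)) : WIdx m n → ℂ := Pi.single (.inl j) 1

/-- The weight `δ_j`. -/
def del (j : Fin n) : WIdx m n → ℂ := Pi.single (.inr j) 1

/-- The positive roots: `ε_i ± ε_j` for `i < j`, `δ_i ± δ_j` for `i < j`, `2 δ_i`, `ε_i ± δ_j`, and,
for odd `m`, also `ε_i` and `δ_j`. -/
def IsPosRoot (α : WIdx m n → ℂ) : Prop :=
  (∃ i j : Fin (m / 2), i < j ∧ (α = eps i - eps j ∨ α = eps i + eps j)) ∨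
  (∃ i j : Fin n, i < j ∧ (α = del i - del j ∨ α = del i + del j)) ∨
  (∃ i : Fin n, α = (2 : ℂ) • del i) ∨
  (∃ (i : Fin (m / 2)) (j : Fin n), α = eps i - del j ∨ α = eps i + del j) ∨
  (Odd m ∧ ((∃ i : Fin (m / 2), α = eps i) ∨ ∃ j : Fin n, α = del j))

/-- `X` is a root vector for `α`, i.e. `[h, X] = α(h) X` for all `h` in the Cartan subalgebra. -/
def IsRootVector (α : WIdx m n → ℂ) (X : osp m n) : Prop :=
  ∀ a, cartan m n a * (X : SMat m n) - (X : SMat m n) * cartan m n a = α a • (X : SMat m n)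

namespace OspRep

variable {V : Type*} [AddCommGroup V] [Module ℂ V]

/-- `v` is a highest weight vector of weight `Λ`: a nonzero vector of weight `Λ` that is
annihilated by all positive root vectors. -/
def IsHighestWeightVector (ρ : OspRep m n V) (Λ : WIdx m n → ℂ) (v : V) : Prop :=
  v ≠ 0 ∧ (∀ a, ρ.act ⟨cartan m n a, cartan_mem a⟩ v = Λ a • v) ∧
    ∀ α, IsPosRoot α → ∀ X, IsRootVector α X → ρ.act X v = 0

/-- The representation is the simple highest weight module of highest weight `Λ`. (It is
automatically generated by its highest weight vector.) -/
def IsSimpleHighestWeight (ρ : OspRep m n V) (Λ : WIdx m n → ℂ) : Prop :=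
  ρ.IsSimple ∧ ∃ v, ρ.IsHighestWeightVector Λ v

end OspRep

/-- The weight `(k, 0, …, 0)`. -/
def firstWeight (m n k : ℕ) : WIdx m n → ℂ :=
  Sum.elim (fun j => if j.1 = 0 then (k : ℂ) else 0) (fun _ => 0)

/-! ### Superpolynomials and spherical harmonics as representations -/

/-- The representation of `𝔬𝔰𝔭(m|2n)` on superpolynomials. -/
def polyRep (m n : ℕ) : OspRep m n (SPoly m n) where
  parity := parityP
  parity_sq := parityP_sq
  act := (glAct m n).comp (osp m n).subtype
  parity_act := fun _ _ hX => parityP_glAct hX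
  act_bracket := fun _ _ _ _ hX hY => glAct_sbracket hX hY

lemma euler_commute {T : Module.End ℂ (SPoly m n)} (hT : euler m n * T = T * euler m n) (d : ℤ)
    {f : SPoly m n} (hf : f ∈ homog m n d) : T f ∈ homog m n d := by
  have h : euler m n f = (d : ℂ) • f := by
    simpa [homog, sub_eq_zero] using hf
  have h2 := LinearMap.congr_fun hT f
  simp only [Module.End.mul_apply, h, map_smul] at h2
  simp [homog, h2]

lemma harm_isSubrep (m n k : ℕ) : (polyRep m n).IsSubrep (harm m n k) := by
  have key : ∀ T : Module.End ℂ (SPoly m n), euler m n * T = T * euler m n →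
      laplace m n * T = T * laplace m n → ∀ f ∈ harm m n k, T f ∈ harm m n k := by
    rintro T h1 h2 f ⟨hf1, hf2⟩
    refine ⟨euler_commute h1 _ hf1, ?_⟩
    have h3 := LinearMap.congr_fun h2 f
    simp only [Module.End.mul_apply, LinearMap.mem_ker.1 hf2, map_zero] at h3
    exact h3
  exact ⟨key _ parityP_euler.symm parityP_laplace.symm,
    fun X => key _ (euler_glAct _) (laplace_glAct X.2)⟩

lemma R2homog_isSubrep (m n k : ℕ) : (polyRep m n).IsSubrep (R2homog m n k) := by
  have key : ∀ T : Module.End ℂ (SPoly m n), euler m n * T = T * euler m n →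
      LinearMap.mulLeft ℂ (R2 m n) * T = T * LinearMap.mulLeft ℂ (R2 m n) →
      ∀ f ∈ R2homog m n k, T f ∈ R2homog m n k := by
    rintro T h1 h2 _ ⟨f, hf, rfl⟩
    exact ⟨T f, euler_commute h1 _ hf, LinearMap.congr_fun h2 f⟩
  exact ⟨key _ parityP_euler.symm parityP_mulR2.symm,
    fun X => key _ (euler_glAct _) (mulR2_glAct X.2)⟩

/-- The representation of `𝔬𝔰𝔭(m|2n)` on the spherical harmonics `ℋ_k`. -/
def harmRep (m n k : ℕ) : OspRep m n (harm m n k) :=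
  (polyRep m n).restrict (harm m n k) (harm_isSubrep m n k)

/-- `ℋ_k ∩ R² 𝒫_{k-2}` as a subspace of `ℋ_k`. -/
def harmCap (m n k : ℕ) : Submodule ℂ (harm m n k) := (R2homog m n k).submoduleOf (harm m n k)

lemma harmCap_isSubrep (m n k : ℕ) : (harmRep m n k).IsSubrep (harmCap m n k) :=
  ⟨fun f hf => (R2homog_isSubrep m n k).1 f.1 hf, fun X f hf => (R2homog_isSubrep m n k).2 X f.1 hf⟩

/-- The representation of `𝔬𝔰𝔭(m|2n)` on `ℋ_k / (ℋ_k ∩ R² 𝒫_{k-2})`. -/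
def quotRep (m n k : ℕ) : OspRep m n (harm m n k ⧸ harmCap m n k) :=
  (harmRep m n k).quotient (harmCap m n k) (harmCap_isSubrep m n k)

/-- The range `M ∈ -2ℕ`, `2 - M/2 ≤ k ≤ 2 - M`, where `M = m - 2n` is the superdimension. -/
def IsExceptional (m n k : ℕ) : Prop :=
  ∃ M : ℤ, M = (m : ℤ) - 2 * n ∧ (∃ j : ℕ, M = -(2 * (j : ℤ))) ∧
    2 - (M : ℚ) / 2 ≤ k ∧ (k : ℤ) ≤ 2 - M

/-- The sum
`∑_{i=0}^{min(k,2n)} C(2n,i) C(k-i+m-1,m-1) - ∑_{i=0}^{min(k-2,2n)} C(2n,i) C(k-i+m-3,m-1)`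
(a sum whose upper limit is negative is empty). -/
def mainDim (m n k : ℕ) : ℤ :=
  ∑ i ∈ Finset.Icc (0 : ℤ) (min k (2 * n)),
      ((2 * n).choose i.toNat : ℤ) * ((k - i + m - 1).toNat.choose (m - 1) : ℤ)
    - ∑ i ∈ Finset.Icc (0 : ℤ) (min (k - 2) (2 * n)),
      ((2 * n).choose i.toNat : ℤ) * ((k - i + m - 3).toNat.choose (m - 1) : ℤ)

/-- The correction term, with `M = m - 2n`,
`∑_{i=0}^{min(-M-k,2n)} C(2n,i) C(2n-k-i-1,m-1) - ∑_{i=0}^{min(2-M-k,2n)} C(2n,i) C(2n-k-i+1,m-1)`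
(a sum whose upper limit is negative is empty). -/
def correctionDim (m n k : ℕ) : ℤ :=
  ∑ i ∈ Finset.Icc (0 : ℤ) (min (-(m - 2 * n) - k) (2 * n)),
      ((2 * n).choose i.toNat : ℤ) * ((2 * n - k - i - 1).toNat.choose (m - 1) : ℤ)
    - ∑ i ∈ Finset.Icc (0 : ℤ) (min (2 - (m - 2 * n) - k) (2 * n)),
      ((2 * n).choose i.toNat : ℤ) * ((2 * n - k - i + 1).toNat.choose (m - 1) : ℤ)

end

end SuperHarm

namespace SuperHarm

noncomputable section

section

variable {m n : ℕ}


/-! The operators R², ∇² and the Euler operator E span, up to constants, an sl₂ that commutes with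
osp(m|2n), and [∇², R²] = 4E + 2M (`laplace_mulR2`). This relation decides which multiples of R² are
harmonic. If f = R^{2j}h has degree k, j > 0 and h is not divisible by R², then ∇²f = 0 forces ∇²h =
0 and j = k - 1 + M/2 (`exists_of_mem_harm_inf`). The conditions j ≥ 1 and 2j ≤ k are exactly the
exceptional range. There H_k ∩ R²P_{k-2} = R^{2j}H_{2-M-k}; otherwise the intersection is zero.
Since R² is injective (`mulR2_injective`) and ∇² is surjective (`exists_laplace_eq`), all dimensions
reduce to counting monomials.

For irreducibility, put z = x_1 + c x_2 and z̄ = x_1 - c x_2 with c² = -1, and grade harmonics by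
the rotation z∂_z - z̄∂_z̄. Setting z = 1, z̄ = 0 maps harmonics of degree k and weight s ≥ 0
injectively into superpolynomials of degree k - s in the remaining variables
(`eq_zero_of_ev_eq_zero`), and lowering z^k realizes every such restriction
(`exists_mem_lvl_ev_eq`). Exchanging z and z̄ treats the weights s ≤ 0. So z^k and z̄^k together
generate H_k.

Conversely, a submodule of H_k not contained in the intersection with R²P_{k-2} contains z^k. Among
its weight vectors outside the intersection, take one of maximal weight; all raising operators send
it into the intersection. After restriction to p this reads ∂^a p + X_a∇²p/(2(s+1)) ≡ 0 for every a
when s ≥ 0, and X_a p ≡ 0 when s < 0. Contracting over a, once with coordinates and once with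
derivatives, gives scalar equations that force p ≡ 0 unless s = k (`eq_zero_of_singular`,
`mem_map_of_singular`). When no further bosonic variable is left, R² in the remaining variables is
nilpotent, and the bound k ≤ n replaces its injectivity.

Finally, two simple modules with the same highest weight are compared through the submodule of their
direct sum generated by the pair of highest weight vectors; it is the graph of an isomorphism
(`exists_equiv_of_isSingular`). -/

lemma smul_sub_end (c : ℂ) (x y : Module.End ℂ (SPoly m n)) : c • (x - y) = c • x - c • y :=
  smul_sub c x y

lemma sgn_smul_sgn (p q : ZMod 2) (x : Module.End ℂ (SPoly m n)) : sgn p q • sgn p q • x = x := by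
  rw [smul_smul, sgn_mul_self, one_smul]

/-! ### Contraction identities and the sl₂ relations between R², ∇² and E. -/

/-- Left multiplication by `R²`. -/
abbrev mulR2 (m n : ℕ) : Module.End ℂ (SPoly m n) := LinearMap.mulLeft ℂ (R2 m n)

/-- The derivative dual to `X_a` with respect to the form. -/
def flatD (a : Idx m n) : Module.End ℂ (SPoly m n) := ∑ j, gram m n a j • der j

/-- Multiplication by the coordinate dual to `X_a` with respect to the form. -/
def upX (a : Idx m n) : Module.End ℂ (SPoly m n) := ∑ j, metric m n j a • mulX j

/-- The derivative `(-1)^[a] ∂_a`. -/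
def sD (a : Idx m n) : Module.End ℂ (SPoly m n) := sgn (par a) (par a) • der a

lemma der_eq_sum_flatD (j : Idx m n) : der j = ∑ a, metric m n j a • flatD a := by
  simp only [flatD, Finset.smul_sum, smul_smul]
  rw [Finset.sum_comm]
  simp only [← Finset.sum_smul, ← Matrix.mul_apply, metric_mul_gram]
  simp [Matrix.one_apply]

/-- The families `upX` and `sD` are contracted against `flatD` and `mulX`; the four sums are E, R²,
∇² and M + E. Later they turn a system of equations indexed by a coordinate into scalar equations.
-/
lemma sum_upX_mul_flatD : ∑ a, upX a * flatD a = euler m n := by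
  simp only [euler, der_eq_sum_flatD, upX, Finset.sum_mul, Finset.mul_sum, smul_mul_assoc,
    mul_smul_comm]
  rw [Finset.sum_comm]

lemma sum_upX_mul_mulX : ∑ a, upX a * mulX a = mulR2 m n := by
  simp only [mulR2, mulR2_eq, upX, Finset.sum_mul, smul_mul_assoc]
  rw [Finset.sum_comm]

lemma sum_sD_mul_flatD : ∑ a, sD a * flatD a = laplace m n := by
  simp only [laplace_eq, flatD, sD, Finset.mul_sum, smul_mul_assoc, mul_smul_comm, smul_smul]
  refine Finset.sum_congr rfl fun a _ => Finset.sum_congr rfl fun j _ => ?_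
  congr 1
  by_cases h : gram m n j a = 0
  · rw [gram_symm, h]; simp
  · rw [gram_symm a j, gram_even h]
    linear_combination gram m n j a * sgn_mul_self (par a) (par a)

/-- The sign in `sD` makes each bosonic index contribute 1 and each Grassmann index -1, so the
constant is the supertrace of the identity, m - 2n. -/
lemma sum_sD_mul_mulX : ∑ a, sD a * mulX a = ((m : ℂ) - 2 * n) • 1 + euler m n := by
  simp only [sD, smul_mul_assoc, der_mulX, euler, smul_add, Finset.sum_add_distrib, smul_smul,
    sgn_mul_self, one_smul]
  congr 1
  simp only [Fintype.sum_sum_type]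
  have h1 : (-1 : ℂ) • (1 : Module.End ℂ (SPoly m n)) = -1 := by rw [neg_smul_end, one_smul]
  simp [par, sgn, h1, sub_eq_add_neg]
  refine LinearMap.ext fun x : SPoly m n => ?_
  simp [← Nat.cast_smul_eq_nsmul ℂ]
  have e1 : ∀ a b : ℂ, a • x + -(b • x) = (a + -b) • x := fun a b => by rw [add_smul]; exact congrArg _ (neg_smul b x).symm
  rw [← e1, mul_smul]

lemma mulR2_mulX (a : Idx m n) : mulR2 m n * mulX a = mulX a * mulR2 m n := by
  simp only [mulR2, mulR2_eq, Finset.sum_mul, Finset.mul_sum, smul_mul_assoc, mul_smul_comm]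
  refine Finset.sum_congr rfl fun i _ => Finset.sum_congr rfl fun j _ => ?_
  by_cases h : metric m n i j = 0
  · simp [h]
  rw [mul_assoc, mulX_mulX j a, mul_smul_comm, ← mul_assoc, mulX_mulX i a, smul_mul_assoc,
    metric_even h, sgn_smul_sgn, mul_assoc]

lemma der_mulR2 (a : Idx m n) :
    der a * mulR2 m n = mulR2 m n * der a + (2 : ℂ) • ∑ j, metric m n a j • mulX j := by
  have key : ∀ i j : Idx m n, par i = par j → der a * (mulX i * mulX j) =
      mulX i * mulX j * der a + ((if a = i then (1 : ℂ) else 0) • mulX j +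
      (if a = j then (1 : ℂ) else 0) • sgn (par a) (par i) •
        (mulX i : Module.End ℂ (SPoly m n))) := by
    intro i j hij
    rw [← mul_assoc, der_mulX, add_mul, smul_mul_assoc, mul_assoc (mulX i), der_mulX, mul_add,
      smul_add, mul_smul_comm, smul_smul, hij, sgn_mul_self, one_smul]
    split_ifs <;> simp [mul_assoc] <;> abel
  have h1 : der a * mulR2 m n - mulR2 m n * der a = ∑ i, ∑ j, metric m n i j •
      ((if a = i then (1 : ℂ) else 0) • mulX j +
      (if a = j then (1 : ℂ) else 0) • sgn (par a) (par i) •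
        (mulX i : Module.End ℂ (SPoly m n))) := by
    simp only [mulR2, mulR2_eq, Finset.sum_mul, Finset.mul_sum, smul_mul_assoc, mul_smul_comm,
      ← Finset.sum_sub_distrib, ← smul_sub_end]
    refine Finset.sum_congr rfl fun i _ => Finset.sum_congr rfl fun j _ => ?_
    by_cases h : metric m n i j = 0
    · simp [h]
    rw [key _ _ (metric_even h), add_sub_cancel_left]
  rw [← sub_eq_iff_eq_add', h1]
  simp only [smul_add, Finset.sum_add_distrib, two_smul]
  congr 1
  · rw [Finset.sum_eq_single a]
    · simp
    · intro b _ hb; simp [Ne.symm hb]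
    · simp
  · refine Finset.sum_congr rfl fun i _ => ?_
    rw [Finset.sum_eq_single a]
    · rw [metric_symm a i, if_pos rfl, one_smul, smul_smul, mul_comm]
    · intro b _ hb; simp [Ne.symm hb]
    · simp

lemma sD_mulR2 (a : Idx m n) :
    sD a * mulR2 m n = mulR2 m n * sD a + (2 : ℂ) • upX a := by
  rw [sD, smul_mul_assoc, der_mulR2, smul_add, mul_smul_comm, smul_comm, Finset.smul_sum, upX]
  congr 2
  refine Finset.sum_congr rfl fun j _ => ?_
  by_cases h : metric m n a j = 0
  · rw [metric_symm j a, h]; simp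
  rw [smul_smul, metric_symm a j, ← metric_even h, ← mul_assoc, sgn_mul_self, one_mul]

lemma flatD_mulR2 (a : Idx m n) :
    flatD a * mulR2 m n = mulR2 m n * flatD a + (2 : ℂ) • mulX a := by
  simp only [flatD, Finset.sum_mul, smul_mul_assoc, der_mulR2, smul_add, Finset.sum_add_distrib,
    Finset.mul_sum, mul_smul_comm]
  congr 1
  simp only [smul_comm (_ : ℂ) (2 : ℂ), ← Finset.smul_sum]
  congr 1
  simp only [Finset.smul_sum, smul_smul]
  rw [Finset.sum_comm]
  simp only [← Finset.sum_smul, ← Matrix.mul_apply, gram_mul_metric]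
  simp [Matrix.one_apply]

lemma euler_mulX (a : Idx m n) : euler m n * mulX a = mulX a * euler m n + mulX a := by
  have h : ∀ i : Idx m n, mulX i * der i * mulX a = mulX a * (mulX i * der i) +
      (if i = a then (1 : ℂ) else 0) • (mulX a : Module.End ℂ (SPoly m n)) := by
    intro i
    rw [mul_assoc, der_mulX, mul_add, mul_smul_comm, ← mul_assoc, mulX_mulX i a, smul_mul_assoc,
      sgn_smul_sgn, mul_assoc]
    split_ifs with hi
    · subst hi; simp [add_comm]
    · simp
  simp only [euler, Finset.sum_mul, h, Finset.sum_add_distrib, Finset.mul_sum]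
  simp

lemma euler_der (a : Idx m n) : euler m n * der a = der a * euler m n - der a := by
  have h : ∀ i : Idx m n, der a * (mulX i * der i) = mulX i * der i * der a +
      (if i = a then (1 : ℂ) else 0) • (der a : Module.End ℂ (SPoly m n)) := by
    intro i
    rw [← mul_assoc, der_mulX, add_mul, smul_mul_assoc, mul_assoc (mulX i), der_der a i,
      mul_smul_comm, smul_smul, sgn_mul_self, one_smul, mul_assoc]
    split_ifs with h1 h2 h2
    · subst h1; simp [add_comm]
    · exact absurd h1.symm h2
    · exact absurd h2.symm h1
    · simp
  simp only [euler, Finset.sum_mul, h, Finset.sum_add_distrib, Finset.mul_sum]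
  simp

lemma euler_mulR2 : euler m n * mulR2 m n = mulR2 m n * euler m n + (2 : ℂ) • mulR2 m n := by
  simp only [← sum_upX_mul_mulX, upX, Finset.sum_mul, Finset.mul_sum, smul_mul_assoc,
    mul_smul_comm, Finset.smul_sum, ← Finset.sum_add_distrib]
  refine Finset.sum_congr rfl fun a _ => Finset.sum_congr rfl fun j _ => ?_
  rw [← mul_assoc, euler_mulX, add_mul, mul_assoc, euler_mulX, mul_add, two_smul]
  simp only [mul_assoc, smul_add]
  abel

lemma euler_laplace : euler m n * laplace m n = laplace m n * euler m n - (2 : ℂ) • laplace m n := by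
  simp only [laplace_eq, Finset.sum_mul, Finset.mul_sum, smul_mul_assoc,
    mul_smul_comm, Finset.smul_sum, ← Finset.sum_sub_distrib]
  refine Finset.sum_congr rfl fun a _ => Finset.sum_congr rfl fun j _ => ?_
  rw [← mul_assoc, euler_der, sub_mul, mul_assoc, euler_der, mul_sub, two_smul]
  simp only [mul_assoc, smul_sub_end]
  abel

/-- Writing ∇² = ∑ `sD a * flatD a` and moving R² to the left leaves 2∑ `upX a * flatD a` = 2E and
2∑ `sD a * mulX a` = 2(M + E). -/
lemma laplace_mulR2 : laplace m n * mulR2 m n = mulR2 m n * laplace m n +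
    ((4 : ℂ) • euler m n + (2 * ((m : ℂ) - 2 * n)) • 1) := by
  have h : ∀ a : Idx m n, sD a * flatD a * mulR2 m n = mulR2 m n * (sD a * flatD a)
      + (2 : ℂ) • (upX a * flatD a) + (2 : ℂ) • (sD a * mulX a) := by
    intro a
    rw [mul_assoc, flatD_mulR2, mul_add, ← mul_assoc, sD_mulR2, mul_smul_comm, add_mul,
      smul_mul_assoc, mul_assoc]
  rw [← sum_sD_mul_flatD, Finset.sum_mul]
  simp only [h, Finset.sum_add_distrib, ← Finset.mul_sum, ← Finset.smul_sum, sum_upX_mul_flatD,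
    sum_sD_mul_mulX, sum_sD_mul_flatD]
  rw [smul_add, smul_smul, add_assoc]
  congr 1
  rw [show (4 : ℂ) = 2 + 2 by norm_num, add_smul]
  abel

lemma der_laplace (a : Idx m n) : der a * laplace m n = laplace m n * der a := by
  simp only [laplace_eq, Finset.sum_mul, Finset.mul_sum, smul_mul_assoc, mul_smul_comm]
  refine Finset.sum_congr rfl fun i _ => Finset.sum_congr rfl fun j _ => ?_
  by_cases h : gram m n j i = 0
  · simp [h]
  rw [← mul_assoc, der_der a i, smul_mul_assoc, mul_assoc, der_der a j, mul_smul_comm,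
    gram_even h, sgn_smul_sgn, mul_assoc]

/-! ### Homogeneous superpolynomials -/

lemma mem_homog {d : ℤ} {f : SPoly m n} : f ∈ homog m n d ↔ euler m n f = (d : ℂ) • f := by
  simp [homog, sub_eq_zero]

lemma mulX_mem_homog {d : ℤ} {f : SPoly m n} (hf : f ∈ homog m n d) (a : Idx m n) :
    mulX a f ∈ homog m n (d + 1) := by
  rw [mem_homog] at *
  have := LinearMap.congr_fun (euler_mulX a) f
  simp only [Module.End.mul_apply, LinearMap.add_apply, hf, map_smul] at this
  rw [this]; push_cast; rw [add_smul, one_smul]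

lemma der_mem_homog {d : ℤ} {f : SPoly m n} (hf : f ∈ homog m n d) (a : Idx m n) :
    der a f ∈ homog m n (d - 1) := by
  rw [mem_homog] at *
  have := LinearMap.congr_fun (euler_der a) f
  simp only [Module.End.mul_apply, LinearMap.sub_apply, hf, map_smul] at this
  rw [this]; push_cast; rw [sub_smul, one_smul]

lemma laplace_mem_homog {d : ℤ} {f : SPoly m n} (hf : f ∈ homog m n d) :
    laplace m n f ∈ homog m n (d - 2) := by
  rw [mem_homog] at *
  have := LinearMap.congr_fun (euler_laplace (m := m) (n := n)) f
  simp only [Module.End.mul_apply, LinearMap.sub_apply, hf, map_smul, LinearMap.smul_apply] at this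
  rw [this]; push_cast; rw [sub_smul]

lemma mulR2_mem_homog {d : ℤ} {f : SPoly m n} (hf : f ∈ homog m n d) :
    mulR2 m n f ∈ homog m n (d + 2) := by
  rw [mem_homog] at *
  have := LinearMap.congr_fun (euler_mulR2 (m := m) (n := n)) f
  simp only [Module.End.mul_apply, LinearMap.add_apply, hf, map_smul, LinearMap.smul_apply] at this
  rw [this]; push_cast; rw [add_smul]

lemma mulR2_pow_mem_homog {d : ℤ} {f : SPoly m n} (hf : f ∈ homog m n d) (i : ℕ) :
    (mulR2 m n ^ i) f ∈ homog m n (d + 2 * i) := by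
  induction i with
  | zero => simpa using hf
  | succ i ih =>
    rw [pow_succ', Module.End.mul_apply]
    have := mulR2_mem_homog ih
    push_cast
    rwa [show d + 2 * ((i : ℤ) + 1) = d + 2 * i + 2 by ring]

/-- Passing ∇² over one factor R² in front of a polynomial of degree d + 2r costs 4(d + 2r) + 2M;
the coefficient is the sum of this over r = 0, …, i. Its zeros are the source of the exceptional
range. -/
lemma laplace_mulR2_pow {d : ℤ} {f : SPoly m n} (hf : f ∈ homog m n d) (i : ℕ) :
    laplace m n ((mulR2 m n ^ (i + 1)) f) = (mulR2 m n ^ (i + 1)) (laplace m n f) +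
      (2 * ((i : ℂ) + 1) * (2 * d + (m - 2 * n) + 2 * i)) • (mulR2 m n ^ i) f := by
  have key : ∀ (e : ℤ) (g : SPoly m n), g ∈ homog m n e → laplace m n (mulR2 m n g)
      = mulR2 m n (laplace m n g) + (4 * (e : ℂ) + 2 * (m - 2 * n)) • g := by
    intro e g hg
    have := LinearMap.congr_fun (laplace_mulR2 (m := m) (n := n)) g
    rw [mem_homog] at hg
    simp only [Module.End.mul_apply, LinearMap.add_apply, hg, LinearMap.smul_apply,
      Module.End.one_apply] at this
    rw [this, smul_smul, ← add_smul]
  induction i with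
  | zero =>
    rw [zero_add, pow_one, key d f hf]
    simp
    congr 1; ring
  | succ i ih =>
    rw [pow_succ' _ (i + 1), Module.End.mul_apply, key _ _ (mulR2_pow_mem_homog hf (i + 1)), ih,
      map_add, map_smul, ← Module.End.mul_apply (mulR2 m n), ← Module.End.mul_apply (mulR2 m n),
      ← pow_succ', ← pow_succ', add_assoc, ← add_smul]
    congr 2
    push_cast; ring

end

section

variable {m n : ℕ}


/-! ### The monomial basis -/

/-- The basis of superpolynomials by monomials. -/
def monoBasis (m n : ℕ) :
    Module.Basis ((Fin m →₀ ℕ) × Finset (Fin n ×ₗ Fin 2)) ℂ (SPoly m n) :=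
  (MvPolynomial.basisMonomials (Fin m) ℂ).tensorProduct
    ((Pi.basisFun ℂ (Fin n × Fin 2)).reindex toLex).ExteriorAlgebra

/-- The degree of a monomial. -/
def monoDeg (p : (Fin m →₀ ℕ) × Finset (Fin n ×ₗ Fin 2)) : ℕ := p.1.degree + p.2.card

/-- Monomials arise from 1 by multiplication with coordinates. Keeping track of the degree lets one
induction yield the degree of a monomial, the description of degree zero, and generation by
coordinates. -/
lemma monoBasis_mem {U : ℕ → Submodule ℂ (SPoly m n)} (h0 : (1 : SPoly m n) ∈ U 0)
    (hU : ∀ d, ∀ f ∈ U d, ∀ a, mulX a f ∈ U (d + 1)) (p) : monoBasis m n p ∈ U (monoDeg p) := by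
  have e1 : ∀ l : List (Fin n × Fin 2), tm 1 (l.map fun a =>
      ExteriorAlgebra.ι ℂ (Pi.single a (1 : ℂ))).prod ∈ U l.length := by
    intro l
    induction l with
    | nil => exact h0
    | cons a l ih =>
      have := hU _ _ ih (.inr a)
      rw [mulX_inr] at this
      simpa using this
  have e2 : ∀ (α : Fin m →₀ ℕ) (d : ℕ) (f g), tm f g ∈ U d →
      tm (MvPolynomial.monomial α 1 * f) g ∈ U (α.degree + d) := by
    intro α
    induction α using Finsupp.induction_linear with
    | zero => intro d f g hg; simpa using hg
    | add α β h1 h2 =>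
      intro d f g hg
      have := h1 _ _ _ (h2 _ _ _ hg)
      rwa [← mul_assoc, MvPolynomial.monomial_mul, one_mul, ← add_assoc, ← map_add] at this
    | single i k =>
      intro d f g hg
      rw [Finsupp.degree_single, ← MvPolynomial.X_pow_eq_monomial]
      induction k with
      | zero => simpa using hg
      | succ k ih =>
        have := hU _ _ ih (.inl i)
        rw [mulX_inl, ← mul_assoc, ← pow_succ'] at this
        rwa [add_right_comm]
  obtain ⟨α, A⟩ := p
  have e3 : monoBasis m n (α, A) = tm (MvPolynomial.monomial α 1)
      ((((Pi.basisFun ℂ (Fin n × Fin 2)).reindex toLex).ExteriorAlgebra) A) := by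
    rw [monoBasis]
    refine (Module.Basis.tensorProduct_apply _ _ _ _).trans ?_
    rw [MvPolynomial.coe_basisMonomials]
    rfl
  rw [e3, monoDeg]
  rw [← mul_one (MvPolynomial.monomial α 1)]
  refine e2 _ _ _ _ ?_
  rw [ExteriorAlgebra.basis_apply]
  change tm 1 (ExteriorAlgebra.ιMulti ℂ _ _) ∈ _
  rw [ExteriorAlgebra.ιMulti_apply]
  have := e1 (List.ofFn fun i => ofLex ((Set.powersetCard.ofFinEmbEquiv.symm
    (Set.powersetCard.prodEquiv.symm A).2) i))
  rw [List.length_ofFn, List.map_ofFn] at this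
  refine Eq.mp ?_ this
  congr 3
  ext i
  simp
  rfl

/-- Applying the i-th coordinate functional to T x = e x gives (c i - e) x_i = 0, so only basis
vectors with eigenvalue e occur in x. -/
lemma ker_sub_eq_span {ι V : Type*} [AddCommGroup V] [Module ℂ V] (b : Module.Basis ι ℂ V)
    (T : Module.End ℂ V) (c : ι → ℂ) (h : ∀ i, T (b i) = c i • b i) (e : ℂ)
    (P : ι → Prop) (hP : ∀ i, c i = e ↔ P i) :
    LinearMap.ker (T - e • LinearMap.id) =
      Submodule.span ℂ (Set.range fun i : {i // P i} => b i) := by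
  apply le_antisymm
  · intro x hx
    have h1 : ∀ i, (c i - e) * b.repr x i = 0 := by
      intro i
      have h2 : b.coord i ∘ₗ T = c i • b.coord i := b.ext fun j => by
        by_cases hj : j = i
        · subst hj; simp [h]
        · simp [h, hj]
      have h3 := LinearMap.congr_fun h2 x
      rw [LinearMap.mem_ker, LinearMap.sub_apply, sub_eq_zero] at hx
      simp only [LinearMap.comp_apply, hx, LinearMap.smul_apply, LinearMap.id_apply, map_smul,
        Module.Basis.coord_apply, smul_eq_mul] at h3
      linear_combination -h3
    rw [← b.linearCombination_repr x, Finsupp.linearCombination_apply]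
    refine Submodule.sum_mem _ fun i hi => Submodule.smul_mem _ _ (Submodule.subset_span ?_)
    refine ⟨⟨i, (hP i).1 ?_⟩, rfl⟩
    have := h1 i
    rw [mul_eq_zero] at this
    exact sub_eq_zero.1 (this.resolve_right (Finsupp.mem_support_iff.1 hi))
  · rw [Submodule.span_le]
    rintro _ ⟨⟨i, hi⟩, rfl⟩
    simp [h, (hP i).2 hi]

lemma monoBasis_mem_homog (p) : monoBasis m n p ∈ homog m n (monoDeg p) := by
  refine monoBasis_mem (U := fun d => homog m n d) ?_ (fun d f hf a => ?_) p
  · rw [mem_homog, ← sum_upX_mul_flatD]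
    have : ∀ a : Idx m n, der a 1 = 0 := by
      intro a
      have h : (1 : SPoly m n) = tm 1 1 := rfl
      have h0 : tm 0 1 = (0 : SPoly m n) := TensorProduct.zero_tmul _ _
      have h0' : tm 1 0 = (0 : SPoly m n) := TensorProduct.tmul_zero _ _
      rcases a with a | a
      · rw [h, der_inl]; simp [h0]
      · rw [h, der_inr, CliffordAlgebra.contractLeft_one, h0']
    simp [flatD, this]
  · exact_mod_cast mulX_mem_homog hf a

/-- A subspace that contains `1` and is stable under multiplication by coordinates is everything. -/
lemma eq_top_of_mulX {U : Submodule ℂ (SPoly m n)} (h0 : (1 : SPoly m n) ∈ U)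
    (hU : ∀ f ∈ U, ∀ a, mulX a f ∈ U) : U = ⊤ := by
  rw [eq_top_iff, ← (monoBasis m n).span_eq, Submodule.span_le]
  rintro _ ⟨p, rfl⟩
  exact monoBasis_mem (U := fun _ => U) h0 (fun _ => hU) p

lemma homog_eq_span (d : ℤ) : homog m n d = Submodule.span ℂ
    (Set.range fun p : {p : (Fin m →₀ ℕ) × Finset (Fin n ×ₗ Fin 2) // (monoDeg p : ℤ) = d} =>
      monoBasis m n p) :=
  ker_sub_eq_span (monoBasis m n) (euler m n) (fun p => ((monoDeg p : ℤ) : ℂ))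
    (fun p => mem_homog.1 (monoBasis_mem_homog p)) (d : ℂ) _ fun _ => Int.cast_inj

lemma homog_eq_span_nat (d : ℕ) : homog m n d = Submodule.span ℂ
    (Set.range fun p : {p : (Fin m →₀ ℕ) × Finset (Fin n ×ₗ Fin 2) // monoDeg p = d} =>
      monoBasis m n p) :=
  ker_sub_eq_span (monoBasis m n) (euler m n) (fun p => ((monoDeg p : ℤ) : ℂ))
    (fun p => mem_homog.1 (monoBasis_mem_homog p)) ((d : ℤ) : ℂ) _ fun _ => by norm_cast

lemma homog_of_neg {d : ℤ} (hd : d < 0) : homog m n d = ⊥ := by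
  rw [homog_eq_span, Submodule.span_eq_bot]
  rintro _ ⟨⟨p, hp⟩, rfl⟩
  omega

lemma homog_zero_le : homog m n 0 ≤ Submodule.span ℂ {1} := by
  rw [homog_eq_span, Submodule.span_le]
  rintro _ ⟨⟨p, hp⟩, rfl⟩
  have hp : monoDeg p = 0 := by exact_mod_cast hp
  -- Allowing everything in positive degree makes stability under multiplication trivial, and only
  -- the information in degree zero remains.
  have := monoBasis_mem (m := m) (n := n)
    (U := fun d => if d = 0 then Submodule.span ℂ {1} else ⊤) (by simp)
    (fun d f _ a => by simp) p
  simpa [hp] using this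

/-- A monomial of degree d is a set A of Grassmann variables and an exponent vector of degree d -
|A|. Grouping by |A| and counting exponent vectors by stars and bars gives the sum; the condition i
≤ d guards the truncated subtraction. -/
lemma card_monoDeg (hm : 0 < m) (d : ℕ) :
    Finite {p : (Fin m →₀ ℕ) × Finset (Fin n ×ₗ Fin 2) // monoDeg p = d} ∧
    Nat.card {p : (Fin m →₀ ℕ) × Finset (Fin n ×ₗ Fin 2) // monoDeg p = d} =
      ∑ i ∈ Finset.range (2 * n + 1), (2 * n).choose i *
        if i ≤ d then (d - i + m - 1).choose (m - 1) else 0 := by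
  let f : ℕ → ℕ := fun i => if i ≤ d then (d - i + m - 1).choose (m - 1) else 0
  let S : Finset (Σ _ : Finset (Fin n ×ₗ Fin 2), Fin m →₀ ℕ) := Finset.univ.sigma fun A =>
    if A.card ≤ d then Finset.finsuppAntidiag Finset.univ (d - A.card) else ∅
  have hS : ∀ q, q ∈ S ↔ monoDeg (q.2, q.1) = d := by
    rintro ⟨A, α⟩
    simp only [S, Finset.mem_sigma, Finset.mem_univ, true_and, monoDeg]
    have : α.degree = ∑ i, α i := by
      rw [Finsupp.degree_eq_sum]
    rw [this]
    split_ifs with h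
    · simp only [Finset.mem_finsuppAntidiag, Finset.subset_univ, and_true]
      change ∑ i, α i = _ ↔ _
      omega
    · simp; omega
  let e : {p : (Fin m →₀ ℕ) × Finset (Fin n ×ₗ Fin 2) // monoDeg p = d} ≃ S :=
    { toFun := fun p => ⟨⟨p.1.2, p.1.1⟩, (hS _).2 p.2⟩
      invFun := fun q => ⟨(q.1.2, q.1.1), (hS _).1 q.2⟩
      left_inv := fun _ => rfl
      right_inv := fun _ => rfl }
  refine ⟨Finite.of_equiv _ e.symm, ?_⟩
  rw [Nat.card_congr e, Nat.card_eq_fintype_card, Fintype.card_coe, Finset.card_sigma]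
  have h1 : ∀ A : Finset (Fin n ×ₗ Fin 2), (if A.card ≤ d then
      Finset.finsuppAntidiag (Finset.univ : Finset (Fin m)) (d - A.card) else ∅).card = f A.card := by
    intro A
    simp only [f]
    split_ifs with h
    · rw [Finset.card_finsuppAntidiag_nat_eq_choose, Finset.card_univ, Fintype.card_fin]
      rw [show d - A.card + m - 1 = m + (d - A.card) - 1 by omega]
      apply Nat.choose_symm_of_eq_add
      omega
    · rfl
  simp only [h1]
  have h2 := Finset.sum_powerset_apply_card f (x := (Finset.univ : Finset (Fin n ×ₗ Fin 2)))
  have h3 : Fintype.card (Fin n ×ₗ Fin 2) = 2 * n := by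
    rw [Fintype.card_lex, Fintype.card_prod, Fintype.card_fin, Fintype.card_fin, mul_comm]
  rw [Finset.powerset_univ, Finset.card_univ, h3] at h2
  simpa [f] using h2

/-- The dimension of the space of homogeneous superpolynomials of degree `d`. -/
def homogDim (m n : ℕ) (d : ℤ) : ℤ :=
  ∑ i ∈ Finset.Icc (0 : ℤ) (min d (2 * n)),
    ((2 * n).choose i.toNat : ℤ) * ((d - i + m - 1).toNat.choose (m - 1) : ℤ)

lemma homogDim_natCast (hm : 0 < m) (d : ℕ) : homogDim m n d =
    ∑ i ∈ Finset.range (2 * n + 1), (2 * n).choose i *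
        if i ≤ d then (d - i + m - 1).choose (m - 1) else 0 := by
  simp only [mul_ite, mul_zero, ← Finset.sum_filter]
  rw [homogDim]
  push_cast
  symm
  refine Finset.sum_bij (fun i _ => (i : ℤ)) ?_ ?_ ?_ ?_
  · intro i hi; simp at hi ⊢; omega
  · intro i _ j _ h; exact_mod_cast h
  · intro i hi
    simp at hi
    exact ⟨i.toNat, by simp; omega, by simp; omega⟩
  · intro i hi
    simp at hi
    rw [Int.toNat_natCast]
    congr 3
    omega

lemma finiteDimensional_homog_and_finrank (hm : 0 < m) (d : ℤ) :
    FiniteDimensional ℂ (homog m n d) ∧ (Module.finrank ℂ (homog m n d) : ℤ) = homogDim m n d := by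
  rcases lt_or_ge d 0 with hd | hd
  · rw [homog_of_neg hd]
    refine ⟨inferInstance, ?_⟩
    rw [finrank_bot, homogDim, Finset.Icc_eq_empty (by omega)]
    simp
  · lift d to ℕ using hd
    obtain ⟨h1, h2⟩ := card_monoDeg (n := n) hm d
    have hli : LinearIndependent ℂ (fun p : {p : (Fin m →₀ ℕ) × Finset (Fin n ×ₗ Fin 2) //
        monoDeg p = d} => monoBasis m n p) :=
      (monoBasis m n).linearIndependent.comp _ Subtype.val_injective
    rw [homog_eq_span_nat]
    refine ⟨FiniteDimensional.span_of_finite ℂ (Set.finite_range _), ?_⟩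
    rw [Module.finrank_eq_nat_card_basis (Module.Basis.span hli), h2, homogDim_natCast hm]

end

section

variable {m n : ℕ}


/-! ### Multiplication by `R²` is injective -/

/-- Each product of the two members of a Grassmann pair squares to zero, and these products commute
with one another. -/
lemma isNilpotent_sum_odd : IsNilpotent (∑ j : Fin n, mulX (.inr (j, 0)) * mulX (.inr (j, 1)) :
    Module.End ℂ (SPoly m n)) := by
  have hc : ∀ a b : Fin n × Fin 2, (mulX (.inr a) * mulX (.inr b) : Module.End ℂ (SPoly m n)) =
      (-1 : ℂ) • (mulX (.inr b) * mulX (.inr a)) := by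
    intro a b
    rw [mulX_mulX]
    simp [par, sgn]
  refine Commute.isNilpotent_sum (fun j _ => ⟨2, ?_⟩) (fun i j _ _ => ?_)
  · have h : (mulX (.inr (j, 0)) * mulX (.inr (j, 0)) : Module.End ℂ (SPoly m n)) = 0 := by
      have h1 := sub_eq_zero.2 (hc (j, 0) (j, 0))
      have h2 : (2 : ℂ) • (mulX (.inr (j, 0)) * mulX (.inr (j, 0)) : Module.End ℂ (SPoly m n)) =
          0 := by
        rw [neg_smul_end, one_smul, sub_neg_eq_add] at h1
        rw [two_smul, h1]
      exact (smul_eq_zero.1 h2).resolve_left two_ne_zero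
    rw [pow_two, mul_assoc, ← mul_assoc (mulX (.inr (j, 1))), hc (j, 1) (j, 0), smul_mul_assoc,
      mul_smul_comm, mul_assoc, ← mul_assoc, h, zero_mul, smul_zero]
  · rw [Commute, SemiconjBy, mul_assoc, ← mul_assoc (mulX (.inr (i, 1))), hc (i, 1) (j, 0),
      smul_mul_assoc, mul_assoc, hc (i, 1) (j, 1), mul_smul_comm, mul_smul_comm, mul_smul_comm,
      smul_smul, ← mul_assoc, hc (i, 0) (j, 0), ← mul_assoc, smul_mul_assoc, smul_mul_assoc,
      mul_assoc (mulX (.inr (j, 0))), hc (i, 0) (j, 1), mul_smul_comm, smul_mul_assoc, smul_smul,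
      smul_smul]
    simp [mul_assoc]

/-- R² = A - N, where A is multiplication by ∑ x_i², which is injective because m > 0, and N is
nilpotent and commutes with R². If R²f = 0, then A^r f = N^r f for all r, which vanishes for large
r. -/
lemma mulR2_injective (hm : 0 < m) : Function.Injective (mulR2 m n) := by
  let q : MvPolynomial (Fin m) ℂ := ∑ i, MvPolynomial.X i * MvPolynomial.X i
  have hq : q ≠ 0 := by
    intro h
    have h1 := congrArg (MvPolynomial.eval (Pi.single ⟨0, hm⟩ (1 : ℂ))) h
    simp [q, Pi.single_apply] at h1
  let A : Module.End ℂ (SPoly m n) := tmap (LinearMap.mulLeft ℂ q) LinearMap.id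
  let N : Module.End ℂ (SPoly m n) := ∑ j : Fin n, mulX (.inr (j, 0)) * mulX (.inr (j, 1))
  have hA : Function.Injective A := by
    have : Function.Injective (LinearMap.rTensor (ExteriorAlgebra ℂ (Fin n × Fin 2 → ℂ))
        (LinearMap.mulLeft ℂ q)) :=
      Module.Flat.rTensor_preserves_injective_linearMap _ (mul_right_injective₀ hq)
    exact this
  have hAR : A = mulR2 m n + N := by
    have h1 : A = ∑ i : Fin m, mulX (.inl i) * mulX (.inl i) := by
      refine spoly_ext fun f g => ?_
      simp only [A, tmap_tm, LinearMap.sum_apply, Module.End.mul_apply, mulX_inl, q,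
        LinearMap.mulLeft_apply, Finset.sum_mul, mul_assoc]
      exact TensorProduct.sum_tmul _ _ _
    have h2 : mulR2 m n = A - N := by
      rw [h1]
      refine LinearMap.ext fun f => ?_
      simp [R2, mulX, sub_mul, Finset.sum_mul, mul_assoc, N]
    rw [h2, sub_add_cancel]
  have hcomm : Commute (mulR2 m n) N := by
    refine Commute.sum_right _ _ _ fun j _ => ?_
    exact Commute.mul_right (mulR2_mulX _) (mulR2_mulX _)
  obtain ⟨r, hr⟩ := isNilpotent_sum_odd (m := m) (n := n)
  rw [injective_iff_map_eq_zero]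
  intro f hf
  have h3 : ∀ i, (A ^ i) f = (N ^ i) f := by
    intro i
    induction i with
    | zero => simp
    | succ i ih =>
      have h4 := LinearMap.congr_fun (hcomm.pow_right i).eq f
      simp only [Module.End.mul_apply, hf, map_zero] at h4
      rw [pow_succ', Module.End.mul_apply, ih, hAR, LinearMap.add_apply, h4, zero_add,
        ← Module.End.mul_apply, ← pow_succ']
  have h5 := h3 r
  change _ = ((∑ j : Fin n, mulX (.inr (j, 0)) * mulX (.inr (j, 1)) :
    Module.End ℂ (SPoly m n)) ^ r) f at h5
  rw [hr, LinearMap.zero_apply] at h5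
  have h6 : Function.Injective (A ^ r) := by
    rw [Module.End.coe_pow]
    exact hA.iterate r
  exact h6 (by rw [h5, map_zero])

lemma mulR2_pow_injective (hm : 0 < m) (i : ℕ) : Function.Injective (mulR2 m n ^ i) := by
  rw [Module.End.coe_pow]
  exact (mulR2_injective hm).iterate i

lemma mem_homog_of_mulR2_pow (hm : 0 < m) {i : ℕ} {d : ℤ} {f : SPoly m n}
    (hf : (mulR2 m n ^ i) f ∈ homog m n d) : f ∈ homog m n (d - 2 * i) := by
  induction i generalizing f with
  | zero => simpa using hf
  | succ i ih =>
    rw [pow_succ, Module.End.mul_apply] at hf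
    have h1 := ih hf
    rw [mem_homog] at h1 ⊢
    have := LinearMap.congr_fun (euler_mulR2 (m := m) (n := n)) f
    simp only [Module.End.mul_apply, LinearMap.add_apply, h1, LinearMap.smul_apply] at this
    apply mulR2_injective hm
    rw [map_smul, ← sub_eq_iff_eq_add.2 this, ← sub_smul]
    congr 1
    push_cast; ring

/-! ### The Laplace operator is surjective -/

/-- Let J be the antiderivative in the first bosonic variable and N the rest of ∇². They commute, so
∇²J²f = f + J²Nf. Correcting J²f by a preimage of J²Nf gives a Neumann series, which terminates
because N lowers the degree by two. -/
lemma exists_laplace_eq (hm : 0 < m) {d : ℤ} {f : SPoly m n} (hf : f ∈ homog m n d) :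
    ∃ g ∈ homog m n (d + 2), laplace m n g = f := by
  let i0 : Idx m n := .inl ⟨0, hm⟩
  let J0 : Module.End ℂ (MvPolynomial (Fin m) ℂ) :=
    (MvPolynomial.basisMonomials (Fin m) ℂ).constr ℂ fun α =>
      MvPolynomial.monomial (α + Finsupp.single ⟨0, hm⟩ 1) ((α ⟨0, hm⟩ + 1 : ℂ)⁻¹)
  have hJ0 : ∀ α c, J0 (MvPolynomial.monomial α c) =
      MvPolynomial.monomial (α + Finsupp.single ⟨0, hm⟩ 1) (c * (α ⟨0, hm⟩ + 1 : ℂ)⁻¹) := by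
    intro α c
    have h1 : MvPolynomial.monomial α c = c • MvPolynomial.basisMonomials (Fin m) ℂ α := by
      simp [MvPolynomial.smul_monomial]
    rw [h1, map_smul, Module.Basis.constr_basis, MvPolynomial.smul_monomial, smul_eq_mul]
  have hpJ : ∀ i : Fin m, i ≠ ⟨0, hm⟩ → (MvPolynomial.pderiv i).toLinearMap * J0 =
      J0 * (MvPolynomial.pderiv i).toLinearMap := by
    intro i hi
    refine (MvPolynomial.basisMonomials (Fin m) ℂ).ext fun α => ?_
    simp [hJ0, MvPolynomial.pderiv_monomial, hi, Ne.symm hi]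
    rw [mul_comm]
    congr 2
    ext l
    simp only [Finsupp.tsub_apply, Finsupp.add_apply, Finsupp.single_apply]
    by_cases h1 : i = l
    · simp [← h1, Ne.symm hi]
    · simp [h1]
  have hp0 : (MvPolynomial.pderiv ⟨0, hm⟩).toLinearMap * J0 = 1 := by
    refine (MvPolynomial.basisMonomials (Fin m) ℂ).ext fun α => ?_
    have : (α ⟨0, hm⟩ + 1 : ℂ) ≠ 0 :=
      Nat.cast_add_one_ne_zero (R := ℂ) (α ⟨0, hm⟩)
    simp [hJ0, MvPolynomial.pderiv_monomial, this]
  let J : Module.End ℂ (SPoly m n) := tmap J0 LinearMap.id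
  have hJ1 : der i0 * J = 1 := by
    refine spoly_ext fun f g => ?_
    simp only [Module.End.mul_apply, J, tmap_tm, i0, der_inl]
    rw [← Derivation.coeFn_coe, ← Module.End.mul_apply, hp0]
    rfl
  have hJ2 : ∀ a, a ≠ i0 → der a * J = J * der a := by
    intro a ha
    refine spoly_ext fun f g => ?_
    rcases a with a | a
    · simp only [Module.End.mul_apply, J, tmap_tm, der_inl]
      rw [← Derivation.coeFn_coe, ← Module.End.mul_apply, hpJ a (fun h => ha (by rw [h]))]
      rfl
    · simp only [Module.End.mul_apply, J, tmap_tm, der_inr]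
      rfl
  let N : Module.End ℂ (SPoly m n) := laplace m n - der i0 * der i0
  have hN : N = ∑ i ∈ Finset.univ.erase ⟨0, hm⟩, der (.inl i) * der (.inl i)
      - (4 : ℂ) • ∑ j : Fin n, der (.inr (j, 0)) * der (.inr (j, 1)) := by
    simp only [N, laplace]
    rw [← Finset.add_sum_erase _ _ (Finset.mem_univ (⟨0, hm⟩ : Fin m))]
    simp only [i0]
    abel
  have hNJ : N * J = J * N := by
    rw [hN]
    have e : ∀ a b, a ≠ i0 → b ≠ i0 → der a * der b * J = J * (der a * der b) := by
      intro a b ha hb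
      rw [mul_assoc, hJ2 b hb, ← mul_assoc, hJ2 a ha, mul_assoc]
    rw [sub_mul, mul_sub, smul_mul_assoc, mul_smul_comm, Finset.sum_mul, Finset.sum_mul,
      Finset.mul_sum, Finset.mul_sum]
    congr 1
    · refine Finset.sum_congr rfl fun i hi => e _ _ ?_ ?_ <;>
      · intro h
        simp only [i0, Sum.inl.injEq] at h
        simp [h] at hi
    · congr 1
      exact Finset.sum_congr rfl fun j _ => e _ _ (by simp [i0]) (by simp [i0])
  -- On each monomial J is a scalar multiple of multiplication by the first coordinate.
  have hJdeg : ∀ {d : ℤ} {f : SPoly m n}, f ∈ homog m n d → J f ∈ homog m n (d + 1) := by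
    intro d f hf
    have key : homog m n d ≤ (homog m n (d + 1)).comap J := by
      conv_lhs => rw [homog_eq_span]
      rw [Submodule.span_le]
      rintro _ ⟨⟨⟨α, A⟩, hp⟩, rfl⟩
      have h1 := monoBasis_mem_homog (m := m) (n := n) (α, A)
      rw [hp] at h1
      have h2 : J (monoBasis m n (α, A)) = (α ⟨0, hm⟩ + 1 : ℂ)⁻¹ •
          mulX i0 (monoBasis m n (α, A)) := by
        have e3 : monoBasis m n (α, A) = tm (MvPolynomial.monomial α 1)
            ((((Pi.basisFun ℂ (Fin n × Fin 2)).reindex toLex).ExteriorAlgebra) A) := by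
          rw [monoBasis]
          refine (Module.Basis.tensorProduct_apply _ _ _ _).trans ?_
          rw [MvPolynomial.coe_basisMonomials]
          rfl
        rw [e3, mulX_inl, tmap_tm, hJ0, LinearMap.id_apply, one_mul]
        have e4 : (MvPolynomial.monomial (α + Finsupp.single ⟨0, hm⟩ 1)) (α ⟨0, hm⟩ + 1 : ℂ)⁻¹ =
            (α ⟨0, hm⟩ + 1 : ℂ)⁻¹ • (MvPolynomial.X ⟨0, hm⟩ * MvPolynomial.monomial α (1 : ℂ)) := by
          rw [mul_comm, MvPolynomial.X, MvPolynomial.monomial_mul, MvPolynomial.smul_monomial]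
          simp
        rw [e4]
        exact (TensorProduct.smul_tmul' _ _ _).symm
      change J (monoBasis m n (α, A)) ∈ homog m n (d + 1)
      rw [h2]
      exact Submodule.smul_mem _ _ (mulX_mem_homog h1 i0)
    exact key hf
  have hNdeg : ∀ {d : ℤ} {f : SPoly m n}, f ∈ homog m n d → N f ∈ homog m n (d - 2) := by
    intro d f hf
    refine Submodule.sub_mem _ (laplace_mem_homog hf) ?_
    have := der_mem_homog (der_mem_homog hf i0) i0
    rwa [show d - 1 - 1 = d - 2 by ring] at this
  have hlap : ∀ f, laplace m n (J (J f)) = f + J (J (N f)) := by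
    intro f
    have h1 : laplace m n = der i0 * der i0 + N := by simp only [N]; abel
    have h2 : ∀ g, der i0 (J g) = g := fun g => LinearMap.congr_fun hJ1 g
    have h3 : ∀ g, N (J g) = J (N g) := fun g => LinearMap.congr_fun hNJ g
    rw [h1, LinearMap.add_apply, Module.End.mul_apply, h2, h2, h3, h3]
  -- The induction is on the number of times N must be applied to annihilate f; replacing f by J²Nf
  -- lowers this number by one.
  have main : ∀ (r : ℕ) (d : ℤ) (f : SPoly m n), f ∈ homog m n d → (N ^ r) f = 0 →
      ∃ g ∈ homog m n (d + 2), laplace m n g = f := by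
    intro r
    induction r with
    | zero =>
      intro d f _ h0
      exact ⟨0, Submodule.zero_mem _, by simpa using h0.symm⟩
    | succ r ih =>
      intro d f hf h0
      have h1 := hJdeg (hJdeg (hNdeg hf))
      rw [show d - 2 + 1 + 1 = d by ring] at h1
      have hc : Commute (N ^ r) J := Commute.pow_left (show Commute N J from hNJ) r
      have h3 : ∀ g, (N ^ r) (J g) = J ((N ^ r) g) := fun g => LinearMap.congr_fun hc.eq g
      obtain ⟨g, hg, hg2⟩ := ih d _ h1 (by
        rw [h3, h3, ← Module.End.mul_apply (N ^ r), ← pow_succ, h0, map_zero, map_zero])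
      refine ⟨J (J f) - g, Submodule.sub_mem _ ?_ hg, ?_⟩
      · have := hJdeg (hJdeg hf)
        rwa [show d + 1 + 1 = d + 2 by ring] at this
      · rw [map_sub, hlap, hg2, add_sub_cancel_right]
  refine main (d.toNat + 1) d f hf ?_
  have h4 : ∀ r : ℕ, (N ^ r) f ∈ homog m n (d - 2 * r) := by
    intro r
    induction r with
    | zero => simpa using hf
    | succ r ih =>
      rw [pow_succ', Module.End.mul_apply]
      have := hNdeg ih
      push_cast
      rwa [show d - 2 * ((r : ℤ) + 1) = d - 2 * r - 2 by ring]
  have h5 := h4 (d.toNat + 1)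
  rwa [homog_of_neg (by push_cast; omega), Submodule.mem_bot] at h5

/-! ### Dimensions of the spaces of spherical harmonics -/

lemma mem_harm {k : ℕ} {f : SPoly m n} :
    f ∈ harm m n k ↔ f ∈ homog m n k ∧ laplace m n f = 0 := Iff.rfl

lemma finiteDimensional_harm_and_finrank (hm : 0 < m) (k : ℕ) :
    FiniteDimensional ℂ (harm m n k) ∧
      (Module.finrank ℂ (harm m n k) : ℤ) = homogDim m n k - homogDim m n (k - 2) := by
  obtain ⟨h1, h2⟩ := finiteDimensional_homog_and_finrank (n := n) hm k
  obtain ⟨h3, h4⟩ := finiteDimensional_homog_and_finrank (n := n) hm (k - 2)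
  let T : homog m n k →ₗ[ℂ] homog m n (k - 2) :=
    (laplace m n).restrict fun f hf => laplace_mem_homog hf
  have hT : LinearMap.range T = ⊤ := by
    rw [LinearMap.range_eq_top]
    rintro ⟨f, hf⟩
    obtain ⟨g, hg, hgf⟩ := exists_laplace_eq hm hf
    rw [sub_add_cancel] at hg
    exact ⟨⟨g, hg⟩, Subtype.ext hgf⟩
  have h5 := LinearMap.finrank_range_add_finrank_ker T
  rw [hT, finrank_top] at h5
  have e : LinearMap.ker T = (harm m n k).submoduleOf (homog m n k) := by
    ext ⟨f, hf⟩
    simp only [LinearMap.mem_ker, Submodule.submoduleOf, Submodule.mem_comap,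
      Submodule.subtype_apply, mem_harm, hf, true_and]
    exact Subtype.ext_iff
  have h6 : harm m n k ≤ homog m n k := inf_le_left
  rw [e, LinearEquiv.finrank_eq (Submodule.submoduleOfEquivOfLe h6)] at h5
  exact ⟨Submodule.finiteDimensional_of_le h6, by rw [← h2, ← h4]; omega⟩

/-! ### Spherical harmonics that are divisible by `R²` -/

/-- The degree bounds the power of R² that can divide a nonzero f, so a maximal power can be split
off. -/
lemma exists_mulR2_pow_eq (hm : 0 < m) {d : ℤ} {f : SPoly m n} (hf : f ∈ homog m n d)
    (h0 : f ≠ 0) : ∃ j : ℕ, ∃ h, f = (mulR2 m n ^ j) h ∧ h ∉ LinearMap.range (mulR2 m n) := by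
  by_contra! H
  have : ∀ j : ℕ, ∃ h, f = (mulR2 m n ^ j) h := by
    intro j
    induction j with
    | zero => exact ⟨f, by simp⟩
    | succ j ih =>
      obtain ⟨h, hh⟩ := ih
      obtain ⟨g, rfl⟩ := H j h hh
      exact ⟨g, by rw [hh, pow_succ, Module.End.mul_apply]⟩
  obtain ⟨h, rfl⟩ := this (d.toNat + 1)
  have h1 := mem_homog_of_mulR2_pow hm hf
  rw [homog_of_neg (by push_cast; omega), Submodule.mem_bot] at h1
  simp [h1] at h0

/-- The relation `hj` says that 2(k - 2j) + M + 2(j - 1), the last factor of the coefficient in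
`laplace_mulR2_pow`, vanishes. -/
lemma mulR2_pow_mem_harm {j k : ℕ} (hj : 2 * ((j : ℤ) - k) = m - 2 * n - 2) {h : SPoly m n}
    (h1 : h ∈ homog m n ((k : ℤ) - 2 * j)) (h2 : laplace m n h = 0) :
    (mulR2 m n ^ j) h ∈ harm m n k := by
  have h3 := mulR2_pow_mem_homog h1 j
  rw [sub_add_cancel] at h3
  refine mem_harm.2 ⟨h3, ?_⟩
  rcases j with _ | j
  · simpa using h2
  · rw [laplace_mulR2_pow h1, h2, map_zero, zero_add]
    convert zero_smul ℂ _
    rw [mul_eq_zero]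
    right
    have : (2 * (((j + 1 : ℕ) : ℤ) - k) : ℂ) = m - 2 * n - 2 := by exact_mod_cast congrArg (Int.cast (R := ℂ)) hj
    push_cast at this ⊢
    linear_combination -this

/-- Split off the maximal power, f = R^{2j}h. Cancelling R^{2(j-1)} from ∇²f = 0 leaves R²∇²h + c h
= 0. As h is not divisible by R², the scalar c must vanish, which fixes j, and then ∇²h = 0 by
injectivity. -/
lemma exists_of_mem_harm_inf (hm : 0 < m) {k : ℕ} {f : SPoly m n}
    (hf : f ∈ harm m n k ⊓ R2homog m n k) (h0 : f ≠ 0) :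
    ∃ j : ℕ, 0 < j ∧ 2 * ((j : ℤ) - k) = m - 2 * n - 2 ∧ 2 * j ≤ k ∧
      ∃ h ∈ harm m n (k - 2 * j), (mulR2 m n ^ j) h = f := by
  obtain ⟨hf, g, hg, hgf⟩ := hf
  obtain ⟨hf1, hf2⟩ := mem_harm.1 hf
  obtain ⟨j, h, hfh, hh⟩ := exists_mulR2_pow_eq hm hf1 h0
  have hj : j ≠ 0 := by
    rintro rfl
    apply hh
    rw [pow_zero, Module.End.one_apply] at hfh
    exact ⟨g, by rw [← hfh, ← hgf]⟩
  obtain ⟨i, rfl⟩ := Nat.exists_eq_succ_of_ne_zero hj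
  have hd : h ∈ homog m n ((k : ℤ) - 2 * (i + 1 : ℕ)) :=
    mem_homog_of_mulR2_pow hm (hfh ▸ hf1)
  have h1 := laplace_mulR2_pow hd i
  rw [Nat.succ_eq_add_one] at hfh
  rw [← hfh, hf2, pow_succ, Module.End.mul_apply, ← map_smul, ← map_add] at h1
  have h2 := mulR2_pow_injective hm i (by rw [← h1, map_zero] : (mulR2 m n ^ i) _ = (mulR2 m n ^ i) 0)
  set c : ℂ := 2 * ((i : ℂ) + 1) * (2 * ((k : ℤ) - 2 * (i + 1 : ℕ) : ℤ) + (m - 2 * n) + 2 * i)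
  have hc : c = 0 := by
    by_contra hc
    apply hh
    refine ⟨-(c⁻¹ • laplace m n h), ?_⟩
    rw [map_neg, map_smul, eq_neg_of_add_eq_zero_left h2, smul_neg, neg_neg, smul_smul,
      inv_mul_cancel₀ hc, one_smul]
  rw [hc, zero_smul, add_zero] at h2
  have h3 : laplace m n h = 0 := mulR2_injective hm (by rw [h2, map_zero])
  have h4 : (2 * ((i : ℂ) + 1)) ≠ 0 := mul_ne_zero two_ne_zero (Nat.cast_add_one_ne_zero i)
  have h5 := (mul_eq_zero.1 hc).resolve_left h4
  have h6 : (2 * ((k : ℤ) - 2 * ((i : ℤ) + 1)) + (m - 2 * n) + 2 * i : ℤ) = 0 := by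
    have : ((2 * ((k : ℤ) - 2 * ((i : ℤ) + 1)) + (m - 2 * n) + 2 * i : ℤ) : ℂ) = 0 := by
      push_cast at h5 ⊢; exact h5
    exact_mod_cast this
  have h7 : 2 * (i + 1) ≤ k := by
    by_contra h
    rw [homog_of_neg (by push_cast; omega), Submodule.mem_bot] at hd
    apply h0
    rw [hfh, hd, map_zero]
  refine ⟨i + 1, Nat.succ_pos _, ?_, h7, h, ⟨?_, h3⟩, hfh.symm⟩
  · push_cast; linarith
  · rwa [Nat.cast_sub h7]

/-- With M = -2(k - j - 1), the inequalities j ≥ 1 and 2j ≤ k become 2 - M/2 ≤ k and k ≤ 2 - M. The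
next lemma reads the same equivalence backwards. -/
lemma isExceptional_of {j k : ℕ} (h0 : 0 < j) (hj : 2 * ((j : ℤ) - k) = m - 2 * n - 2)
    (h : 2 * j ≤ k) : IsExceptional m n k := by
  refine ⟨(m : ℤ) - 2 * n, rfl, ⟨k - j - 1, by omega⟩, ?_, by omega⟩
  have : ((2 * ((j : ℤ) - k) : ℤ) : ℚ) = m - 2 * n - 2 := by rw [hj]; push_cast; ring
  have h0' : (1 : ℚ) ≤ j := by exact_mod_cast h0
  push_cast at this ⊢
  linarith

lemma exists_of_isExceptional {k : ℕ} (h : IsExceptional m n k) :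
    ∃ j : ℕ, 0 < j ∧ 2 * ((j : ℤ) - k) = m - 2 * n - 2 ∧ 2 * j ≤ k := by
  obtain ⟨M, hM, ⟨i, hi⟩, h1, h2⟩ := h
  have h3 : 2 + (i : ℤ) ≤ k := by
    rw [hi] at h1
    push_cast at h1
    have : (2 + (i : ℚ)) ≤ k := by linarith
    exact_mod_cast this
  exact ⟨k - 1 - i, by omega, by omega, by omega⟩

lemma harm_inf_R2homog_of_not_isExceptional (hm : 0 < m) {k : ℕ} (h : ¬ IsExceptional m n k) :
    harm m n k ⊓ R2homog m n k = ⊥ := by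
  rw [eq_bot_iff]
  intro f hf
  by_contra h0
  obtain ⟨j, h1, h2, h3, -⟩ := exists_of_mem_harm_inf hm hf h0
  exact h (isExceptional_of h1 h2 h3)

lemma harm_inf_R2homog_eq_map (hm : 0 < m) {j k : ℕ} (h0 : 0 < j)
    (hj : 2 * ((j : ℤ) - k) = m - 2 * n - 2) (h : 2 * j ≤ k) :
    harm m n k ⊓ R2homog m n k = (harm m n (k - 2 * j)).map (mulR2 m n ^ j) := by
  apply le_antisymm
  · intro f hf
    by_cases hf0 : f = 0
    · rw [hf0]; exact Submodule.zero_mem _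
    · obtain ⟨i, -, h2, h3, g, hg, hgf⟩ := exists_of_mem_harm_inf hm hf hf0
      obtain rfl : i = j := by omega
      exact ⟨g, hg, hgf⟩
  · rintro _ ⟨g, hg, rfl⟩
    obtain ⟨hg1, hg2⟩ := mem_harm.1 hg
    rw [Nat.cast_sub h] at hg1
    push_cast at hg1
    refine ⟨mulR2_pow_mem_harm hj hg1 hg2, ?_⟩
    obtain ⟨i, rfl⟩ := Nat.exists_eq_succ_of_ne_zero h0.ne'
    rw [pow_succ', Module.End.mul_apply]
    refine ⟨_, ?_, rfl⟩
    have := mulR2_pow_mem_homog hg1 i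
    push_cast at this
    rwa [show (k : ℤ) - 2 * (i + 1) + 2 * i = k - 2 by ring] at this

end

section

variable {m n : ℕ}


/-! ### Generators of `𝔬𝔰𝔭(m|2n)` -/

/-- The element `w ↦ X_i ⟨X_j, w⟩ - (-1)^([i][j]) X_j ⟨X_i, w⟩` of `𝔬𝔰𝔭(m|2n)`. -/
def rot (i j : Idx m n) : SMat m n := Matrix.of fun k l =>
  (if k = i then gram m n j l else 0) - sgn (par i) (par j) * if k = j then gram m n i l else 0

lemma gram_mul_rot (i j k l : Idx m n) : (gram m n * rot i j) k l =
    gram m n k i * gram m n j l - sgn (par i) (par j) * (gram m n k j * gram m n i l) := by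
  simp only [Matrix.mul_apply, rot, Matrix.of_apply, mul_sub, Finset.sum_sub_distrib]
  simp
  ring

lemma rot_mem (i j : Idx m n) : rot i j ∈ osp m n := by
  rw [mem_osp_iff]
  intro k l
  rw [gram_mul_rot, gram_mul_rot]
  have e1 : sgn (par k) (par k) * (gram m n k i * gram m n j l) =
      sgn (par k) (par l) * sgn (par l) (par l) * sgn (par i) (par j) *
        (gram m n l j * gram m n i k) := by
    by_cases h1 : gram m n i k = 0
    · rw [gram_symm k i, h1]; simp
    by_cases h2 : gram m n l j = 0
    · rw [gram_symm j l, h2]; simp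
    rw [gram_symm k i, gram_symm j l, gram_even h1, ← gram_even h2]
    linear_combination (sgn (par l) (par l) * gram m n i k * gram m n l j) *
      (sgn_mul_self (par k) (par k) - sgn_mul_self (par k) (par l))
  have e2 : sgn (par k) (par k) * sgn (par i) (par j) * (gram m n k j * gram m n i l) =
      sgn (par k) (par l) * sgn (par l) (par l) * (gram m n l i * gram m n j k) := by
    by_cases h1 : gram m n j k = 0
    · rw [gram_symm k j, h1]; simp
    by_cases h2 : gram m n l i = 0
    · rw [gram_symm i l, h2]; simp
    rw [gram_symm k j, gram_symm i l, gram_even h1, ← gram_even h2, sgn_comm (par l) (par k)]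
    linear_combination (sgn (par k) (par l) * sgn (par l) (par l) * gram m n j k * gram m n l i) *
      sgn_mul_self (par k) (par k)
  linear_combination e1 - e2

lemma sub_smul_end (a b : ℂ) (x : Module.End ℂ (SPoly m n)) : (a - b) • x = a • x - b • x :=
  sub_smul a b x

lemma glAct_rot (i j : Idx m n) : glAct m n (rot i j) =
    mulX i * flatD j - sgn (par i) (par j) • (mulX j * flatD i) := by
  have h : ∀ k l, rot i j k l • (mulX k * der l : Module.End ℂ (SPoly m n)) =
      (if k = i then gram m n j l • (mulX k * der l) else 0) -
      sgn (par i) (par j) • if k = j then gram m n i l • (mulX k * der l) else 0 := by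
    intro k l
    simp only [rot, Matrix.of_apply]
    rw [sub_smul_end, mul_smul, ite_smul, zero_smul, ite_smul, zero_smul]
  simp only [glAct_apply, h, Finset.sum_sub_distrib]
  simp [-Fintype.sum_sum_type, flatD, Finset.mul_sum, Finset.smul_sum]

/-- The matrix X g, with g the metric, is skew in the super sense, so each of the two terms in `rot`
sums to X; hence the factor one half. -/
lemma sum_rot {X : SMat m n} (hX : X ∈ osp m n) :
    X = (1 / 2 : ℂ) • ∑ i, ∑ j, (X * metric m n) i j • rot i j := by
  have h1 : ∑ i, ∑ j, (X * metric m n) i j • rot i j = (2 : ℂ) • X := by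
    ext k l
    simp only [Matrix.sum_apply, Matrix.smul_apply, rot, Matrix.of_apply, smul_eq_mul, mul_sub,
      Finset.sum_sub_distrib]
    have e1 : ∑ i, ∑ j, (X * metric m n) i j * (if k = i then gram m n j l else 0) = X k l := by
      rw [Finset.sum_eq_single k]
      · simp only [if_true]
        rw [← Matrix.mul_apply, Matrix.mul_assoc, metric_mul_gram, Matrix.mul_one]
      · intro b _ hb; simp [Ne.symm hb]
      · simp
    have e2 : ∑ i, ∑ j, (X * metric m n) i j * (sgn (par i) (par j) *
        if k = j then gram m n i l else 0) = - X k l := by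
      rw [← e1, Finset.sum_comm, ← Finset.sum_neg_distrib]
      refine Finset.sum_congr rfl fun i _ => ?_
      rw [← Finset.sum_neg_distrib]
      refine Finset.sum_congr rfl fun j _ => ?_
      have := mul_metric_symm hX i j
      rw [sgn_comm] at this
      linear_combination (if k = i then gram m n j l else 0) * this
    rw [e1, e2]; ring
  rw [h1, smul_smul]; norm_num

/-! ### Commutation of even coordinates -/

lemma sgn_of_even {p q : ZMod 2} (h : p = 0 ∨ q = 0) : sgn p q = 1 := by
  rcases h with rfl | rfl <;> simp [sgn]

lemma der_mulX_apply {i j : Idx m n} (h : par i = 0 ∨ par j = 0) (f : SPoly m n) :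
    der i (mulX j f) = (if i = j then f else 0) + mulX j (der i f) := by
  have := LinearMap.congr_fun (der_mulX i j) f
  rw [sgn_of_even h, one_smul] at this
  simp only [Module.End.mul_apply, LinearMap.add_apply] at this
  rw [this]
  split_ifs <;> simp

lemma mulX_mulX_apply {i j : Idx m n} (h : par i = 0 ∨ par j = 0) (f : SPoly m n) :
    mulX i (mulX j f) = mulX j (mulX i f) := by
  have := LinearMap.congr_fun (mulX_mulX i j) f
  rwa [sgn_of_even h, one_smul] at this

lemma der_der_apply {i j : Idx m n} (h : par i = 0 ∨ par j = 0) (f : SPoly m n) :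
    der i (der j f) = der j (der i f) := by
  have := LinearMap.congr_fun (der_der i j) f
  rwa [sgn_of_even h, one_smul] at this

/-! ### A pair of null coordinates -/

/-- The coordinates other than the first two. -/
def up : Idx m n → Idx (m + 2) n := Sum.map (fun i => i.succ.succ) id

/-- The first coordinate. -/
def i0 : Idx (m + 2) n := .inl 0

/-- The second coordinate. -/
def i1 : Idx (m + 2) n := .inl 1

@[simp] lemma par_i0 : par (i0 : Idx (m + 2) n) = 0 := rfl

@[simp] lemma par_i1 : par (i1 : Idx (m + 2) n) = 0 := rfl

@[simp] lemma par_up (a : Idx m n) : par (up a) = par a := by cases a <;> rfl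

@[simp] lemma up_ne_i0 (a : Idx m n) : up a ≠ i0 := by
  cases a <;> simp [up, i0, Fin.ext_iff]

@[simp] lemma up_ne_i1 (a : Idx m n) : up a ≠ i1 := by
  cases a <;> simp [up, i1, Fin.ext_iff]

@[simp] lemma i0_ne_up (a : Idx m n) : i0 ≠ up a := (up_ne_i0 a).symm

@[simp] lemma i1_ne_up (a : Idx m n) : i1 ≠ up a := (up_ne_i1 a).symm

@[simp] lemma i0_ne_i1 : (i0 : Idx (m + 2) n) ≠ i1 := by simp [i0, i1]

@[simp] lemma i1_ne_i0 : (i1 : Idx (m + 2) n) ≠ i0 := by simp [i0, i1]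

lemma sum_idx {α : Type*} [AddCommMonoid α] (F : Idx (m + 2) n → α) :
    ∑ i, F i = F i0 + F i1 + ∑ a, F (up a) := by
  simp only [Fintype.sum_sum_type, Fin.sum_univ_succ, up, i0, i1, Sum.map_inl, Sum.map_inr, id]
  simp only [add_assoc]
  rfl

lemma gram_up_up (a b : Idx m n) : gram (m + 2) n (up a) (up b) = gram m n a b := by
  rcases a with a | a <;> rcases b with b | b <;> simp [gram, up, Matrix.one_apply]

lemma gram_i0 (a : Idx (m + 2) n) : gram (m + 2) n i0 a = if i0 = a then 1 else 0 := by
  rcases a with a | a <;> simp [gram, i0, Matrix.one_apply]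

lemma gram_i1 (a : Idx (m + 2) n) : gram (m + 2) n i1 a = if i1 = a then 1 else 0 := by
  rcases a with a | a <;> simp [gram, i1, Matrix.one_apply]

lemma gram_up_i0 (a : Idx m n) : gram (m + 2) n (up a) i0 = 0 := by
  rcases a with a | a <;> simp [gram, i0, up, Fin.ext_iff]

lemma gram_up_i1 (a : Idx m n) : gram (m + 2) n (up a) i1 = 0 := by
  rcases a with a | a <;> simp [gram, i1, up, Fin.ext_iff]

lemma flatD_i0 : flatD (i0 : Idx (m + 2) n) = der i0 := by
  simp [flatD, gram_i0]

lemma flatD_i1 : flatD (i1 : Idx (m + 2) n) = der i1 := by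
  simp [flatD, gram_i1]

lemma flatD_up (a : Idx m n) : flatD (up a) = ∑ b, gram m n a b • der (up b) := by
  simp [-Fintype.sum_sum_type, flatD, sum_idx, gram_up_up, gram_up_i0, gram_up_i1]

lemma laplace_apply (f : SPoly (m + 2) n) : laplace (m + 2) n f =
    der i0 (der i0 f) + der i1 (der i1 f) + ∑ a, ∑ b, gram m n b a • der (up a) (der (up b) f) := by
  simp [-Fintype.sum_sum_type, laplace_eq, sum_idx, gram_up_up, gram_up_i0, gram_up_i1, gram_i0, gram_i1]

lemma euler_apply (f : SPoly (m + 2) n) : euler (m + 2) n f =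
    mulX i0 (der i0 f) + mulX i1 (der i1 f) + ∑ a, mulX (up a) (der (up a) f) := by
  simp [-Fintype.sum_sum_type, euler, sum_idx]

/-! ### Restriction to the slice where the null coordinates are 1 and 0. -/

/-- The restriction of a superpolynomial to `x_1 = 1/2`, `x_2 = -c/2`. -/
def ev (c : ℂ) : SPoly (m + 2) n →ₗ[ℂ] SPoly m n :=
  TensorProduct.map (MvPolynomial.aeval (Fin.cons (MvPolynomial.C (1 / 2))
    (Fin.cons (MvPolynomial.C (-c / 2)) MvPolynomial.X) :
      Fin (m + 2) → MvPolynomial (Fin m) ℂ)).toLinearMap LinearMap.id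

lemma ev_tm (c : ℂ) (f g) : ev c (tm f g : SPoly (m + 2) n) =
    tm (MvPolynomial.aeval (Fin.cons (MvPolynomial.C (1 / 2))
    (Fin.cons (MvPolynomial.C (-c / 2)) MvPolynomial.X) :
      Fin (m + 2) → MvPolynomial (Fin m) ℂ) f) g := TensorProduct.map_tmul _ _ _ _

lemma spoly_hom_ext {p q : SPoly (m + 2) n →ₗ[ℂ] SPoly m n} (h : ∀ f g, p (tm f g) = q (tm f g)) :
    p = q := TensorProduct.ext' h

lemma ev_one (c : ℂ) : ev c (1 : SPoly (m + 2) n) = 1 := by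
  have := ev_tm c (1 : MvPolynomial (Fin (m + 2)) ℂ) (1 : ExteriorAlgebra ℂ (Fin n × Fin 2 → ℂ))
  rwa [map_one] at this

lemma ev_mulX_up (c : ℂ) (a : Idx m n) (f : SPoly (m + 2) n) :
    ev c (mulX (up a) f) = mulX a (ev c f) := by
  refine LinearMap.congr_fun (f := ev c ∘ₗ mulX (up a)) (g := mulX a ∘ₗ ev c)
    (spoly_hom_ext fun f g => ?_) f
  rcases a with a | a <;> simp [up, mulX_inl, mulX_inr, ev_tm]

lemma ev_mulX_i0 (c : ℂ) (f : SPoly (m + 2) n) : ev c (mulX i0 f) = (1 / 2 : ℂ) • ev c f := by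
  refine LinearMap.congr_fun (f := ev c ∘ₗ mulX i0) (g := (1 / 2 : ℂ) • ev c)
    (spoly_hom_ext fun f g => ?_) f
  simp only [i0, LinearMap.comp_apply, mulX_inl, ev_tm, LinearMap.smul_apply, map_mul,
    MvPolynomial.aeval_X, Fin.cons_zero, ← MvPolynomial.smul_eq_C_mul]
  exact (TensorProduct.smul_tmul' _ _ _).symm

lemma ev_mulX_i1 (c : ℂ) (f : SPoly (m + 2) n) : ev c (mulX i1 f) = (-c / 2 : ℂ) • ev c f := by
  refine LinearMap.congr_fun (f := ev c ∘ₗ mulX i1) (g := (-c / 2 : ℂ) • ev c)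
    (spoly_hom_ext fun f g => ?_) f
  simp only [i1, LinearMap.comp_apply, mulX_inl, ev_tm, LinearMap.smul_apply, map_mul,
    MvPolynomial.aeval_X]
  rw [show (1 : Fin (m + 2)) = Fin.succ 0 from rfl, Fin.cons_succ, Fin.cons_zero,
    ← MvPolynomial.smul_eq_C_mul]
  exact (TensorProduct.smul_tmul' _ _ _).symm

lemma ev_der_up (c : ℂ) (a : Idx m n) (f : SPoly (m + 2) n) :
    ev c (der (up a) f) = der a (ev c f) := by
  refine LinearMap.congr_fun (f := ev c ∘ₗ der (up a)) (g := der a ∘ₗ ev c)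
    (spoly_hom_ext fun f g => ?_) f
  rcases a with a | a
  · simp only [up, Sum.map_inl, LinearMap.comp_apply, der_inl, ev_tm]
    congr 1
    induction f using MvPolynomial.induction_on with
    | C r => simp
    | add p q hp hq => simp only [map_add, hp, hq]
    | mul_X p i hp =>
      simp only [Derivation.leibniz, map_add, map_mul, hp, smul_eq_mul, MvPolynomial.aeval_X]
      congr 1
      refine Fin.cases ?_ (fun i => Fin.cases ?_ (fun i => ?_) i) i
      · simp [MvPolynomial.pderiv_X, Fin.ext_iff]
      · simp [MvPolynomial.pderiv_X, Fin.ext_iff]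
      · by_cases h : i = a <;> simp [MvPolynomial.pderiv_X, h]
  · simp only [up, Sum.map_inr, LinearMap.comp_apply, der_inr, ev_tm, id]

lemma ev_flatD_up (c : ℂ) (a : Idx m n) (f : SPoly (m + 2) n) :
    ev c (flatD (up a) f) = flatD a (ev c f) := by
  rw [flatD_up, flatD]
  simp [-Fintype.sum_sum_type, ev_der_up]

end

/-! ### Null coordinates z, z̄, their rotation, and harmonics graded by its weight. -/

section

variable {m n : ℕ}


/-- The null coordinate `x_1 + c x_2`, where `c² = -1`. -/
def nulX (c : ℂ) : Module.End ℂ (SPoly (m + 2) n) := mulX i0 + c • mulX i1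

/-- The derivative with respect to the null coordinate `x_1 + c x_2`. -/
def nulD (c : ℂ) : Module.End ℂ (SPoly (m + 2) n) := (1 / 2 : ℂ) • (der i0 - c • der i1)

/-- The rotation in the plane of the null coordinates. -/
def hOp (c : ℂ) : Module.End ℂ (SPoly (m + 2) n) := c • (mulX i1 * der i0 - mulX i0 * der i1)

/-- The rotation that maps `x_1 + c x_2` to `X_a`. -/
def lowOp (c : ℂ) (a : Idx m n) : Module.End ℂ (SPoly (m + 2) n) :=
  mulX (up a) * nulD c - (1 / 2 : ℂ) • (nulX (-c) * flatD (up a))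

lemma nulX_apply (c : ℂ) (f : SPoly (m + 2) n) : nulX c f = mulX i0 f + c • mulX i1 f := rfl

lemma nulD_apply (c : ℂ) (f : SPoly (m + 2) n) :
    nulD c f = (1 / 2 : ℂ) • (der i0 f - c • der i1 f) := rfl

lemma hOp_apply (c : ℂ) (f : SPoly (m + 2) n) :
    hOp c f = c • (mulX i1 (der i0 f) - mulX i0 (der i1 f)) := rfl

lemma lowOp_apply (c : ℂ) (a : Idx m n) (f : SPoly (m + 2) n) :
    lowOp c a f = mulX (up a) (nulD c f) - (1 / 2 : ℂ) • nulX (-c) (flatD (up a) f) := rfl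

lemma hOp_neg (c : ℂ) (f : SPoly (m + 2) n) : hOp (-c) f = -hOp c f := by
  simp only [hOp_apply, neg_smul]

lemma hOp_eq_glAct (c : ℂ) : hOp c = glAct (m + 2) n (c • rot i1 i0) := by
  rw [map_smul, glAct_rot, flatD_i0, flatD_i1]
  simp [hOp, sgn]

lemma lowOp_eq_glAct (c : ℂ) (a : Idx m n) :
    lowOp c a = glAct (m + 2) n ((1 / 2 : ℂ) • (rot (up a) i0 - c • rot (up a) i1)) := by
  rw [map_smul, map_sub, map_smul, glAct_rot, glAct_rot, flatD_i0, flatD_i1]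
  refine LinearMap.ext fun f => ?_
  simp only [par_i0, par_i1, sgn_zero_right, one_smul, lowOp_apply, nulX_apply, nulD_apply,
    LinearMap.smul_apply, LinearMap.sub_apply, Module.End.mul_apply, map_sub, map_smul]
  module

lemma hOp_eq (c : ℂ) (f : SPoly (m + 2) n) :
    hOp c f = nulX c (nulD c f) - nulX (-c) (nulD (-c) f) := by
  simp only [hOp_apply, nulX_apply, nulD_apply, map_smul, map_sub]
  module

variable {c : ℂ}

/-- At x_1 = 1/2, x_2 = -c/2 with c² = -1, the coordinate x_1 + c x_2 takes the value 1 and x_1 - c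
x_2 the value 0; the next lemma records the latter. -/
lemma ev_nulX (hc : c * c = -1) (f : SPoly (m + 2) n) : ev c (nulX c f) = ev c f := by
  rw [nulX_apply, map_add, map_smul, ev_mulX_i0, ev_mulX_i1]
  linear_combination (norm := module) ((-1 / 2 : ℂ) * hc) • ev c f

lemma ev_nulX_neg (hc : c * c = -1) (f : SPoly (m + 2) n) : ev c (nulX (-c) f) = 0 := by
  rw [nulX_apply, map_add, map_smul, ev_mulX_i0, ev_mulX_i1]
  linear_combination (norm := module) ((1 / 2 : ℂ) * hc) • ev c f

/-- The rotation is z∂_z - z̄∂_z̄, and on the slice z = 1, z̄ = 0 only ∂_z is left of it. -/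
lemma ev_nulD (hc : c * c = -1) (f : SPoly (m + 2) n) : ev c (nulD c f) = ev c (hOp c f) := by
  rw [hOp_eq, map_sub, ev_nulX hc, ev_nulX_neg hc, sub_zero]

lemma laplace_eq_nulD (hc : c * c = -1) (f : SPoly (m + 2) n) : laplace (m + 2) n f =
    (4 : ℂ) • nulD c (nulD (-c) f) + ∑ a, ∑ b, gram m n b a • der (up a) (der (up b) f) := by
  rw [laplace_apply]
  congr 1
  simp only [nulD_apply, map_smul, map_sub]
  rw [der_der_apply (i := i1) (j := i0) (Or.inl rfl)]
  linear_combination (norm := module) hc • der i1 (der i1 f)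

lemma ev_laplace (hc : c * c = -1) (f : SPoly (m + 2) n) : ev c (laplace (m + 2) n f) =
    (4 : ℂ) • ev c (nulD c (nulD (-c) f)) + laplace m n (ev c f) := by
  rw [laplace_eq_nulD hc, laplace_eq, map_add, map_smul]
  simp only [map_sum, map_smul, ev_der_up, LinearMap.sum_apply, LinearMap.smul_apply,
    Module.End.mul_apply]

lemma hOp_nulD_neg (hc : c * c = -1) (f : SPoly (m + 2) n) :
    hOp c (nulD (-c) f) = nulD (-c) (hOp c f) + nulD (-c) f := by
  have e : ∀ i j : Idx (m + 2) n, par i = 0 → ∀ g, der i (mulX j g) = _ :=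
    fun i j h g => der_mulX_apply (Or.inl h) g
  simp only [hOp_apply, nulD_apply, map_smul, map_sub]
  simp only [e i0 _ rfl, e i1 _ rfl, der_der_apply (i := i1) (j := i0) (Or.inl rfl), if_true,
    i0_ne_i1, i1_ne_i0, if_false, zero_add]
  linear_combination (norm := module) (-(1 / 2 : ℂ) * hc) • der i0 f

lemma hOp_nulD (hc : c * c = -1) (f : SPoly (m + 2) n) :
    hOp c (nulD c f) = nulD c (hOp c f) - nulD c f := by
  have := hOp_nulD_neg (c := -c) (by rw [neg_mul_neg, hc]) f
  rw [hOp_neg, hOp_neg, neg_neg, map_neg] at this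
  rw [neg_eq_iff_eq_neg.1 this]
  abel

lemma hOp_nulX (hc : c * c = -1) (f : SPoly (m + 2) n) :
    hOp c (nulX c f) = nulX c (hOp c f) + nulX c f := by
  have e : ∀ i j : Idx (m + 2) n, par i = 0 → ∀ g, der i (mulX j g) = _ :=
    fun i j h g => der_mulX_apply (Or.inl h) g
  simp only [hOp_apply, nulX_apply, map_smul, map_sub, map_add]
  simp only [e i0 _ rfl, e i1 _ rfl, mulX_mulX_apply (i := i1) (j := i0) (Or.inl rfl), if_true,
    i0_ne_i1, i1_ne_i0, if_false, zero_add, map_add]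
  linear_combination (norm := module) (-1 * hc) • mulX i0 f

lemma hOp_nulX_neg (hc : c * c = -1) (f : SPoly (m + 2) n) :
    hOp c (nulX (-c) f) = nulX (-c) (hOp c f) - nulX (-c) f := by
  have := hOp_nulX (c := -c) (by rw [neg_mul_neg, hc]) f
  rw [hOp_neg, hOp_neg, map_neg] at this
  rw [neg_eq_iff_eq_neg.1 this]
  abel

lemma hOp_mulX_up (c : ℂ) (a : Idx m n) (f : SPoly (m + 2) n) :
    hOp c (mulX (up a) f) = mulX (up a) (hOp c f) := by
  have e : ∀ i : Idx (m + 2) n, par i = 0 → ∀ g, der i (mulX (up a) g) = _ :=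
    fun i h g => der_mulX_apply (Or.inl h) g
  have e2 : ∀ i : Idx (m + 2) n, par i = 0 → ∀ g, mulX i (mulX (up a) g) = _ :=
    fun i h g => mulX_mulX_apply (Or.inl h) g
  simp only [hOp_apply, e i0 rfl, e i1 rfl, e2 i0 rfl, e2 i1 rfl, i0_ne_up, i1_ne_up, if_false,
    zero_add, map_smul, map_sub]

lemma hOp_der_up (c : ℂ) (a : Idx m n) (f : SPoly (m + 2) n) :
    hOp c (der (up a) f) = der (up a) (hOp c f) := by
  have e : ∀ j : Idx (m + 2) n, par j = 0 → ∀ g, der (up a) (mulX j g) = _ :=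
    fun j h g => der_mulX_apply (Or.inr h) g
  have e2 : ∀ i : Idx (m + 2) n, par i = 0 → ∀ g, der i (der (up a) g) = _ :=
    fun i h g => der_der_apply (Or.inl h) g
  simp only [hOp_apply, e i0 rfl, e i1 rfl, e2 i0 rfl, e2 i1 rfl, up_ne_i0, up_ne_i1, if_false,
    zero_add, map_smul, map_sub]

lemma hOp_flatD_up (c : ℂ) (a : Idx m n) (f : SPoly (m + 2) n) :
    hOp c (flatD (up a) f) = flatD (up a) (hOp c f) := by
  simp only [flatD_up, LinearMap.sum_apply, LinearMap.smul_apply, map_sum, map_smul, hOp_der_up]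

lemma hOp_lowOp (hc : c * c = -1) (a : Idx m n) (f : SPoly (m + 2) n) :
    hOp c (lowOp c a f) = lowOp c a (hOp c f) - lowOp c a f := by
  simp only [lowOp_apply, map_sub, map_smul, hOp_mulX_up, hOp_nulD hc, hOp_nulX_neg hc,
    hOp_flatD_up]
  module

/-- The harmonics of degree `k` and weight `s` for the rotation in the plane of the null
coordinates. -/
def lvl (m n : ℕ) (c : ℂ) (k s : ℤ) : Submodule ℂ (SPoly (m + 2) n) :=
  homog (m + 2) n k ⊓ LinearMap.ker (laplace (m + 2) n) ⊓
    LinearMap.ker (hOp c - (s : ℂ) • LinearMap.id)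

lemma mem_lvl {k s : ℤ} {f : SPoly (m + 2) n} : f ∈ lvl m n c k s ↔
    f ∈ homog (m + 2) n k ∧ laplace (m + 2) n f = 0 ∧ hOp c f = (s : ℂ) • f := by
  simp [lvl, sub_eq_zero, and_assoc]

lemma lvl_neg {k s : ℤ} : lvl m n (-c) k s = lvl m n c k (-s) := by
  ext f
  rw [mem_lvl, mem_lvl, hOp_neg, neg_eq_iff_eq_neg]
  push_cast
  rw [neg_smul]

lemma glAct_mem_harm {X : SMat m n} (hX : X ∈ osp m n) {d : ℤ} {f : SPoly m n}
    (h1 : f ∈ homog m n d) (h2 : laplace m n f = 0) :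
    glAct m n X f ∈ homog m n d ∧ laplace m n (glAct m n X f) = 0 := by
  refine ⟨euler_commute (euler_glAct X) d h1, ?_⟩
  have := LinearMap.congr_fun (laplace_glAct hX) f
  rwa [Module.End.mul_apply, Module.End.mul_apply, h2, map_zero] at this

lemma lowOp_mat_mem (c : ℂ) (a : Idx m n) :
    (1 / 2 : ℂ) • (rot (up a) i0 - c • rot (up a) i1) ∈ osp (m + 2) n :=
  Submodule.smul_mem _ _ (Submodule.sub_mem _ (rot_mem _ _) (Submodule.smul_mem _ _ (rot_mem _ _)))

lemma hOp_mat_mem (c : ℂ) : c • rot i1 i0 ∈ osp (m + 2) n := Submodule.smul_mem _ _ (rot_mem _ _)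

lemma lowOp_mem_lvl (hc : c * c = -1) {k s : ℤ} {f : SPoly (m + 2) n} (hf : f ∈ lvl m n c k s)
    (a : Idx m n) : lowOp c a f ∈ lvl m n c k (s - 1) := by
  obtain ⟨h1, h2, h3⟩ := mem_lvl.1 hf
  have h4 := glAct_mem_harm (lowOp_mat_mem c a) h1 h2
  rw [← lowOp_eq_glAct] at h4
  refine mem_lvl.2 ⟨h4.1, h4.2, ?_⟩
  rw [hOp_lowOp hc, h3, map_smul]
  push_cast
  module

lemma lowOp_neg_mem_lvl (hc : c * c = -1) {k s : ℤ} {f : SPoly (m + 2) n}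
    (hf : f ∈ lvl m n c k s) (a : Idx m n) : lowOp (-c) a f ∈ lvl m n c k (s + 1) := by
  rw [← neg_neg c, lvl_neg] at hf ⊢
  have := lowOp_mem_lvl (c := -c) (by rw [neg_mul_neg, hc]) hf a
  rw [neg_neg]
  rwa [neg_add, ← sub_eq_add_neg]

/-- The Euler operator is z∂_z + z̄∂_z̄ plus that of the remaining variables. On the slice the first
part acts on f as its weight s, leaving degree k - s. -/
lemma ev_mem_homog (hc : c * c = -1) {k s : ℤ} {f : SPoly (m + 2) n} (hf : f ∈ lvl m n c k s) :
    ev c f ∈ homog m n (k - s) := by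
  obtain ⟨h1, h2, h3⟩ := mem_lvl.1 hf
  rw [mem_homog] at h1 ⊢
  have e : mulX i0 (der i0 f) + mulX i1 (der i1 f) =
      nulX c (nulD c f) + nulX (-c) (nulD (-c) f) := by
    simp only [nulX_apply, nulD_apply, map_smul, map_sub]
    linear_combination (norm := module) hc • mulX i1 (der i1 f)
  have h4 := congrArg (ev c) (euler_apply f)
  rw [h1, e, map_add, map_add, ev_nulX hc, ev_nulX_neg hc, ev_nulD hc, h3] at h4
  simp only [map_sum, ev_mulX_up, ev_der_up, map_smul] at h4
  have h5 : euler m n (ev c f) = ∑ a, mulX a (der a (ev c f)) := by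
    simp only [euler, LinearMap.sum_apply, Module.End.mul_apply]
  rw [h5]
  push_cast
  linear_combination (norm := module) -h4

lemma ev_nulD_of_mem (hc : c * c = -1) {k s : ℤ} {f : SPoly (m + 2) n} (hf : f ∈ lvl m n c k s) :
    ev c (nulD c f) = (s : ℂ) • ev c f := by
  rw [ev_nulD hc, (mem_lvl.1 hf).2.2, map_smul]

/-- Since ∂_z̄ f has weight s + 1, a further ∂_z acts on the slice as s + 1. Harmonicity, 4∂_z∂_z̄ f
= -∇'²f with ∇'² the Laplacian of the remaining variables, thus recovers ∂_z̄ f on the slice from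
the restriction of f, provided s ≠ -1. -/
lemma ev_nulD_neg_of_mem (hc : c * c = -1) {k s : ℤ} {f : SPoly (m + 2) n}
    (hf : f ∈ lvl m n c k s) :
    (4 * (s + 1) : ℂ) • ev c (nulD (-c) f) = - laplace m n (ev c f) := by
  obtain ⟨h1, h2, h3⟩ := mem_lvl.1 hf
  have h4 := ev_laplace hc f
  rw [h2, map_zero, ev_nulD hc, hOp_nulD_neg hc, h3, map_smul, map_add, map_smul] at h4
  linear_combination (norm := module) -h4

lemma ev_lowOp (hc : c * c = -1) {k s : ℤ} {f : SPoly (m + 2) n} (hf : f ∈ lvl m n c k s)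
    (a : Idx m n) : ev c (lowOp c a f) = (s : ℂ) • mulX a (ev c f) := by
  rw [lowOp_apply, map_sub, map_smul, ev_nulX_neg hc, ev_mulX_up, ev_nulD_of_mem hc hf, smul_zero,
    sub_zero, map_smul]

/-- Eliminating ∂_z̄ f through harmonicity expresses the raising operators by the restriction alone.
Vectors annihilated by them therefore satisfy a differential system in the remaining variables. -/
lemma ev_lowOp_neg (hc : c * c = -1) {k s : ℤ} {f : SPoly (m + 2) n} (hf : f ∈ lvl m n c k s)
    (hs : (s : ℂ) + 1 ≠ 0) (a : Idx m n) : (-2 : ℂ) • ev c (lowOp (-c) a f) =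
      flatD a (ev c f) + (2 * (s + 1) : ℂ)⁻¹ • mulX a (laplace m n (ev c f)) := by
  have h1 : laplace m n (ev c f) = (-(4 * (s + 1)) : ℂ) • ev c (nulD (-c) f) := by
    rw [neg_smul, ev_nulD_neg_of_mem hc hf, neg_neg]
  rw [lowOp_apply, map_sub, map_smul, neg_neg, ev_nulX hc, ev_mulX_up, ev_flatD_up, h1, map_smul,
    smul_smul, show (2 * (s + 1) : ℂ)⁻¹ * (-(4 * (s + 1))) = -2 by field_simp; norm_num]
  module

lemma der_up_mem_lvl {k s : ℤ} {f : SPoly (m + 2) n} (hf : f ∈ lvl m n c k s) (a : Idx m n) :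
    der (up a) f ∈ lvl m n c (k - 1) s := by
  obtain ⟨h1, h2, h3⟩ := mem_lvl.1 hf
  refine mem_lvl.2 ⟨der_mem_homog h1 _, ?_, ?_⟩
  · rw [← Module.End.mul_apply, ← der_laplace, Module.End.mul_apply, h2, map_zero]
  · rw [hOp_der_up, h3, map_smul]

lemma nulD_mem_harm {k : ℤ} {f : SPoly (m + 2) n} (h1 : f ∈ homog (m + 2) n k)
    (h2 : laplace (m + 2) n f = 0) :
    nulD c f ∈ homog (m + 2) n (k - 1) ∧ laplace (m + 2) n (nulD c f) = 0 := by
  have h3 : ∀ a, laplace (m + 2) n (der a f) = 0 := fun a => by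
    rw [← Module.End.mul_apply, ← der_laplace, Module.End.mul_apply, h2, map_zero]
  rw [nulD_apply]
  refine ⟨Submodule.smul_mem _ _ (Submodule.sub_mem _ (der_mem_homog h1 _)
    (Submodule.smul_mem _ _ (der_mem_homog h1 _))), ?_⟩
  rw [map_smul, map_sub, map_smul, h3, h3, smul_zero, sub_zero, smul_zero]

lemma nulD_mem_lvl (hc : c * c = -1) {k s : ℤ} {f : SPoly (m + 2) n} (hf : f ∈ lvl m n c k s) :
    nulD c f ∈ lvl m n c (k - 1) (s - 1) := by
  obtain ⟨h1, h2, h3⟩ := mem_lvl.1 hf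
  obtain ⟨h4, h5⟩ := nulD_mem_harm (c := c) h1 h2
  refine mem_lvl.2 ⟨h4, h5, ?_⟩
  rw [hOp_nulD hc, h3, map_smul]
  push_cast; module

lemma nulD_neg_mem_lvl (hc : c * c = -1) {k s : ℤ} {f : SPoly (m + 2) n}
    (hf : f ∈ lvl m n c k s) : nulD (-c) f ∈ lvl m n c (k - 1) (s + 1) := by
  obtain ⟨h1, h2, h3⟩ := mem_lvl.1 hf
  obtain ⟨h4, h5⟩ := nulD_mem_harm (c := -c) h1 h2
  refine mem_lvl.2 ⟨h4, h5, ?_⟩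
  rw [hOp_nulD_neg hc, h3, map_smul]
  push_cast; module

lemma spoly_one_ne_zero : (1 : SPoly m n) ≠ 0 := by
  have : Nontrivial (SPoly m n) := ⟨monoBasis m n (0, ∅), 0, (monoBasis m n).ne_zero _⟩
  exact one_ne_zero

/-- A harmonic of nonnegative weight is determined by its restriction. -/
lemma eq_zero_of_ev_eq_zero (hc : c * c = -1) {k s : ℤ} (hs : 0 ≤ s) {f : SPoly (m + 2) n}
    (hf : f ∈ lvl m n c k s) (h0 : ev c f = 0) : f = 0 := by
  rcases lt_or_ge k 0 with hk | hk
  · have := (mem_lvl.1 hf).1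
    rwa [homog_of_neg hk, Submodule.mem_bot] at this
  lift k to ℕ using hk
  induction k generalizing s f with
  | zero =>
    obtain ⟨a, rfl⟩ := Submodule.mem_span_singleton.1 (homog_zero_le (mem_lvl.1 hf).1)
    rw [map_smul, ev_one, smul_eq_zero] at h0
    rw [h0.resolve_right spoly_one_ne_zero, zero_smul]
  | succ k ih =>
    obtain ⟨h1, h2, h3⟩ := mem_lvl.1 hf
    have ih' : ∀ {s : ℤ} {g : SPoly (m + 2) n}, 0 ≤ s → g ∈ lvl m n c ((k + 1 : ℕ) - 1) s →
        ev c g = 0 → g = 0 := fun hs hg h => ih hs h (by simpa using hg)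
    -- The derivatives of f are again harmonic weight vectors with zero restriction, so they vanish
    -- by induction on the degree; Euler's identity then gives f = 0.
    have e1 : ∀ a, der (up a) f = 0 := fun a =>
      ih' hs (der_up_mem_lvl hf a) (by rw [ev_der_up, h0, map_zero])
    have e2 : nulD (-c) f = 0 := by
      refine ih' (by omega) (nulD_neg_mem_lvl hc hf) ?_
      have := ev_nulD_neg_of_mem hc hf
      rw [h0, map_zero, neg_zero, smul_eq_zero] at this
      refine this.resolve_left (mul_ne_zero (by norm_num) ?_)
      have h4 : s + 1 ≠ 0 := by omega
      exact_mod_cast h4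
    have e3 : nulX c (nulD c f) = 0 := by
      -- For s = 0 the derivative ∂_z f has weight -1, out of reach of the induction. Then z∂_z f =
      -- z̄∂_z̄ f, and the right side is already known to vanish.
      rcases hs.eq_or_lt with rfl | hs
      · rw [hOp_eq, e2, map_zero, sub_zero] at h3
        simpa using h3
      · rw [ih' (by omega) (nulD_mem_lvl hc hf) (by rw [ev_nulD_of_mem hc hf, h0, smul_zero]),
          map_zero]
    have e4 : mulX i0 (der i0 f) + mulX i1 (der i1 f) =
        nulX c (nulD c f) + nulX (-c) (nulD (-c) f) := by
      simp only [nulX_apply, nulD_apply, map_smul, map_sub]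
      linear_combination (norm := module) hc • mulX i1 (der i1 f)
    rw [mem_homog, euler_apply, e4, e3, e2] at h1
    simp only [map_zero, e1, Finset.sum_const_zero, add_zero] at h1
    refine (smul_eq_zero.1 h1.symm).resolve_left ?_
    have h4 : ((k + 1 : ℕ) : ℤ) ≠ 0 := by omega
    exact_mod_cast h4

/-! ### The highest weight vector -/

/-- The power `(x_1 + c x_2)^k`. -/
def nulPow (m n : ℕ) (c : ℂ) (k : ℕ) : SPoly (m + 2) n := (nulX c ^ k) 1

lemma der_one (a : Idx m n) : der a (1 : SPoly m n) = 0 := by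
  have h : (1 : SPoly m n) = tm 1 1 := rfl
  have h0 : tm 0 1 = (0 : SPoly m n) := TensorProduct.zero_tmul _ _
  have h0' : tm 1 0 = (0 : SPoly m n) := TensorProduct.tmul_zero _ _
  rcases a with a | a
  · rw [h, der_inl]; simp [h0]
  · rw [h, der_inr, CliffordAlgebra.contractLeft_one, h0']

lemma nulPow_succ (c : ℂ) (k : ℕ) : nulPow m n c (k + 1) = nulX c (nulPow m n c k) := by
  rw [nulPow, pow_succ', Module.End.mul_apply, nulPow]

lemma der_nulPow (c : ℂ) (k : ℕ) (a : Idx (m + 2) n) : der a (nulPow m n c k) =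
    (k * ((if a = i0 then 1 else 0) + c * if a = i1 then 1 else 0) : ℂ) •
      nulPow m n c (k - 1) := by
  induction k with
  | zero => simp [nulPow, der_one]
  | succ k ih =>
    rw [nulPow_succ, nulX_apply, map_add, map_smul, der_mulX_apply (Or.inr rfl),
      der_mulX_apply (Or.inr rfl), ih, map_smul, map_smul]
    -- The truncated exponent k - 1 is harmless at k = 0, because its coefficient is zero.
    rcases k with _ | k
    · simp only [Nat.cast_zero, zero_mul, zero_smul, add_zero, Nat.cast_one, zero_add, Nat.sub_self,
        one_mul]
      split_ifs <;> simp [add_smul]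
    · simp only [Nat.add_sub_cancel]
      have h1 : nulPow m n c (k + 1) = mulX i0 (nulPow m n c k) + c • mulX i1 (nulPow m n c k) := by
        rw [nulPow_succ, nulX_apply]
      rw [h1]
      push_cast
      split_ifs <;> module

lemma nulPow_mem_lvl (hc : c * c = -1) (k : ℕ) : nulPow m n c k ∈ lvl m n c k k := by
  have h1 : ∀ b : Idx m n, der (up b) (nulPow m n c k) = 0 := fun b => by simp [der_nulPow]
  have h2 : nulD (-c) (nulPow m n c k) = 0 := by
    rw [nulD_apply, der_nulPow, der_nulPow]
    simp only [if_true, i0_ne_i1, i1_ne_i0, if_false]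
    linear_combination (norm := module) ((1 / 2 : ℂ) * k * hc) • nulPow m n c (k - 1)
  refine mem_lvl.2 ⟨?_, ?_, ?_⟩
  · clear h1 h2
    induction k with
    | zero =>
      rw [mem_homog]
      simp [nulPow, euler, -Fintype.sum_sum_type, der_one]
    | succ k ih =>
      rw [nulPow_succ, nulX_apply]
      push_cast
      exact Submodule.add_mem _ (mulX_mem_homog ih _) (Submodule.smul_mem _ _ (mulX_mem_homog ih _))
  · rw [laplace_eq_nulD hc, h2]
    simp [h1]
  · clear h1 h2
    induction k with
    | zero => simp [nulPow, hOp_apply, der_one]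
    | succ k ih =>
      rw [nulPow_succ, hOp_nulX hc, ih, map_smul]
      push_cast
      module

lemma ev_nulPow (hc : c * c = -1) (k : ℕ) : ev c (nulPow m n c k) = 1 := by
  induction k with
  | zero => simp [nulPow, ev_one]
  | succ k ih => rw [nulPow_succ, ev_nulX hc, ih]

lemma nulPow_ne_zero (hc : c * c = -1) (k : ℕ) : nulPow m n c k ≠ 0 := by
  intro h
  have := ev_nulPow (m := m) (n := n) hc k
  rw [h, map_zero] at this
  exact spoly_one_ne_zero this.symm

/-- The restriction of a harmonic of top weight has degree zero, so it is constant, and it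
determines the harmonic. -/
lemma lvl_self_le (hc : c * c = -1) (k : ℕ) :
    lvl m n c k k ≤ Submodule.span ℂ {nulPow m n c k} := by
  intro f hf
  have h1 := ev_mem_homog hc hf
  rw [sub_self] at h1
  obtain ⟨a, ha⟩ := Submodule.mem_span_singleton.1 (homog_zero_le h1)
  refine Submodule.mem_span_singleton.2 ⟨a, ?_⟩
  rw [← sub_eq_zero]
  refine eq_zero_of_ev_eq_zero hc (Int.natCast_nonneg k) (Submodule.sub_mem _
    (Submodule.smul_mem _ _ (nulPow_mem_lvl hc k)) hf) ?_
  rw [map_sub, map_smul, ev_nulPow hc, ha, sub_self]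

/-- A subspace that contains `(x_1 + c x_2)^k` and is stable under rotations contains harmonics
of nonnegative weight with arbitrary restriction. -/
lemma exists_mem_lvl_ev_eq (hc : c * c = -1) {U : Submodule ℂ (SPoly (m + 2) n)}
    (hU : ∀ a, ∀ f ∈ U, lowOp c a f ∈ U) {k : ℕ} (hk : nulPow m n c k ∈ U) {l : ℕ} (hl : l ≤ k)
    {p : SPoly m n} (hp : p ∈ homog m n l) : ∃ u ∈ U, u ∈ lvl m n c k (k - l) ∧ ev c u = p := by
  induction l generalizing p with
  | zero =>
    obtain ⟨a, rfl⟩ := Submodule.mem_span_singleton.1 (homog_zero_le hp)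
    refine ⟨a • nulPow m n c k, Submodule.smul_mem _ _ hk, Submodule.smul_mem _ _ ?_, ?_⟩
    · simpa using nulPow_mem_lvl hc k
    · rw [map_smul, ev_nulPow hc]
  | succ l ih =>
    -- Each ∂_a p is lifted by induction and then lowered along a. The sum restricts to (k - l) ∑
    -- X_a∂_a p = (k - l)(l + 1) p, and k - l ≠ 0 because l < k.
    have h1 : ∀ a, ∃ u ∈ U, u ∈ lvl m n c k (k - l) ∧ ev c u = der a p := fun a =>
      ih (by omega) (by simpa using der_mem_homog hp a)
    choose u hu1 hu2 hu3 using h1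
    have hkl : ((k : ℂ) - l) ≠ 0 := by
      have : (k : ℤ) - l ≠ 0 := by omega
      exact_mod_cast this
    have hl1 : ((l : ℂ) + 1) ≠ 0 := Nat.cast_add_one_ne_zero l
    refine ⟨(((k : ℂ) - l) * (l + 1))⁻¹ • ∑ a, lowOp c a (u a), Submodule.smul_mem _ _
      (Submodule.sum_mem _ fun a _ => hU a _ (hu1 a)), Submodule.smul_mem _ _
      (Submodule.sum_mem _ fun a _ => ?_), ?_⟩
    · have := lowOp_mem_lvl hc (hu2 a) a
      push_cast
      rwa [show (k : ℤ) - (l + 1) = k - l - 1 by ring]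
    · rw [map_smul, map_sum]
      have h2 : ∀ a, ev c (lowOp c a (u a)) = ((k : ℂ) - l) • mulX a (der a p) := fun a => by
        rw [ev_lowOp hc (hu2 a), hu3]
        push_cast; rfl
      have h3 : ∑ a, mulX a (der a p) = ((l : ℂ) + 1) • p := by
        have := mem_homog.1 hp
        simp only [euler, LinearMap.sum_apply, Module.End.mul_apply] at this
        rw [this]; push_cast; rfl
      simp only [h2]
      rw [← Finset.smul_sum, h3, smul_smul, smul_smul, mul_assoc,
        inv_mul_cancel₀ (mul_ne_zero hkl hl1), one_smul]

/-- The subspace contains an element of the same weight with the same restriction, and the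
restriction is injective for s ≥ 0. -/
lemma lvl_le_of_nulPow_mem (hc : c * c = -1) {U : Submodule ℂ (SPoly (m + 2) n)}
    (hU : ∀ a, ∀ f ∈ U, lowOp c a f ∈ U) {k : ℕ} (hk : nulPow m n c k ∈ U) {s : ℤ} (hs : 0 ≤ s) :
    lvl m n c k s ≤ U := by
  intro f hf
  have h1 := ev_mem_homog hc hf
  rcases lt_or_ge ((k : ℤ) - s) 0 with h | h
  · rw [homog_of_neg h, Submodule.mem_bot] at h1
    rw [eq_zero_of_ev_eq_zero hc hs hf h1]
    exact Submodule.zero_mem _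
  · obtain ⟨l, hl⟩ := Int.eq_ofNat_of_zero_le h
    rw [hl] at h1
    obtain ⟨u, hu1, hu2, hu3⟩ := exists_mem_lvl_ev_eq hc hU hk (by omega) h1
    rw [show (k : ℤ) - l = s by omega] at hu2
    have h2 := eq_zero_of_ev_eq_zero hc hs (Submodule.sub_mem _ hf hu2) (by
      rw [map_sub, hu3, sub_self])
    rwa [sub_eq_zero.1 h2]

end

section

variable {m n : ℕ}


/-! ### Divergence identities -/

lemma sum_upX_flatD_apply {d : ℤ} {p : SPoly m n} (hp : p ∈ homog m n d) :
    ∑ a, upX a (flatD a p) = (d : ℂ) • p := by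
  rw [← mem_homog.1 hp, ← sum_upX_mul_flatD, LinearMap.sum_apply]
  rfl

lemma sum_upX_mulX_apply (p : SPoly m n) : ∑ a, upX a (mulX a p) = mulR2 m n p := by
  rw [← sum_upX_mul_mulX, LinearMap.sum_apply]
  rfl

lemma sum_sD_flatD_apply (p : SPoly m n) : ∑ a, sD a (flatD a p) = laplace m n p := by
  rw [← sum_sD_mul_flatD, LinearMap.sum_apply]
  rfl

lemma sum_sD_mulX_apply {d : ℤ} {p : SPoly m n} (hp : p ∈ homog m n d) :
    ∑ a, sD a (mulX a p) = ((m : ℂ) - 2 * n + d) • p := by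
  have := LinearMap.congr_fun (sum_sD_mul_mulX (m := m) (n := n)) p
  rw [LinearMap.sum_apply, LinearMap.add_apply, mem_homog.1 hp] at this
  rw [add_smul]
  exact this

lemma mulR2_pow_upX (i : ℕ) (a : Idx m n) (p : SPoly m n) :
    (mulR2 m n ^ i) (upX a p) = upX a ((mulR2 m n ^ i) p) := by
  have h : Commute (mulR2 m n) (upX a) := by
    refine Commute.sum_right _ _ _ fun j _ => Commute.smul_right (mulR2_mulX j) _
  exact LinearMap.congr_fun (h.pow_left i).eq p

lemma sD_mulR2_pow (i : ℕ) (a : Idx m n) (p : SPoly m n) :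
    sD a ((mulR2 m n ^ (i + 1)) p) = (mulR2 m n ^ (i + 1)) (sD a p) +
      (2 * ((i : ℂ) + 1)) • (mulR2 m n ^ i) (upX a p) := by
  have key : ∀ g, sD a (mulR2 m n g) = mulR2 m n (sD a g) + (2 : ℂ) • upX a g := fun g =>
    LinearMap.congr_fun (sD_mulR2 a) g
  induction i with
  | zero => simpa using key p
  | succ i ih =>
    rw [pow_succ' _ (i + 1), Module.End.mul_apply, key, ih, map_add, map_smul,
      ← Module.End.mul_apply (mulR2 m n), ← Module.End.mul_apply (mulR2 m n), ← pow_succ',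
      ← mulR2_pow_upX, ← pow_succ']
    push_cast
    module

lemma sum_sD_mulR2_pow (i : ℕ) (g : Idx m n → SPoly m n) :
    ∑ a, sD a ((mulR2 m n ^ (i + 1)) (g a)) = (mulR2 m n ^ (i + 1)) (∑ a, sD a (g a)) +
      (2 * ((i : ℂ) + 1)) • (mulR2 m n ^ i) (∑ a, upX a (g a)) := by
  simp only [sD_mulR2_pow, Finset.sum_add_distrib, map_sum, Finset.smul_sum]

lemma sum_upX_mulR2_pow (i : ℕ) (g : Idx m n → SPoly m n) :
    ∑ a, upX a ((mulR2 m n ^ i) (g a)) = (mulR2 m n ^ i) (∑ a, upX a (g a)) := by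
  simp only [← mulR2_pow_upX, map_sum]

lemma mulR2_laplace_mulR2_pow {d : ℤ} {h : SPoly m n} (hh : h ∈ homog m n d) (i : ℕ) :
    mulR2 m n (laplace m n ((mulR2 m n ^ i) h)) = (mulR2 m n ^ (i + 1)) (laplace m n h) +
      (2 * (i : ℂ) * (2 * d + (m - 2 * n) + 2 * i - 2)) • (mulR2 m n ^ i) h := by
  rcases i with _ | i
  · simp
  · rw [laplace_mulR2_pow hh, map_add, map_smul, ← Module.End.mul_apply (mulR2 m n),
      ← Module.End.mul_apply (mulR2 m n), ← pow_succ', ← pow_succ']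
    congr 2
    push_cast; ring

lemma range_mulR2_pow_anti {i j : ℕ} (h : i ≤ j) :
    LinearMap.range (mulR2 m n ^ j) ≤ LinearMap.range (mulR2 m n ^ i) := by
  obtain ⟨d, rfl⟩ := Nat.exists_eq_add_of_le h
  rw [pow_add]
  exact LinearMap.range_comp_le_range _ _

/-- Divisibility by powers of `R²` at the critical degree. -/
lemma mem_range_mulR2_pow_of_critical (hm : 0 < m) {l s j : ℕ} (hM : (m : ℤ) - 2 * n = -l - 2 * s)
    (hj : 2 * j < l + 2) {p : SPoly m n} (hp : p ∈ homog m n l)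
    (h : (l : ℂ) • p + (2 * (s + 1) : ℂ)⁻¹ • mulR2 m n (laplace m n p) ∈
      LinearMap.range (mulR2 m n ^ j)) : p ∈ LinearMap.range (mulR2 m n ^ j) := by
  -- One factor R² is gained at a time. With p = R^{2i}q the given combination is R^{2i}(e q + t
  -- R²∇²q), so q is divisible by R² as soon as e ≠ 0.
  have key : ∀ i ≤ j, p ∈ LinearMap.range (mulR2 m n ^ i) := by
    intro i
    induction i with
    | zero => intro _; exact ⟨p, by simp⟩
    | succ i ih =>
      intro hi
      obtain ⟨q, rfl⟩ := ih (by omega)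
      obtain ⟨g, hg⟩ := range_mulR2_pow_anti hi h
      have hq := mem_homog_of_mulR2_pow hm hp
      rw [mulR2_laplace_mulR2_pow hq, pow_succ, Module.End.mul_apply, Module.End.mul_apply,
        ← map_smul, ← map_smul, ← map_add, ← map_smul, ← map_add] at hg
      have h1 := mulR2_pow_injective hm i hg
      set t : ℂ := (2 * (s + 1) : ℂ)⁻¹ with ht
      have hs : (s : ℂ) + 1 ≠ 0 := Nat.cast_add_one_ne_zero s
      have ht2 : t * (2 * (s + 1)) = 1 := inv_mul_cancel₀ (mul_ne_zero two_ne_zero hs)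
      have hM' : (m : ℂ) - 2 * n = -l - 2 * s := by exact_mod_cast congrArg (Int.cast (R := ℂ)) hM
      set e : ℂ := l + t * (2 * (i : ℂ) * (2 * ((l : ℤ) - 2 * i : ℤ) + (m - 2 * n) + 2 * i - 2))
        with he
      -- At the critical value of M the coefficient factors as 2t(l - 2i)(s + 1 + i). It is nonzero,
      -- because i < j and 2j < l + 2 give 2i < l.
      have he2 : e = t * (2 * (((l : ℂ) - 2 * i) * (s + 1 + i))) := by
        rw [he, hM']
        push_cast
        linear_combination (-(l : ℂ)) * ht2
      have he0 : e ≠ 0 := by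
        rw [he2]
        have h2 : (l : ℂ) - 2 * i ≠ 0 := by
          have : (l : ℤ) - 2 * i ≠ 0 := by omega
          exact_mod_cast this
        have h3 : (s : ℂ) + 1 + i ≠ 0 := by exact_mod_cast (by omega : s + 1 + i ≠ 0)
        exact mul_ne_zero (inv_ne_zero (mul_ne_zero two_ne_zero hs))
          (mul_ne_zero two_ne_zero (mul_ne_zero h2 h3))
      have h4 : e • q = mulR2 m n (g - t • laplace m n q) := by
        rw [map_sub, h1, map_smul, he]
        module
      refine ⟨e⁻¹ • (g - t • laplace m n q), ?_⟩
      rw [pow_succ, Module.End.mul_apply, map_smul, ← h4, smul_smul, inv_mul_cancel₀ he0, one_smul]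
  exact key j le_rfl

/-! ### Singular vectors -/

lemma mulR2_apply (f : SPoly m n) : mulR2 m n f = ∑ i : Fin m, mulX (.inl i) (mulX (.inl i) f)
    - ∑ j : Fin n, mulX (.inr (j, 0)) (mulX (.inr (j, 1)) f) := by
  simp [R2, mulX, sub_mul, Finset.sum_mul, mul_assoc]

lemma ev_mulR2 {c : ℂ} (hc : c * c = -1) (f : SPoly (m + 2) n) :
    ev c (mulR2 (m + 2) n f) = mulR2 m n (ev c f) := by
  rw [mulR2_apply, mulR2_apply, Fin.sum_univ_succ, Fin.sum_univ_succ]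
  have e0 : (Sum.inl 0 : Idx (m + 2) n) = i0 := rfl
  have e1 : (Sum.inl (Fin.succ 0) : Idx (m + 2) n) = i1 := rfl
  have e2 : ∀ i : Fin m, (Sum.inl i.succ.succ : Idx (m + 2) n) = up (.inl i) := fun _ => rfl
  have e3 : ∀ a, (Sum.inr a : Idx (m + 2) n) = up (.inr a) := fun _ => rfl
  simp only [e0, e1, e2, e3, map_sub, map_add, map_sum, ev_mulX_i0, ev_mulX_i1, ev_mulX_up,
    smul_smul]
  linear_combination (norm := module) ((1 / 4 : ℂ) * hc) • ev c f

lemma ev_mulR2_pow {c : ℂ} (hc : c * c = -1) (j : ℕ) (f : SPoly (m + 2) n) :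
    ev c ((mulR2 (m + 2) n ^ j) f) = (mulR2 m n ^ j) (ev c f) := by
  induction j with
  | zero => simp
  | succ j ih => rw [pow_succ', Module.End.mul_apply, ev_mulR2 hc, ih, pow_succ',
      Module.End.mul_apply]

lemma hOp_mulR2_pow (c : ℂ) (j : ℕ) (f : SPoly (m + 2) n) :
    hOp c ((mulR2 (m + 2) n ^ j) f) = (mulR2 (m + 2) n ^ j) (hOp c f) := by
  have h : Commute (mulR2 (m + 2) n) (hOp c) := by
    rw [hOp_eq_glAct]
    exact mulR2_glAct (hOp_mat_mem c)
  exact (LinearMap.congr_fun (h.pow_left j).eq f).symm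

variable {c : ℂ}

/-- For s ≥ 0 the restriction p satisfies `flatD a p + t • mulX a (laplace m n p) = 0` for all a,
and two contractions of this system kill p except at one critical degree. For s < 0, seen from the
opposite null coordinate, the raising operators become multiplications by the X_a. -/
lemma eq_zero_of_singular (hc : c * c = -1) {k : ℕ} (hk : 0 < m ∨ k ≤ n)
    (hex : ¬ IsExceptional (m + 2) n k) {s : ℤ} (hs : s < k) {f : SPoly (m + 2) n}
    (hf : f ∈ lvl m n c k s) (h : ∀ a, lowOp (-c) a f = 0) : f = 0 := by
  rcases le_or_gt 0 s with hs0 | hs0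
  · lift s to ℕ using hs0
    obtain ⟨l, rfl⟩ := Nat.exists_eq_add_of_lt (show s < k by exact_mod_cast hs)
    have hp := ev_mem_homog hc hf
    rw [show ((s + l + 1 : ℕ) : ℤ) - s = (l + 1 : ℕ) by push_cast; ring] at hp
    refine eq_zero_of_ev_eq_zero hc (Int.natCast_nonneg s) hf ?_
    have hs1 : (s : ℂ) + 1 ≠ 0 := Nat.cast_add_one_ne_zero s
    have hG := fun a => ev_lowOp_neg hc hf (by exact_mod_cast hs1) a
    simp only [h, map_zero, smul_zero, Int.cast_natCast] at hG
    set p := ev c f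
    set t : ℂ := (2 * (s + 1) : ℂ)⁻¹ with ht
    have ht0 : t ≠ 0 := inv_ne_zero (mul_ne_zero two_ne_zero hs1)
    have ht2 : t * (2 * (s + 1)) = 1 := inv_mul_cancel₀ (mul_ne_zero two_ne_zero hs1)
    -- Contraction with `upX`: Euler's identity and ∑ `upX a * mulX a` = R².
    have h1 : ((l + 1 : ℕ) : ℂ) • p + t • mulR2 m n (laplace m n p) = 0 := by
      rw [← Int.cast_natCast, ← sum_upX_flatD_apply hp, ← sum_upX_mulX_apply, Finset.smul_sum,
        ← Finset.sum_add_distrib]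
      refine Finset.sum_eq_zero fun a _ => ?_
      rw [← map_smul, ← map_add, ← hG, map_zero]
    -- Contraction with `sD`, where 1 is rewritten as 2t(s + 1) to collect the multiples of ∇²p.
    have h2 : (t * (2 * s + (m - 2 * n) + (l + 1))) • laplace m n p = 0 := by
      have e : ∑ a, sD a (flatD a p + t • mulX a (laplace m n p)) = 0 :=
        Finset.sum_eq_zero fun a _ => by rw [← hG, map_zero]
      simp only [map_add, map_smul, Finset.sum_add_distrib, ← Finset.smul_sum, sum_sD_flatD_apply,
        sum_sD_mulX_apply (laplace_mem_homog hp)] at e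
      rw [← e]
      push_cast
      linear_combination (norm := module) ht2 • laplace m n p
    -- If the factor vanishes, the second equation is empty. The first then forces divisibility of p
    -- by R^{2j} with j = (l + 2)/2 rounded down: too much for its degree l + 1 when l is even, and
    -- excluded by non-exceptionality when l is odd.
    by_cases hcrit : (2 * s + (m - 2 * n) + (l + 1) : ℤ) = 0
    · have hm : 0 < m := by
        rcases hk with hk | hk
        · exact hk
        · omega
      have h3 := mem_range_mulR2_pow_of_critical (l := l + 1) (s := s) (j := (l + 2) / 2) hm
        (by push_cast; omega) (by omega) hp (by rw [h1]; exact Submodule.zero_mem _)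
      obtain ⟨q, hq⟩ := h3
      rw [← hq] at hp
      have hq2 := mem_homog_of_mulR2_pow hm hp
      rcases Nat.even_or_odd l with ⟨r, hr⟩ | ⟨r, hr⟩
      · rw [homog_of_neg (by omega), Submodule.mem_bot] at hq2
        rw [← hq, hq2, map_zero]
      · exact absurd (isExceptional_of (m := m + 2) (n := n) (j := r + 1) (k := s + l + 1)
          (by omega) (by push_cast; omega) (by omega)) hex
    · have h3 : (2 * s + (m - 2 * n) + (l + 1) : ℂ) ≠ 0 := by exact_mod_cast hcrit
      have h4 := (smul_eq_zero.1 h2).resolve_left (mul_ne_zero ht0 h3)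
      rw [h4, map_zero, smul_zero, add_zero] at h1
      exact (smul_eq_zero.1 h1).resolve_left (by exact_mod_cast (Nat.succ_ne_zero l))
  · obtain ⟨σ, rfl⟩ : ∃ σ, s = -σ := ⟨-s, by ring⟩
    rw [← lvl_neg] at hf
    have hc' : -c * -c = -1 := by rw [neg_mul_neg, hc]
    refine eq_zero_of_ev_eq_zero hc' (by omega) hf ?_
    have hp := ev_mem_homog hc' hf
    have h1 : ∀ a, mulX a (ev (-c) f) = 0 := fun a => by
      have := ev_lowOp hc' hf a
      rw [h, map_zero] at this
      have h0 : (σ : ℂ) ≠ 0 := by exact_mod_cast (by omega : σ ≠ 0)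
      exact (smul_eq_zero.1 this.symm).resolve_left h0
    rcases hk with hm | hk
    · apply mulR2_injective hm
      rw [← sum_upX_mulX_apply, map_zero]
      simp [h1]
    -- With no bosonic variable left, R² need not be injective. Contraction with `sD` gives (-2n + k
    -- - σ)p = 0, whose factor is negative since σ > 0 and k ≤ n.
    · have h2 := sum_sD_mulX_apply hp
      simp only [h1, map_zero, Finset.sum_const_zero] at h2
      rcases Nat.eq_zero_or_pos m with hm | hm
      · refine (smul_eq_zero.1 h2.symm).resolve_left ?_
        have : (m : ℤ) - 2 * n + (k - σ) ≠ 0 := by omega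
        exact_mod_cast this
      · apply mulR2_injective hm
        rw [← sum_upX_mulX_apply, map_zero]
        simp [h1]

/-- If the restriction is R^{2j}q, lift q to a harmonic g of degree k - 2j. By the choice of j,
R^{2j}g is harmonic; it has the same weight and restriction as f, hence equals f. -/
lemma mem_map_of_ev_mem_range (hm : 0 < m) (hc : c * c = -1) {j k : ℕ}
    (hj : 2 * ((j : ℤ) - k) = m - 2 * n) (hjk : 2 * j ≤ k) {s : ℤ} (hs : 0 ≤ s)
    {f : SPoly (m + 2) n} (hf : f ∈ lvl m n c k s)
    (h : ev c f ∈ LinearMap.range (mulR2 m n ^ j)) :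
    f ∈ (harm (m + 2) n (k - 2 * j)).map (mulR2 (m + 2) n ^ j) := by
  obtain ⟨q, hq⟩ := h
  have hp := ev_mem_homog hc hf
  rw [← hq] at hp
  have hq2 := mem_homog_of_mulR2_pow hm hp
  rcases lt_or_ge ((k : ℤ) - s - 2 * j) 0 with h0 | h0
  · rw [homog_of_neg h0, Submodule.mem_bot] at hq2
    rw [eq_zero_of_ev_eq_zero hc hs hf (by rw [← hq, hq2, map_zero])]
    exact Submodule.zero_mem _
  · obtain ⟨l, hl⟩ := Int.eq_ofNat_of_zero_le h0
    rw [hl] at hq2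
    obtain ⟨g, -, hg, hgq⟩ := exists_mem_lvl_ev_eq (U := ⊤) (k := k - 2 * j) hc
      (fun _ _ _ => trivial) trivial (by omega) hq2
    obtain ⟨hg1, hg2, hg3⟩ := mem_lvl.1 hg
    refine ⟨g, ⟨hg1, hg2⟩, ?_⟩
    rw [Nat.cast_sub hjk] at hg1
    have h1 := mem_harm.1 (mulR2_pow_mem_harm (m := m + 2) (n := n) (j := j) (k := k)
      (by push_cast; omega) (by push_cast at hg1; exact hg1) hg2)
    have h2 : (mulR2 (m + 2) n ^ j) g ∈ lvl m n c k s := by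
      refine mem_lvl.2 ⟨h1.1, h1.2, ?_⟩
      rw [hOp_mulR2_pow, hg3, map_smul]
      congr 2
      omega
    rw [← sub_eq_zero]
    refine eq_zero_of_ev_eq_zero hc hs (Submodule.sub_mem _ h2 hf) ?_
    rw [map_sub, ev_mulR2_pow hc, hgq, hq, sub_self]

/-- The same contractions as in `eq_zero_of_singular`, now modulo multiples of R^{2j}. Contraction
with derivatives loses one factor R², which is regained on multiplying ∇²p by R². -/
lemma mem_map_of_singular (hm : 0 < m) (hc : c * c = -1) {j k : ℕ} (hj0 : 0 < j)
    (hj : 2 * ((j : ℤ) - k) = m - 2 * n) (hjk : 2 * j ≤ k) {s : ℤ} (hs : s < k)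
    {f : SPoly (m + 2) n} (hf : f ∈ lvl m n c k s)
    (h : ∀ a, lowOp (-c) a f ∈ (harm (m + 2) n (k - 2 * j)).map (mulR2 (m + 2) n ^ j)) :
    f ∈ (harm (m + 2) n (k - 2 * j)).map (mulR2 (m + 2) n ^ j) := by
  choose g hg1 hg2 using h
  obtain ⟨i, rfl⟩ := Nat.exists_eq_succ_of_ne_zero hj0.ne'
  rw [Nat.succ_eq_add_one] at *
  have hj' : 2 * ((i : ℂ) + 1 - k) = m - 2 * n := by
    exact_mod_cast congrArg (Int.cast (R := ℂ)) hj
  have hR : ∀ x : SPoly m n, (mulR2 m n ^ (i + 1)) x = mulR2 m n ((mulR2 m n ^ i) x) := fun x => by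
    rw [pow_succ', Module.End.mul_apply]
  rcases le_or_gt 0 s with hs0 | hs0
  · refine mem_map_of_ev_mem_range hm hc hj hjk hs0 hf ?_
    lift s to ℕ using hs0
    obtain ⟨l, rfl⟩ := Nat.exists_eq_add_of_lt (show s < k by exact_mod_cast hs)
    have hp := ev_mem_homog hc hf
    rw [show ((s + l + 1 : ℕ) : ℤ) - s = (l + 1 : ℕ) by push_cast; ring] at hp
    have hs1 : (s : ℂ) + 1 ≠ 0 := Nat.cast_add_one_ne_zero s
    have hG : ∀ a, (mulR2 m n ^ (i + 1)) (ev c ((-2 : ℂ) • g a)) = flatD a (ev c f) +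
        (2 * (s + 1) : ℂ)⁻¹ • mulX a (laplace m n (ev c f)) := fun a => by
      rw [map_smul, map_smul, ← ev_mulR2_pow hc, hg2]
      exact ev_lowOp_neg hc hf (by exact_mod_cast hs1) a
    set p := ev c f
    set t : ℂ := (2 * (s + 1) : ℂ)⁻¹ with ht
    have ht0 : t ≠ 0 := inv_ne_zero (mul_ne_zero two_ne_zero hs1)
    have ht2 : t * (2 * (s + 1)) = 1 := inv_mul_cancel₀ (mul_ne_zero two_ne_zero hs1)
    have h1 : ((l + 1 : ℕ) : ℂ) • p + t • mulR2 m n (laplace m n p) ∈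
        LinearMap.range (mulR2 m n ^ (i + 1)) := by
      refine ⟨∑ a, upX a (ev c ((-2 : ℂ) • g a)), ?_⟩
      rw [← sum_upX_mulR2_pow, ← Int.cast_natCast, ← sum_upX_flatD_apply hp, ← sum_upX_mulX_apply,
        Finset.smul_sum, ← Finset.sum_add_distrib]
      refine Finset.sum_congr rfl fun a _ => ?_
      rw [hG, map_add, map_smul]
    -- With the given exponent j = i + 1, the factor 2s + (m - 2n) + l + 1 equals 2j - (l + 1), so
    -- degree l + 1 = 2j is the critical one.
    by_cases hcrit : (l + 1 : ℤ) = 2 * (i + 1)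
    · exact mem_range_mulR2_pow_of_critical hm (by push_cast at *; omega) (by omega) hp h1
    · have h2 : (t * (2 * s + (m - 2 * n) + (l + 1))) • laplace m n p ∈
          LinearMap.range (mulR2 m n ^ i) := by
        have e : (t * (2 * s + (m - 2 * n) + (l + 1))) • laplace m n p =
            ∑ a, sD a ((mulR2 m n ^ (i + 1)) (ev c ((-2 : ℂ) • g a))) := by
          simp only [hG]
          simp only [map_add, map_smul, Finset.sum_add_distrib, ← Finset.smul_sum,
            sum_sD_flatD_apply, sum_sD_mulX_apply (laplace_mem_homog hp)]
          push_cast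
          linear_combination (norm := module) ht2 • laplace m n p
        rw [e, sum_sD_mulR2_pow]
        exact Submodule.add_mem _ (range_mulR2_pow_anti (Nat.le_succ i) ⟨_, rfl⟩)
          (Submodule.smul_mem _ _ ⟨_, rfl⟩)
      have h3 : (2 * s + (m - 2 * n) + (l + 1) : ℂ) ≠ 0 := by
        have : (2 * s + (m - 2 * n) + (l + 1) : ℤ) ≠ 0 := by push_cast at hj; omega
        exact_mod_cast this
      obtain ⟨q, hq⟩ := (Submodule.smul_mem_iff _ (mul_ne_zero ht0 h3)).1 h2
      have h4 : t • mulR2 m n (laplace m n p) ∈ LinearMap.range (mulR2 m n ^ (i + 1)) :=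
        Submodule.smul_mem _ _ ⟨q, by rw [hR, hq]⟩
      exact (Submodule.smul_mem_iff _ (by exact_mod_cast Nat.succ_ne_zero l)).1
        ((Submodule.add_mem_iff_left _ h4).1 h1)
  · obtain ⟨σ, rfl⟩ : ∃ σ, s = -σ := ⟨-s, by ring⟩
    rw [← lvl_neg] at hf
    have hc' : -c * -c = -1 := by rw [neg_mul_neg, hc]
    refine mem_map_of_ev_mem_range hm hc' hj hjk (by omega) hf ?_
    have hp := ev_mem_homog hc' hf
    have h0 : (σ : ℂ) ≠ 0 := by exact_mod_cast (by omega : σ ≠ 0)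
    have h1 : ∀ a, mulX a (ev (-c) f) = (mulR2 m n ^ (i + 1)) ((σ : ℂ)⁻¹ • ev (-c) (g a)) :=
      fun a => by
        have := ev_lowOp hc' hf a
        rw [← hg2, ev_mulR2_pow hc'] at this
        rw [map_smul, this, smul_smul, inv_mul_cancel₀ h0, one_smul]
    set p := ev (-c) f
    set G := ∑ a, upX a ((σ : ℂ)⁻¹ • ev (-c) (g a)) with hG
    -- Contraction with `upX` gives R²p = R^{2(i+1)}G, and one factor cancels. This yields one power
    -- of R² too few; contraction with `sD` supplies the last.
    have h2 : p = (mulR2 m n ^ i) G := by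
      apply mulR2_injective hm
      rw [← sum_upX_mulX_apply, ← hR, hG, ← sum_upX_mulR2_pow]
      simp only [h1]
    have h3 := sum_sD_mulX_apply hp
    simp only [h1] at h3
    rw [sum_sD_mulR2_pow, ← hG, ← h2, ← hj'] at h3
    -- The term 2(i + 1)R^{2i}G is 2(i + 1)p. Subtracting it from (m - 2n + k - σ)p and inserting m
    -- - 2n = 2(i + 1 - k) leaves -k - σ, which is negative.
    have h4 : (-(k : ℂ) - σ) • p ∈ LinearMap.range (mulR2 m n ^ (i + 1)) := by
      refine ⟨_, eq_sub_of_add_eq h3 |>.trans ?_⟩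
      push_cast
      module
    refine (Submodule.smul_mem_iff _ ?_).1 h4
    have : -(k : ℤ) - σ ≠ 0 := by omega
    exact_mod_cast this

end

section

variable {m n : ℕ}


/-! ### Decomposition into eigenvectors -/

/-- Applying T - t removes the t-component and multiplies every other component by s - t ≠ 0;
induction on the number of components does the rest. -/
lemma eigenvector_mem_of_sum_mem {V : Type*} [AddCommGroup V] [Module ℂ V] {T : Module.End ℂ V}
    {U : Submodule ℂ V} (hU : ∀ v ∈ U, T v ∈ U) (S : Finset ℤ) (g : ℤ → V)
    (hg : ∀ s ∈ S, T (g s) = (s : ℂ) • g s) (h : ∑ s ∈ S, g s ∈ U) : ∀ s ∈ S, g s ∈ U := by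
  induction S using Finset.induction_on generalizing g with
  | empty => simp
  | insert t S ht ih =>
    have h1 : ∀ s ∈ S, ((s : ℂ) - t) • g s ∈ U := by
      apply ih
      · intro s hs
        rw [map_smul, hg s (Finset.mem_insert_of_mem hs), smul_comm]
      · have h2 := U.sub_mem (hU _ h) (U.smul_mem (t : ℂ) h)
        rw [Finset.sum_insert ht, map_add, map_sum, hg t (Finset.mem_insert_self t S), smul_add,
          Finset.smul_sum, add_sub_add_left_eq_sub, ← Finset.sum_sub_distrib] at h2
        convert h2 using 2 with s hs
        rw [hg s (Finset.mem_insert_of_mem hs), sub_smul]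
    have h2 : ∀ s ∈ S, g s ∈ U := fun s hs => by
      refine (Submodule.smul_mem_iff _ ?_).1 (h1 s hs)
      rw [sub_ne_zero]
      exact_mod_cast fun e : s = t => ht (e ▸ hs)
    intro s hs
    rcases Finset.mem_insert.1 hs with rfl | hs
    · rw [Finset.sum_insert ht] at h
      exact (Submodule.add_mem_iff_left _ (Submodule.sum_mem _ h2)).1 h
    · exact h2 s hs

lemma idx_cases (a : Idx (m + 2) n) : a = i0 ∨ a = i1 ∨ ∃ b : Idx m n, a = up b := by
  rcases a with ⟨i, hi⟩ | a
  · rcases i with _ | _ | i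
    · exact Or.inl rfl
    · exact Or.inr (Or.inl rfl)
    · exact Or.inr (Or.inr ⟨.inl ⟨i, by omega⟩, rfl⟩)
  · exact Or.inr (Or.inr ⟨.inr a, rfl⟩)

variable {c : ℂ}

/-- Multiplications by z, z̄ and the remaining coordinates shift the weight by 1, -1 and 0, so the
span of the weight vectors contains 1 and is stable under all coordinates. -/
lemma iSup_eigenspace_hOp (hc : c * c = -1) :
    ⨆ s : ℤ, (hOp c : Module.End ℂ (SPoly (m + 2) n)).eigenspace (s : ℂ) = ⊤ := by
  set W := ⨆ s : ℤ, (hOp c : Module.End ℂ (SPoly (m + 2) n)).eigenspace (s : ℂ) with hW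
  have hmem : ∀ (s : ℤ) (f : SPoly (m + 2) n), hOp c f = (s : ℂ) • f → f ∈ W := fun s f hf =>
    Submodule.mem_iSup_of_mem s (Module.End.mem_eigenspace_iff.2 hf)
  have key : ∀ (A : Module.End ℂ (SPoly (m + 2) n)) (t : ℤ),
      (∀ f, hOp c (A f) = A (hOp c f) + (t : ℂ) • A f) → ∀ f ∈ W, A f ∈ W := by
    intro A t hA f hf
    have : W ≤ W.comap A := iSup_le fun s f hf => by
      refine hmem (s + t) _ ?_
      rw [hA, Module.End.mem_eigenspace_iff.1 hf, map_smul]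
      push_cast; module
    exact this hf
  have k1 := key (nulX c) 1 fun f => by rw [hOp_nulX hc]; simp
  have k2 := key (nulX (-c)) (-1) fun f => by rw [hOp_nulX_neg hc]; push_cast; module
  have k3 := fun b : Idx m n => key (mulX (up b)) 0 fun f => by rw [hOp_mulX_up]; simp
  have hc0 : c ≠ 0 := by rintro rfl; simp at hc
  refine eq_top_of_mulX ?_ ?_
  · refine hmem 0 1 ?_
    simp [hOp_apply, der_one]
  · intro f hf a
    rcases idx_cases a with rfl | rfl | ⟨b, rfl⟩
    · have : mulX i0 f = (1 / 2 : ℂ) • (nulX c f + nulX (-c) f) := by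
        simp only [nulX_apply]; module
      rw [this]
      exact W.smul_mem _ (W.add_mem (k1 f hf) (k2 f hf))
    · have : mulX i1 f = (2 * c)⁻¹ • (nulX c f - nulX (-c) f) := by
        rw [eq_inv_smul_iff₀ (mul_ne_zero two_ne_zero hc0)]
        simp only [nulX_apply]; module
      rw [this]
      exact W.smul_mem _ (W.sub_mem (k1 f hf) (k2 f hf))
    · exact k3 b f hf

lemma exists_sum_eigenvectors_hOp (hc : c * c = -1) {U : Submodule ℂ (SPoly (m + 2) n)}
    (hU : ∀ f ∈ U, hOp c f ∈ U) {f : SPoly (m + 2) n} (hf : f ∈ U) :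
    ∃ (S : Finset ℤ) (g : ℤ → SPoly (m + 2) n), f = ∑ s ∈ S, g s ∧
      ∀ s ∈ S, g s ∈ U ∧ hOp c (g s) = (s : ℂ) • g s := by
  have h : f ∈ ⨆ s : ℤ, (hOp c : Module.End ℂ (SPoly (m + 2) n)).eigenspace (s : ℂ) := by
    rw [iSup_eigenspace_hOp hc]; trivial
  obtain ⟨g, hg, rfl⟩ := (Submodule.mem_iSup_iff_exists_finsupp _ _).1 h
  have hg' : ∀ s ∈ g.support, hOp c (g s) = (s : ℂ) • g s := fun s _ =>
    Module.End.mem_eigenspace_iff.1 (hg s)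
  exact ⟨g.support, g, rfl, fun s hs =>
    ⟨eigenvector_mem_of_sum_mem hU _ _ hg' hf s hs, hg' s hs⟩⟩

/-! ### Irreducibility of the quotient -/

lemma lvl_of_lt (hc : c * c = -1) {k : ℕ} {s : ℤ} (hs : k < s) : lvl m n c k s = ⊥ := by
  refine (Submodule.eq_bot_iff _).2 fun f hf => eq_zero_of_ev_eq_zero hc (by omega) hf ?_
  have := ev_mem_homog hc hf
  rwa [homog_of_neg (by omega), Submodule.mem_bot] at this

/-- If z and z̄ are the only bosonic variables, the exponent would be j = k - n, which is not
positive for k ≤ n. -/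
lemma pos_of_isExceptional {k : ℕ} (hk : 0 < m ∨ k ≤ n) (h : IsExceptional (m + 2) n k) :
    0 < m := by
  obtain ⟨j, h0, h1, h2⟩ := exists_of_isExceptional h
  rcases hk with hk | hk
  · exact hk
  · push_cast at h1
    omega

lemma mem_inf_of_singular (hc : c * c = -1) {k : ℕ} (hk : 0 < m ∨ k ≤ n) {s : ℤ} (hs : s < k)
    {f : SPoly (m + 2) n} (hf : f ∈ lvl m n c k s)
    (h : ∀ a, lowOp (-c) a f ∈ harm (m + 2) n k ⊓ R2homog (m + 2) n k) :
    f ∈ harm (m + 2) n k ⊓ R2homog (m + 2) n k := by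
  by_cases hex : IsExceptional (m + 2) n k
  · have hm := pos_of_isExceptional hk hex
    obtain ⟨j, h0, h1, h2⟩ := exists_of_isExceptional hex
    rw [harm_inf_R2homog_eq_map (by omega) h0 h1 h2] at h ⊢
    exact mem_map_of_singular hm hc h0 (by push_cast at h1; omega) h2 hs hf h
  · rw [harm_inf_R2homog_of_not_isExceptional (by omega) hex] at h ⊢
    exact (Submodule.mem_bot ℂ).2 (eq_zero_of_singular hc hk hex hs hf fun a =>
      (Submodule.mem_bot ℂ).1 (h a))

lemma nulPow_mem_harm (hc : c * c = -1) (k : ℕ) : nulPow m n c k ∈ harm (m + 2) n k := by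
  have := mem_lvl.1 (nulPow_mem_lvl (m := m) (n := n) hc k)
  exact mem_harm.2 ⟨this.1, this.2.1⟩

/-- The restriction of z^k is 1. In the exceptional case it would be a multiple of a positive power
of R², which its degree forbids. -/
lemma nulPow_notMem (hc : c * c = -1) {k : ℕ} (hk : 0 < m ∨ k ≤ n) :
    nulPow m n c k ∉ harm (m + 2) n k ⊓ R2homog (m + 2) n k := by
  by_cases hex : IsExceptional (m + 2) n k
  · have hm := pos_of_isExceptional hk hex
    obtain ⟨j, h0, h1, h2⟩ := exists_of_isExceptional hex
    rw [harm_inf_R2homog_eq_map (by omega) h0 h1 h2]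
    rintro ⟨g, -, hg⟩
    have h3 := ev_mulR2_pow hc j g
    rw [hg, ev_nulPow hc] at h3
    have h4 : (1 : SPoly m n) ∈ homog m n 0 := by
      have := ev_mem_homog hc (nulPow_mem_lvl (m := m) (n := n) hc k)
      rwa [sub_self, ev_nulPow hc] at this
    rw [h3] at h4
    have h5 := mem_homog_of_mulR2_pow hm h4
    rw [homog_of_neg (by omega), Submodule.mem_bot] at h5
    rw [h5, map_zero] at h3
    exact spoly_one_ne_zero h3
  · rw [harm_inf_R2homog_of_not_isExceptional (by omega) hex, Submodule.mem_bot]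
    exact nulPow_ne_zero hc k

/-- Choose in U a weight vector outside the intersection with R²P_{k-2}, of maximal weight. Raising
it lands in the intersection by maximality, so by `mem_inf_of_singular` its weight must be k, where
z^k spans. -/
lemma nulPow_mem_of_stable (hc : c * c = -1) {k : ℕ} (hk : 0 < m ∨ k ≤ n)
    {U : Submodule ℂ (SPoly (m + 2) n)} (hU : ∀ X ∈ osp (m + 2) n, ∀ f ∈ U, glAct _ _ X f ∈ U)
    (hle : U ≤ harm (m + 2) n k) (hne : ¬ U ≤ harm (m + 2) n k ⊓ R2homog (m + 2) n k) :
    nulPow m n c k ∈ U := by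
  have hUh : ∀ f ∈ U, hOp c f ∈ U := by
    rw [hOp_eq_glAct]; exact hU _ (hOp_mat_mem c)
  have hUl : ∀ a, ∀ f ∈ U, lowOp (-c) a f ∈ U := fun a => by
    rw [lowOp_eq_glAct]; exact hU _ (lowOp_mat_mem (-c) a)
  set I := harm (m + 2) n k ⊓ R2homog (m + 2) n k with hI
  let P : ℤ → Prop := fun s => ∃ g ∈ U, g ∈ lvl m n c k s ∧ g ∉ I
  have hbdd : ∀ s, P s → s ≤ k := by
    rintro s ⟨g, -, hg, hgI⟩
    by_contra! hs
    rw [lvl_of_lt hc hs, Submodule.mem_bot] at hg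
    exact hgI (hg ▸ I.zero_mem)
  have hex : ∃ s, P s := by
    obtain ⟨f, hf, hfI⟩ := Set.not_subset.1 hne
    obtain ⟨S, g, rfl, hg⟩ := exists_sum_eigenvectors_hOp hc hUh hf
    by_contra! hP
    refine hfI (I.sum_mem fun s hs => ?_)
    by_contra hgs
    have h1 := mem_harm.1 (hle (hg s hs).1)
    exact hP s ⟨g s, (hg s hs).1, mem_lvl.2 ⟨h1.1, h1.2, (hg s hs).2⟩, hgs⟩
  obtain ⟨s, ⟨g, hgU, hgs, hgI⟩, hmax⟩ := Int.exists_greatest_of_bdd ⟨k, hbdd⟩ hex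
  rcases lt_or_eq_of_le (hbdd s ⟨g, hgU, hgs, hgI⟩) with hs | rfl
  · refine absurd (mem_inf_of_singular hc hk hs hgs fun a => ?_) hgI
    by_contra h
    have := hmax (s + 1) ⟨_, hUl a g hgU, lowOp_neg_mem_lvl hc hgs a, h⟩
    omega
  · obtain ⟨b, rfl⟩ := Submodule.mem_span_singleton.1 (lvl_self_le hc k hgs)
    refine (U.smul_mem_iff fun hb => hgI ?_).1 hgU
    rw [hb, zero_smul]
    exact I.zero_mem

/-- The previous lemma, used for both square roots of -1, puts z^k and z̄^k into U. The first
generates the harmonics of weight s ≥ 0, the second those of weight s ≤ 0. -/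
lemma eq_harm_of_stable {k : ℕ} (hk : 0 < m ∨ k ≤ n)
    {U : Submodule ℂ (SPoly (m + 2) n)} (hU : ∀ X ∈ osp (m + 2) n, ∀ f ∈ U, glAct _ _ X f ∈ U)
    (hle : U ≤ harm (m + 2) n k) (hne : ¬ U ≤ harm (m + 2) n k ⊓ R2homog (m + 2) n k) :
    U = harm (m + 2) n k := by
  refine le_antisymm hle fun f hf => ?_
  have hc := Complex.I_mul_I
  have hc' : -Complex.I * -Complex.I = -1 := by rw [neg_mul_neg, hc]
  have hUl : ∀ c a, ∀ f ∈ U, lowOp c a f ∈ U := fun c a => by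
    rw [lowOp_eq_glAct]; exact hU _ (lowOp_mat_mem c a)
  have hh : ∀ f ∈ harm (m + 2) n k, hOp Complex.I f ∈ harm (m + 2) n k := by
    intro f hf
    rw [hOp_eq_glAct]
    exact mem_harm.2 (glAct_mem_harm (hOp_mat_mem _) (mem_harm.1 hf).1 (mem_harm.1 hf).2)
  obtain ⟨S, g, rfl, hg⟩ := exists_sum_eigenvectors_hOp hc hh hf
  refine U.sum_mem fun s hs => ?_
  have h1 : g s ∈ lvl m n Complex.I k s :=
    mem_lvl.2 ⟨(mem_harm.1 (hg s hs).1).1, (mem_harm.1 (hg s hs).1).2, (hg s hs).2⟩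
  rcases le_total 0 s with h0 | h0
  · exact lvl_le_of_nulPow_mem hc (hUl _) (nulPow_mem_of_stable hc hk hU hle hne) h0 h1
  · replace h1 : g s ∈ lvl m n (-Complex.I) k (-s) := by rwa [lvl_neg, neg_neg]
    exact lvl_le_of_nulPow_mem hc' (hUl _) (nulPow_mem_of_stable hc' hk hU hle hne)
      (neg_nonneg.2 h0) h1

theorem quotRep_isSimple {k : ℕ} (hk : 0 < m ∨ k ≤ n) : (quotRep (m + 2) n k).IsSimple := by
  have hcap : ∀ x : harm (m + 2) n k, x ∈ harmCap (m + 2) n k ↔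
      (x : SPoly (m + 2) n) ∈ harm (m + 2) n k ⊓ R2homog (m + 2) n k :=
    fun x => ⟨fun h => ⟨x.2, h⟩, fun h => h.2⟩
  refine ⟨⟨(harmCap (m + 2) n k).mkQ ⟨_, nulPow_mem_harm Complex.I_mul_I k⟩, 0, fun h => ?_⟩,
    fun W hW => ?_⟩
  · rw [Submodule.mkQ_apply, Submodule.Quotient.mk_eq_zero, hcap] at h
    exact nulPow_notMem Complex.I_mul_I hk h
  · set U := (W.comap (harmCap (m + 2) n k).mkQ).map (harm (m + 2) n k).subtype with hUdef
    have hUle : U ≤ harm (m + 2) n k := Submodule.map_subtype_le _ _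
    have hU : ∀ X ∈ osp (m + 2) n, ∀ f ∈ U, glAct _ _ X f ∈ U := by
      rintro X hX _ ⟨f, hf, rfl⟩
      exact ⟨(harmRep (m + 2) n k).act ⟨X, hX⟩ f, hW.2 ⟨X, hX⟩ _ hf, rfl⟩
    have hmem : ∀ f : harm (m + 2) n k, (f : SPoly (m + 2) n) ∈ U →
        (harmCap (m + 2) n k).mkQ f ∈ W := by
      rintro f ⟨g, hg, hgf⟩
      rw [← Subtype.ext hgf]
      exact hg
    by_cases hne : U ≤ harm (m + 2) n k ⊓ R2homog (m + 2) n k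
    · left
      refine (Submodule.eq_bot_iff _).2 fun w hw => ?_
      obtain ⟨f, rfl⟩ := Submodule.mkQ_surjective _ w
      rw [Submodule.mkQ_apply, Submodule.Quotient.mk_eq_zero, hcap]
      exact hne ⟨f, hw, rfl⟩
    · right
      refine Submodule.eq_top_iff'.2 fun w => ?_
      obtain ⟨f, rfl⟩ := Submodule.mkQ_surjective _ w
      apply hmem
      rw [eq_harm_of_stable hk hU hUle hne]
      exact f.2

end

section

variable {m n : ℕ}


/-! ### Bilinear rotations -/

/-- The bilinear extension of `rot`. -/
def rotV : (Idx m n → ℂ) →ₗ[ℂ] (Idx m n → ℂ) →ₗ[ℂ] SMat m n :=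
  LinearMap.mk₂ ℂ (fun u v => ∑ i, ∑ j, (u i * v j) • rot i j)
    (fun u u' v => by simp only [Pi.add_apply, add_mul, add_smul, Finset.sum_add_distrib])
    (fun a u v => by simp only [Pi.smul_apply, smul_eq_mul, mul_assoc, mul_smul, Finset.smul_sum])
    (fun u v v' => by simp only [Pi.add_apply, mul_add, add_smul, Finset.sum_add_distrib])
    (fun a u v => by
      simp only [Pi.smul_apply, smul_eq_mul, mul_left_comm _ a, mul_smul, Finset.smul_sum])

lemma rotV_apply (u v : Idx m n → ℂ) : rotV u v = ∑ i, ∑ j, (u i * v j) • rot i j := rfl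

lemma rotV_single (i j : Idx m n) : rotV (Pi.single i 1) (Pi.single j 1) = rot i j := by
  rw [rotV_apply, Finset.sum_eq_single i, Finset.sum_eq_single j]
  · simp
  · intro b _ hb; simp [hb]
  · simp
  · intro b _ hb; simp [hb]
  · simp

lemma rotV_mem (u v : Idx m n → ℂ) : rotV u v ∈ osp m n :=
  Submodule.sum_mem _ fun _ _ => Submodule.sum_mem _ fun _ _ => Submodule.smul_mem _ _ (rot_mem _ _)

lemma rot_swap (i j : Idx m n) : rot i j = -(sgn (par i) (par j) • rot j i) := by
  ext k l
  simp only [rot, Matrix.of_apply, Matrix.neg_apply, Matrix.smul_apply, smul_eq_mul]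
  rw [sgn_comm (par j) (par i)]
  linear_combination -(if k = i then gram m n j l else 0) * sgn_mul_self (par i) (par j)

/-- `v` is homogeneous of parity `p`. -/
def IsHomogV (p : ZMod 2) (v : Idx m n → ℂ) : Prop := ∀ i, v i ≠ 0 → par i = p

lemma rotV_swap {p q : ZMod 2} {u v : Idx m n → ℂ} (hu : IsHomogV p u) (hv : IsHomogV q v) :
    rotV u v = -(sgn p q • rotV v u) := by
  rw [rotV_apply, rotV_apply, Finset.sum_comm, Finset.smul_sum, ← Finset.sum_neg_distrib]
  refine Finset.sum_congr rfl fun j _ => ?_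
  rw [Finset.smul_sum, ← Finset.sum_neg_distrib]
  refine Finset.sum_congr rfl fun i _ => ?_
  by_cases h1 : u i = 0
  · simp [h1]
  by_cases h2 : v j = 0
  · simp [h2]
  rw [rot_swap, hu i h1, hv j h2, smul_neg, smul_comm, mul_comm]

lemma isHomog_rot (i j : Idx m n) : IsHomog (par i + par j) (rot i j) := by
  intro k l h
  by_contra h2
  apply h
  have e1 : (if k = i then gram m n j l else 0) = 0 := by
    split_ifs with hk
    · by_contra h3
      exact h2 (by rw [hk, gram_even h3])
    · rfl
  have e2 : (if k = j then gram m n i l else 0) = 0 := by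
    split_ifs with hk
    · by_contra h3
      exact h2 (by rw [hk, gram_even h3, add_comm])
    · rfl
  simp only [rot, Matrix.of_apply, e1, e2, mul_zero, sub_zero]

lemma isHomog_rotV {p q : ZMod 2} {u v : Idx m n → ℂ} (hu : IsHomogV p u) (hv : IsHomogV q v) :
    IsHomog (p + q) (rotV u v) := by
  intro k l h
  rw [rotV_apply, Matrix.sum_apply] at h
  obtain ⟨i, -, hi⟩ := Finset.exists_ne_zero_of_sum_ne_zero h
  rw [Matrix.sum_apply] at hi
  obtain ⟨j, -, hj⟩ := Finset.exists_ne_zero_of_sum_ne_zero hi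
  rw [Matrix.smul_apply, smul_eq_mul] at hj
  rw [← hu i (left_ne_zero_of_mul (left_ne_zero_of_mul hj)),
    ← hv j (right_ne_zero_of_mul (left_ne_zero_of_mul hj))]
  exact isHomog_rot i j k l (right_ne_zero_of_mul hj)

lemma even_transpose_mul_gram {X : SMat m n} (hX : X ∈ osp m n) (h0 : IsHomog 0 X) (i j : Idx m n) :
    ∑ k, X k i * gram m n k j = -(gram m n * X) i j := by
  have h := hX i j
  rw [Matrix.mul_apply]
  by_cases hp : par i = par j
  · rw [hp, show par j + par j = (0 : ZMod 2) from CharTwo.add_self_eq_zero _, sgn_zero_left,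
      one_mul] at h
    exact eq_neg_of_add_eq_zero_left h
  · have key : ∀ a b c, X a b ≠ 0 → gram m n c a ≠ 0 → par c = par b := fun a b c h1 h2 => by
      have := h0 a b h1
      rw [gram_even h2]
      exact CharTwo.add_eq_zero.1 this
    rw [Finset.sum_eq_zero, Finset.sum_eq_zero, neg_zero]
    · intro k _
      by_contra h3
      exact hp (key k j i (right_ne_zero_of_mul h3) (left_ne_zero_of_mul h3))
    · intro k _
      by_contra h3
      refine hp (key k i j (left_ne_zero_of_mul h3) ?_).symm
      have h4 := right_ne_zero_of_mul h3
      contrapose! h4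
      rw [gram_symm, h4, mul_zero]

/-- The map `rot` is equivariant, so bracketing with an even X acts by X on each of the two
coordinates. The even case suffices: it is applied to Cartan elements only. -/
lemma commutator_rot {X : SMat m n} (hX : X ∈ osp m n) (h0 : IsHomog 0 X) (i j : Idx m n) :
    X * rot i j - rot i j * X = ∑ k, X k i • rot k j + ∑ k, X k j • rot i k := by
  ext k l
  have e1 : (X * rot i j) k l =
      X k i * gram m n j l - sgn (par i) (par j) * (X k j * gram m n i l) := by
    simp only [Matrix.mul_apply, rot, Matrix.of_apply, mul_sub, Finset.sum_sub_distrib]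
    simp [mul_left_comm]
  have e2 : (rot i j * X) k l = (if k = i then (gram m n * X) j l else 0) -
      sgn (par i) (par j) * if k = j then (gram m n * X) i l else 0 := by
    simp only [Matrix.mul_apply, rot, Matrix.of_apply, sub_mul, Finset.sum_sub_distrib, mul_assoc,
      ← Finset.mul_sum]
    congr 1
    · split_ifs <;> simp
    · split_ifs <;> simp
  have hs : ∀ a b r q, X a b * (sgn (par a) q * r) = sgn (par b) q * (X a b * r) := by
    intro a b r q
    by_cases h : X a b = 0
    · simp [h]
    · rw [CharTwo.add_eq_zero.1 (h0 a b h)]; ring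
  have e3 : ∑ r, X r i * rot r j k l = X k i * gram m n j l -
      sgn (par i) (par j) * if k = j then ∑ r, X r i * gram m n r l else 0 := by
    simp only [rot, Matrix.of_apply, mul_sub, Finset.sum_sub_distrib, hs, ← Finset.mul_sum]
    congr 1
    · simp
    · split_ifs <;> simp
  have e4 : ∑ r, X r j * rot i r k l = (if k = i then ∑ r, X r j * gram m n r l else 0) -
      sgn (par i) (par j) * (X k j * gram m n i l) := by
    simp only [rot, Matrix.of_apply, mul_sub, Finset.sum_sub_distrib, sgn_comm (par i), hs,
      ← Finset.mul_sum]
    congr 1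
    · split_ifs <;> simp
    · simp
  simp only [Matrix.sub_apply, Matrix.add_apply, Matrix.sum_apply, Matrix.smul_apply, smul_eq_mul]
  rw [e1, e2, e3, e4, even_transpose_mul_gram hX h0, even_transpose_mul_gram hX h0]
  split_ifs <;> ring

lemma commutator_rotV {X : SMat m n} (hX : X ∈ osp m n) (h0 : IsHomog 0 X) (u v : Idx m n → ℂ) :
    X * rotV u v - rotV u v * X = rotV (X.mulVec u) v + rotV u (X.mulVec v) := by
  have h : ∀ i j, X * (u i * v j) • rot i j - (u i * v j) • rot i j * X =
      ∑ k, (X k i * u i * v j) • rot k j + ∑ k, (u i * (X k j * v j)) • rot i k := by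
    intro i j
    rw [Matrix.mul_smul, Matrix.smul_mul, ← smul_sub, commutator_rot hX h0, smul_add,
      Finset.smul_sum, Finset.smul_sum]
    congr 1 <;> refine Finset.sum_congr rfl fun k _ => ?_ <;> rw [smul_smul] <;> ring_nf
  simp only [rotV_apply, Finset.mul_sum, Finset.sum_mul, ← Finset.sum_sub_distrib, h,
    Finset.sum_add_distrib, Matrix.mulVec, dotProduct, Finset.sum_smul]
  congr 1
  · rw [Finset.sum_comm, Finset.sum_congr rfl fun j _ => Finset.sum_comm, Finset.sum_comm]
  · refine Finset.sum_congr rfl fun i _ => ?_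
    rw [Finset.sum_comm]

end

section

variable {m n : ℕ}


/-! ### Weight vectors -/

/-- Labels of a basis of weight vectors of the span of the coordinates. -/
inductive WLabel (m n : ℕ) : Type
  | pos (a : WIdx m n)
  | neg (a : WIdx m n)
  | zero (h : Odd m)

namespace WLabel

/-- The weight. -/
def wt : WLabel m n → WIdx m n → ℂ
  | pos a => Pi.single a 1
  | neg a => -Pi.single a 1
  | zero _ => 0

/-- The parity. -/
def parity : WLabel m n → ZMod 2
  | pos (.inl _) => 0
  | pos (.inr _) => 1
  | neg (.inl _) => 0
  | neg (.inr _) => 1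
  | zero _ => 0

/-- The weight vector. -/
def vec : WLabel m n → Idx m n → ℂ
  | pos (.inl j) => Pi.single (bosFst j) 1 + Complex.I • Pi.single (bosSnd j) 1
  | pos (.inr j) => Pi.single (.inr (j, 0)) 1
  | neg (.inl j) => Pi.single (bosFst j) 1 - Complex.I • Pi.single (bosSnd j) 1
  | neg (.inr j) => Pi.single (.inr (j, 1)) 1
  | zero h => Pi.single (.inl ⟨m - 1, Nat.sub_lt h.pos one_pos⟩) 1

end WLabel

open WLabel

lemma isHomogV_single (i : Idx m n) : IsHomogV (par i) (Pi.single i (1 : ℂ)) := by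
  intro j h
  by_cases e : j = i
  · rw [e]
  · simp [e] at h

lemma isHomogV_vec (p : WLabel m n) : IsHomogV p.parity p.vec := by
  rcases p with (j | j) | (j | j) | h
  · intro i hi
    by_contra h2
    rcases i with i | i <;> simp_all [vec, parity, par, bosFst, bosSnd]
  · exact isHomogV_single _
  · intro i hi
    by_contra h2
    rcases i with i | i <;> simp_all [vec, parity, par, bosFst, bosSnd]
  · exact isHomogV_single _
  · exact isHomogV_single _

lemma isHomog_cartan (a : WIdx m n) : IsHomog 0 (cartan m n a) := by
  intro i j h
  by_contra h2
  apply h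
  rcases a with a | a <;> rcases i with i | ⟨i, r⟩ <;> rcases j with j | ⟨j, s⟩ <;>
    simp_all [cartan, par, bosFst, bosSnd, CharTwo.add_self_eq_zero]

lemma cartan_mulVec_vec (a : WIdx m n) (p : WLabel m n) :
    (cartan m n a).mulVec p.vec = p.wt a • p.vec := by
  have hne1 : ∀ i j : Fin (m / 2), (bosFst i : Idx m n) ≠ bosSnd j := fun i j h => by
    simp only [bosFst, bosSnd, Sum.inl.injEq, Fin.mk.injEq] at h; omega
  have hfst : ∀ i j : Fin (m / 2), (bosFst i : Idx m n) = bosFst j ↔ i = j := fun i j => by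
    simp only [bosFst, Sum.inl.injEq, Fin.ext_iff]; omega
  have hsnd : ∀ i j : Fin (m / 2), (bosSnd i : Idx m n) = bosSnd j ↔ i = j := fun i j => by
    simp only [bosSnd, Sum.inl.injEq, Fin.ext_iff]; omega
  have hf : ∀ (j : Fin (m / 2)) b, (bosFst j : Idx m n) ≠ .inr b := fun _ _ => Sum.inl_ne_inr
  have hs : ∀ (j : Fin (m / 2)) b, (bosSnd j : Idx m n) ≠ .inr b := fun _ _ => Sum.inl_ne_inr
  have hI : Complex.I * Complex.I = -1 := Complex.I_mul_I
  rcases a with a | a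
  · simp only [cartan, Sum.elim_inl, Matrix.smul_mulVec, Matrix.sub_mulVec, Matrix.single_mulVec_eq]
    rcases p with (j | j) | (j | j) | h
    · by_cases e : a = j
      · subst e
        simp [vec, wt, hne1, (hne1 _ _).symm]
        linear_combination (norm := module) (-hI) • (Pi.single (bosFst a) 1 : Idx m n → ℂ)
      · simp [vec, wt, hne1, (hne1 _ _).symm, hfst, hsnd, e]
    · simp [vec, wt, hf, hs]
    · by_cases e : a = j
      · subst e
        simp [vec, wt, hne1, (hne1 _ _).symm]
        linear_combination (norm := module) hI • (Pi.single (bosFst a) 1 : Idx m n → ℂ)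
      · simp [vec, wt, hne1, (hne1 _ _).symm, hfst, hsnd, e]
    · simp [vec, wt, hf, hs]
    · have h1 : 2 * (a : ℕ) ≠ m - 1 := by have := Nat.odd_iff.1 h; omega
      have h2 : 2 * (a : ℕ) + 1 ≠ m - 1 := by have := Nat.odd_iff.1 h; omega
      simp [vec, wt, bosFst, bosSnd, h1, h2]
  · simp only [cartan, Sum.elim_inr, Matrix.sub_mulVec, Matrix.single_mulVec_eq]
    rcases p with (j | j) | (j | j) | h
    · simp [vec, wt, (hf _ _).symm, (hs _ _).symm]
    · by_cases e : a = j
      · subst e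
        simp [vec, wt]
      · simp [vec, wt, e]
    · simp [vec, wt, (hf _ _).symm, (hs _ _).symm]
    · by_cases e : a = j
      · subst e
        simp [vec, wt]
      · simp [vec, wt, e]
    · simp [vec, wt]

lemma span_range_vec : Submodule.span ℂ (Set.range (vec : WLabel m n → Idx m n → ℂ)) = ⊤ := by
  set S := Submodule.span ℂ (Set.range (vec : WLabel m n → Idx m n → ℂ))
  have hS : ∀ p : WLabel m n, p.vec ∈ S := fun p => Submodule.subset_span ⟨p, rfl⟩
  have h : ∀ i, Pi.single i (1 : ℂ) ∈ S := by
    have h0 : ∀ j : Fin (m / 2), Pi.single (bosFst j) (1 : ℂ) ∈ S ∧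
        Pi.single (bosSnd j) (1 : ℂ) ∈ S := by
      intro j
      have h1 := S.add_mem (hS (pos (.inl j))) (hS (neg (.inl j)))
      have h2 := S.sub_mem (hS (pos (.inl j))) (hS (neg (.inl j)))
      have e1 : (pos (.inl j) : WLabel m n).vec + (neg (.inl j) : WLabel m n).vec =
          (2 : ℂ) • Pi.single (bosFst j) 1 := by simp only [vec]; module
      have e2 : (pos (.inl j) : WLabel m n).vec - (neg (.inl j) : WLabel m n).vec =
          (2 * Complex.I) • Pi.single (bosSnd j) 1 := by simp only [vec]; module
      rw [e1] at h1
      rw [e2] at h2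
      exact ⟨(S.smul_mem_iff two_ne_zero).1 h1,
        (S.smul_mem_iff (mul_ne_zero two_ne_zero Complex.I_ne_zero)).1 h2⟩
    rintro (⟨i, hi⟩ | ⟨j, r⟩)
    · rcases Nat.even_or_odd' i with ⟨j, rfl | rfl⟩
      · by_cases hj : j < m / 2
        · exact (h0 ⟨j, hj⟩).1
        -- An even index without a partner can only be the last coordinate for odd m, the vector of
        -- weight zero.
        · have hodd : Odd m := by rw [Nat.odd_iff]; omega
          convert hS (zero hodd) using 1
          simp only [vec]
          congr 3
          rw [Nat.odd_iff] at hodd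
          omega
      · exact (h0 ⟨j, by omega⟩).2
    · fin_cases r
      · exact hS (pos (.inr j))
      · exact hS (neg (.inr j))
  rw [eq_top_iff]
  intro v _
  rw [pi_eq_sum_univ' v]
  refine S.sum_mem fun i _ => S.smul_mem _ ?_
  convert h i using 1

lemma rot_inl (i j : Fin m) : (rot (.inl i) (.inl j) : SMat m n) =
    Matrix.single (.inl i) (.inl j) 1 - Matrix.single (.inl j) (.inl i) 1 := by
  have h : ∀ (i : Fin m) (l : Idx m n), gram m n (.inl i) l = if .inl i = l then 1 else 0 := by
    rintro i (l | l) <;> simp [gram, Matrix.one_apply]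
  ext k l
  simp only [rot, par, sgn, h, Matrix.of_apply, Matrix.sub_apply, Matrix.single_apply, ite_and,
    @eq_comm _ k, Sum.elim_inl, zero_ne_one, if_false, one_mul]

lemma rot_inr (j : Fin n) : (rot (.inr (j, 0)) (.inr (j, 1)) : SMat m n) =
    (2 : ℂ) • (Matrix.single (.inr (j, 1)) (.inr (j, 1)) 1 -
      Matrix.single (.inr (j, 0)) (.inr (j, 0)) 1) := by
  have h0 : ∀ (l : Idx m n), gram m n (.inr (j, 0)) l = if .inr (j, 1) = l then 2 else 0 := by
    rintro (l | ⟨l, r⟩)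
    · simp [gram]
    · fin_cases r <;> simp [gram, Matrix.one_apply]
  have h1 : ∀ (l : Idx m n), gram m n (.inr (j, 1)) l = if .inr (j, 0) = l then -2 else 0 := by
    rintro (l | ⟨l, r⟩)
    · simp [gram]
    · fin_cases r
      · simp only [gram, Matrix.fromBlocks_apply₂₂, Matrix.kroneckerMap_apply, Matrix.one_apply]
        by_cases h : j = l <;> simp [h]
      · simp [gram, Matrix.one_apply]
  ext k l
  simp only [rot, par, sgn, h0, h1, Matrix.of_apply, Matrix.sub_apply, Matrix.smul_apply,
    Matrix.single_apply, ite_and, @eq_comm _ k, Sum.elim_inr, if_true, smul_eq_mul]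
  split_ifs <;> norm_num

lemma rotV_vec_pos_neg (a : WIdx m n) :
    ∃ t : ℂ, rotV (pos a : WLabel m n).vec (neg a : WLabel m n).vec = t • cartan m n a := by
  rcases a with j | j
  · refine ⟨2, ?_⟩
    simp only [vec, map_add, map_sub, map_smul, LinearMap.add_apply, LinearMap.smul_apply,
      rotV_single, cartan, Sum.elim_inl, bosFst, bosSnd, rot_inl]
    module
  · refine ⟨-2, ?_⟩
    simp only [vec, rotV_single, rot_inr, cartan, Sum.elim_inr]
    module

/-- Rotations are antisymmetric on even vectors. This is why 2ε_j is not a root, whereas 2δ_j is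
one. -/
lemma rotV_vec_self {p : WLabel m n} (hp : p.parity = 0) : rotV p.vec p.vec = 0 := by
  have h := rotV_swap (isHomogV_vec p) (isHomogV_vec p)
  rw [hp, sgn_zero_left, one_smul] at h
  have h2 : (2 : ℂ) • rotV p.vec p.vec = 0 := by
    rw [two_smul]
    nth_rewrite 1 [h]
    exact neg_add_cancel _
  exact (smul_eq_zero.1 h2).resolve_left two_ne_zero

/-! ### Heights -/

/-- The heights of the weights `ε_j` and `δ_j`. -/
def ht (m n : ℕ) : WIdx m n → ℕ :=
  Sum.elim (fun j => n + (m / 2 - j)) (fun j => n - j)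

lemma ht_pos (a : WIdx m n) : 0 < ht m n a := by
  rcases a with a | a <;> simp only [ht, Sum.elim_inl, Sum.elim_inr] <;> omega

lemma ht_injective : Function.Injective (ht m n) := by
  rintro (a | a) (b | b) h <;> simp only [ht, Sum.elim_inl, Sum.elim_inr] at h
  · exact congrArg Sum.inl (Fin.ext (by omega))
  · omega
  · omega
  · exact congrArg Sum.inr (Fin.ext (by omega))

/-- The element of the Cartan subalgebra that measures the height. -/
def htMat (m n : ℕ) : SMat m n := ∑ a, (ht m n a : ℂ) • cartan m n a

lemma htMat_mem : htMat m n ∈ osp m n :=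
  Submodule.sum_mem _ fun _ _ => Submodule.smul_mem _ _ (cartan_mem _)

lemma isHomog_htMat : IsHomog 0 (htMat m n) := by
  intro i j h
  rw [htMat, Matrix.sum_apply] at h
  obtain ⟨a, -, ha⟩ := Finset.exists_ne_zero_of_sum_ne_zero h
  rw [Matrix.smul_apply, smul_eq_mul] at ha
  exact isHomog_cartan a i j (right_ne_zero_of_mul ha)

/-- The height of a weight vector. -/
def WLabel.height : WLabel m n → ℤ
  | pos a => ht m n a
  | neg a => -ht m n a
  | zero _ => 0

lemma htMat_mulVec_vec (p : WLabel m n) : (htMat m n).mulVec p.vec = (p.height : ℂ) • p.vec := by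
  rw [htMat, Matrix.sum_mulVec]
  simp only [Matrix.smul_mulVec, cartan_mulVec_vec, smul_smul, ← Finset.sum_smul]
  congr 1
  rcases p with a | a | h
  · rw [Finset.sum_eq_single a] <;> simp +contextual [wt, height]
  · rw [Finset.sum_eq_single a] <;> simp +contextual [wt, height]
  · simp [wt, height]

/-- The heights decrease along ε_1, ε_2, …, δ_1, …, δ_n and stay positive, in agreement with the
chosen positive system; so one Cartan element detects positivity of a root. -/
lemma height_of_isPosRoot {α : WIdx m n → ℂ} (h : IsPosRoot α) :
    ∃ t : ℕ, 0 < t ∧ ∑ a, (ht m n a : ℂ) * α a = t := by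
  have e : ∀ a, ∑ b, (ht m n b : ℂ) * (Pi.single a 1 : WIdx m n → ℂ) b = ht m n a := by
    intro a
    rw [Finset.sum_eq_single a] <;> simp +contextual
  have h1 : ∀ a b, ht m n b < ht m n a → ∃ t : ℕ, 0 < t ∧ ∑ c, (ht m n c : ℂ) *
      (Pi.single a 1 - Pi.single b 1 : WIdx m n → ℂ) c = t := by
    intro a b hab
    refine ⟨ht m n a - ht m n b, by omega, ?_⟩
    simp only [Pi.sub_apply, mul_sub, Finset.sum_sub_distrib, e]
    rw [Nat.cast_sub hab.le]
  have h2 : ∀ a b, ∃ t : ℕ, 0 < t ∧ ∑ c, (ht m n c : ℂ) *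
      (Pi.single a 1 + Pi.single b 1 : WIdx m n → ℂ) c = t := by
    intro a b
    refine ⟨ht m n a + ht m n b, by have := ht_pos a; omega, ?_⟩
    simp only [Pi.add_apply, mul_add, Finset.sum_add_distrib, e]
    rw [Nat.cast_add]
  rcases h with ⟨i, j, h, rfl | rfl⟩ | ⟨i, j, h, rfl | rfl⟩ | ⟨i, rfl⟩ | ⟨i, j, rfl | rfl⟩ |
    ⟨-, ⟨i, rfl⟩ | ⟨j, rfl⟩⟩
  · exact h1 _ _ (by simp only [ht, Sum.elim_inl]; omega)
  · exact h2 _ _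
  · exact h1 _ _ (by simp only [ht, Sum.elim_inr]; omega)
  · exact h2 _ _
  · rw [two_smul]; exact h2 _ _
  · exact h1 _ _ (by simp only [ht, Sum.elim_inl, Sum.elim_inr]; omega)
  · exact h2 _ _
  · exact ⟨_, ht_pos _, e _⟩
  · exact ⟨_, ht_pos _, e _⟩

lemma isPosRoot_sub {a b : WIdx m n} (h : ht m n b < ht m n a) :
    IsPosRoot (Pi.single a 1 - Pi.single b 1 : WIdx m n → ℂ) := by
  rcases a with a | a <;> rcases b with b | b <;>
    simp only [ht, Sum.elim_inl, Sum.elim_inr] at h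
  · exact Or.inl ⟨a, b, by omega, Or.inl rfl⟩
  · exact Or.inr (Or.inr (Or.inr (Or.inl ⟨a, b, Or.inl rfl⟩)))
  · omega
  · exact Or.inr (Or.inl ⟨a, b, by omega, Or.inl rfl⟩)

lemma isPosRoot_add {a b : WIdx m n} (h : ht m n b < ht m n a) :
    IsPosRoot (Pi.single a 1 + Pi.single b 1 : WIdx m n → ℂ) := by
  rcases a with a | a <;> rcases b with b | b <;>
    simp only [ht, Sum.elim_inl, Sum.elim_inr] at h
  · exact Or.inl ⟨a, b, by omega, Or.inr rfl⟩
  · exact Or.inr (Or.inr (Or.inr (Or.inl ⟨a, b, Or.inr rfl⟩)))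
  · omega
  · exact Or.inr (Or.inl ⟨a, b, by omega, Or.inr rfl⟩)

lemma isPosRoot_single (hm : Odd m) (a : WIdx m n) :
    IsPosRoot (Pi.single a 1 : WIdx m n → ℂ) := by
  rcases a with a | a
  · exact Or.inr (Or.inr (Or.inr (Or.inr ⟨hm, Or.inl ⟨a, rfl⟩⟩)))
  · exact Or.inr (Or.inr (Or.inr (Or.inr ⟨hm, Or.inr ⟨a, rfl⟩⟩)))

/-- `𝔬𝔰𝔭(m|2n)` is spanned by the Cartan subalgebra, the positive root vectors, and the homogeneous
elements of negative height. -/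
lemma osp_le_of_generators {S : Submodule ℂ (SMat m n)} (hcar : ∀ a, cartan m n a ∈ S)
    (hpos : ∀ (X : osp m n) (p : ZMod 2) α, IsPosRoot α → IsRootVector α X →
      IsHomog p (X : SMat m n) → (X : SMat m n) ∈ S)
    (hneg : ∀ (X : osp m n) (p : ZMod 2) (t : ℕ), 0 < t → IsHomog p (X : SMat m n) →
      htMat m n * (X : SMat m n) - (X : SMat m n) * htMat m n = -(t : ℂ) • (X : SMat m n) →
      (X : SMat m n) ∈ S) : osp m n ≤ S := by
  -- The rotation of two weight vectors is a root vector for the sum of their weights, by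
  -- equivariance.
  have hP : ∀ p q : WLabel m n, IsPosRoot (p.wt + q.wt) → rotV p.vec q.vec ∈ S := by
    intro p q h
    refine hpos ⟨_, rotV_mem p.vec q.vec⟩ _ _ h ?_
      (isHomog_rotV (isHomogV_vec p) (isHomogV_vec q))
    intro a
    simp only [commutator_rotV (cartan_mem a) (isHomog_cartan a), cartan_mulVec_vec, map_smul,
      LinearMap.smul_apply, Pi.add_apply, add_smul]
  have hN : ∀ p q : WLabel m n, p.height + q.height < 0 → rotV p.vec q.vec ∈ S := by
    intro p q h
    refine hneg ⟨_, rotV_mem p.vec q.vec⟩ _ (-(p.height + q.height)).toNat (by omega)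
      (isHomog_rotV (isHomogV_vec p) (isHomogV_vec q)) ?_
    have e : (((-(p.height + q.height)).toNat : ℕ) : ℂ) = -(p.height + q.height) := by
      have : (((-(p.height + q.height)).toNat : ℕ) : ℤ) = -(p.height + q.height) := by omega
      exact_mod_cast congrArg (Int.cast (R := ℂ)) this
    simp only [commutator_rotV htMat_mem isHomog_htMat, htMat_mulVec_vec, map_smul,
      LinearMap.smul_apply, e, neg_neg, add_smul]
  have hsymm : ∀ p q : WLabel m n, rotV p.vec q.vec ∈ S → rotV q.vec p.vec ∈ S := by
    intro p q h
    rw [rotV_swap (isHomogV_vec q) (isHomogV_vec p)]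
    exact S.neg_mem (S.smul_mem _ h)
  have hpp : ∀ a b, ht m n b < ht m n a →
      rotV (pos a : WLabel m n).vec (pos b : WLabel m n).vec ∈ S := fun a b h =>
    hP _ _ (isPosRoot_add h)
  have hpn : ∀ a b, rotV (pos a : WLabel m n).vec (neg b : WLabel m n).vec ∈ S := by
    intro a b
    rcases lt_trichotomy (ht m n b) (ht m n a) with h | h | h
    · refine hP _ _ ?_
      rw [wt, wt, ← sub_eq_add_neg]
      exact isPosRoot_sub h
    · obtain rfl := ht_injective h
      obtain ⟨t, ht⟩ := rotV_vec_pos_neg (m := m) (n := n) b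
      rw [ht]
      exact S.smul_mem _ (hcar b)
    · refine hN _ _ ?_
      simp only [WLabel.height]
      omega
  have hpz : ∀ a h, rotV (pos a : WLabel m n).vec (zero h : WLabel m n).vec ∈ S := by
    intro a h
    refine hP _ _ ?_
    rw [wt, wt, add_zero]
    exact isPosRoot_single h a
  have hnz : ∀ a h, rotV (neg a : WLabel m n).vec (zero h : WLabel m n).vec ∈ S := by
    intro a h
    refine hN _ _ ?_
    have := ht_pos a
    simp only [WLabel.height]
    omega
  -- Equal positive labels need separate care: they give zero for ε_j and the root 2δ_j for δ_j. All
  -- other pairs have a positive root as weight, a negative height, or opposite labels, which give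
  -- Cartan elements.
  have hall : ∀ p q : WLabel m n, rotV p.vec q.vec ∈ S := by
    rintro (a | a | h) (b | b | h')
    · rcases lt_trichotomy (ht m n b) (ht m n a) with h | h | h
      · exact hpp a b h
      · obtain rfl := ht_injective h
        rcases b with b | b
        · rw [rotV_vec_self rfl]; exact S.zero_mem
        · refine hP _ _ (Or.inr (Or.inr (Or.inl ⟨b, ?_⟩)))
          rw [two_smul]; rfl
      · exact hsymm _ _ (hpp b a h)
    · exact hpn a b
    · exact hpz a h'
    · exact hsymm _ _ (hpn b a)
    · refine hN _ _ ?_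
      have := ht_pos a
      simp only [WLabel.height]
      omega
    · exact hnz a h'
    · exact hsymm _ _ (hpz b h)
    · exact hsymm _ _ (hnz b h)
    · rw [rotV_vec_self rfl]; exact S.zero_mem
  have h1 : ∀ (q : WLabel m n) (v : Idx m n → ℂ), rotV v q.vec ∈ S := by
    intro q v
    have : (⊤ : Submodule ℂ (Idx m n → ℂ)) ≤ S.comap (rotV.flip q.vec) := by
      rw [← span_range_vec, Submodule.span_le]
      rintro _ ⟨p, rfl⟩
      exact hall p q
    exact this trivial
  have h2 : ∀ u v : Idx m n → ℂ, rotV u v ∈ S := by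
    intro u v
    have : (⊤ : Submodule ℂ (Idx m n → ℂ)) ≤ S.comap (rotV u) := by
      rw [← span_range_vec, Submodule.span_le]
      rintro _ ⟨p, rfl⟩
      exact h1 p u
    exact this trivial
  intro X hX
  rw [sum_rot hX]
  refine S.smul_mem _ (S.sum_mem fun i _ => S.sum_mem fun j _ => S.smul_mem _ ?_)
  rw [← rotV_single]
  exact h2 _ _

/-! ### The highest weight vector -/

lemma gram_pairing {X : SMat m n} (hX : X ∈ osp m n) (h0 : IsHomog 0 X) (u v : Idx m n → ℂ) :
    u ⬝ᵥ (gram m n).mulVec (X.mulVec v) = -(X.mulVec u ⬝ᵥ (gram m n).mulVec v) := by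
  have h : gram m n * X = -(X.transpose * gram m n) := by
    ext i j
    rw [Matrix.neg_apply, Matrix.mul_apply (M := X.transpose)]
    simp only [Matrix.transpose_apply]
    rw [even_transpose_mul_gram hX h0, neg_neg]
  rw [Matrix.mulVec_mulVec, h, Matrix.neg_mulVec, dotProduct_neg, ← Matrix.mulVec_mulVec,
    Matrix.dotProduct_mulVec, Matrix.vecMul_transpose]

/-- The form is invariant, so a vector of height t pairs nontrivially only with height -t. No
coordinate vector has that height, and the form is nondegenerate. -/
lemma eq_zero_of_htMat_mulVec {v : Idx m n → ℂ} {t : ℕ} (ht : ∀ p : WLabel m n, -p.height < t)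
    (hv : (htMat m n).mulVec v = (t : ℂ) • v) : v = 0 := by
  have h1 : ∀ p : WLabel m n, p.vec ⬝ᵥ (gram m n).mulVec v = 0 := by
    intro p
    have h := gram_pairing htMat_mem isHomog_htMat p.vec v
    rw [hv, htMat_mulVec_vec, Matrix.mulVec_smul, dotProduct_smul, smul_dotProduct, smul_eq_mul,
      smul_eq_mul] at h
    have h2 : ((t : ℂ) + p.height) * (p.vec ⬝ᵥ (gram m n).mulVec v) = 0 := by
      linear_combination h
    refine (mul_eq_zero.1 h2).resolve_left ?_
    have : (t : ℤ) + p.height ≠ 0 := by have := ht p; omega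
    exact_mod_cast this
  have h2 : ∀ u : Idx m n → ℂ, u ⬝ᵥ (gram m n).mulVec v = 0 := by
    intro u
    have hu : u ∈ Submodule.span ℂ (Set.range (vec : WLabel m n → Idx m n → ℂ)) := by
      rw [span_range_vec]; trivial
    induction hu using Submodule.span_induction with
    | mem x hx => obtain ⟨p, rfl⟩ := hx; exact h1 p
    | zero => exact zero_dotProduct _
    | add x y _ _ hx hy => rw [add_dotProduct, hx, hy, add_zero]
    | smul a x _ hx => rw [smul_dotProduct, hx, smul_zero]
  have h3 : (gram m n).mulVec v = 0 := dotProduct_eq_zero _ fun u => by rw [dotProduct_comm, h2]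
  rw [← Matrix.one_mulVec v, ← metric_mul_gram, ← Matrix.mulVec_mulVec, h3, Matrix.mulVec_zero]

end

section

variable {m n : ℕ}


open WLabel

/-! ### The highest weight vector of the harmonics -/

/-- The label of the first weight vector. -/
def topLabel : WLabel (m + 2) n := pos (.inl ⟨0, by omega⟩)

lemma topLabel_vec_apply (i : Idx (m + 2) n) : (topLabel : WLabel (m + 2) n).vec i =
    (if i = i0 then 1 else 0) + Complex.I * if i = i1 then 1 else 0 := by
  have e0 : (bosFst ⟨0, by omega⟩ : Idx (m + 2) n) = i0 := rfl
  have e1 : (bosSnd ⟨0, by omega⟩ : Idx (m + 2) n) = i1 := rfl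
  simp only [topLabel, vec, e0, e1, Pi.add_apply, Pi.smul_apply, Pi.single_apply, smul_eq_mul]

/-- The action is first order and every derivative of z^k is a multiple of z^{k-1}, so X sends z^k
to k z^{k-1} times its value on z. -/
lemma glAct_nulPow {X : SMat (m + 2) n} {t : ℂ}
    (hX : X.mulVec (topLabel : WLabel (m + 2) n).vec = t • topLabel.vec) (k : ℕ) :
    glAct (m + 2) n X (nulPow m n Complex.I k) = (k * t) • nulPow m n Complex.I k := by
  have h1 : ∀ i, ∑ j, X i j * ((k : ℂ) * (topLabel : WLabel (m + 2) n).vec j) =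
      k * t * topLabel.vec i := fun i => by
    have := congrFun hX i
    simp only [Matrix.mulVec, dotProduct, Pi.smul_apply, smul_eq_mul] at this
    rw [mul_assoc, ← this, Finset.mul_sum]
    exact Finset.sum_congr rfl fun j _ => by ring
  have h2 : glAct (m + 2) n X (nulPow m n Complex.I k) =
      ∑ i, (k * t * (topLabel : WLabel (m + 2) n).vec i) • mulX i (nulPow m n Complex.I (k - 1)) := by
    rw [glAct_apply, LinearMap.sum_apply]
    refine Finset.sum_congr rfl fun i _ => ?_
    rw [← h1, Finset.sum_smul, LinearMap.sum_apply]
    refine Finset.sum_congr rfl fun j _ => ?_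
    rw [LinearMap.smul_apply, Module.End.mul_apply, der_nulPow, ← topLabel_vec_apply, map_smul,
      smul_smul]
  rw [h2]
  rcases k with _ | k
  · simp
  · rw [nulPow_succ, nulX_apply, sum_idx]
    simp only [topLabel_vec_apply, i0_ne_i1, i1_ne_i0, up_ne_i0, up_ne_i1, if_true, if_false,
      Nat.add_sub_cancel]
    simp only [mul_zero, mul_one, add_zero, zero_add, zero_smul, Finset.sum_const_zero]
    module

/-- A positive root vector raises the height, and z already has the largest height among the
coordinates. -/
lemma mulVec_topLabel_of_isPosRoot {α : WIdx (m + 2) n → ℂ} (hα : IsPosRoot α)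
    {X : osp (m + 2) n} (hX : IsRootVector α X) :
    (X : SMat (m + 2) n).mulVec (topLabel : WLabel (m + 2) n).vec = 0 := by
  obtain ⟨t, ht0, ht1⟩ := height_of_isPosRoot hα
  have h1 : htMat (m + 2) n * (X : SMat (m + 2) n) - X * htMat (m + 2) n =
      (t : ℂ) • (X : SMat (m + 2) n) := by
    rw [← ht1, Finset.sum_smul, htMat, Finset.sum_mul, Finset.mul_sum, ← Finset.sum_sub_distrib]
    refine Finset.sum_congr rfl fun a _ => ?_
    rw [Matrix.smul_mul, Matrix.mul_smul, ← smul_sub, hX a, smul_smul]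
  have htop : ((topLabel : WLabel (m + 2) n).height : ℤ) = (n + (m + 2) / 2 : ℕ) := rfl
  refine eq_zero_of_htMat_mulVec (t := t + (n + (m + 2) / 2)) ?_ ?_
  · rintro (a | a | h)
    · simp only [WLabel.height]; omega
    · rcases a with a | a <;> simp only [WLabel.height, ht, Sum.elim_inl, Sum.elim_inr] <;> omega
    · simp only [WLabel.height]; omega
  · have h2 := congrArg (fun Y => Y.mulVec (topLabel : WLabel (m + 2) n).vec) h1
    simp only [Matrix.sub_mulVec, ← Matrix.mulVec_mulVec, htMat_mulVec_vec, Matrix.smul_mulVec,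
      Matrix.mulVec_smul, htop] at h2
    rw [sub_eq_iff_eq_add.1 h2, Int.cast_natCast, Nat.cast_add t, add_smul]

theorem quotRep_isSimpleHighestWeight {k : ℕ} (hk : 0 < m ∨ k ≤ n) :
    (quotRep (m + 2) n k).IsSimpleHighestWeight (firstWeight (m + 2) n k) := by
  have hI := Complex.I_mul_I
  let z : harm (m + 2) n k := ⟨_, nulPow_mem_harm hI k⟩
  have hact : ∀ (X : osp (m + 2) n) (t : ℂ),
      (X : SMat (m + 2) n).mulVec (topLabel : WLabel (m + 2) n).vec = t • topLabel.vec →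
      (quotRep (m + 2) n k).act X ((harmCap (m + 2) n k).mkQ z) =
        (k * t) • (harmCap (m + 2) n k).mkQ z := by
    intro X t hX
    have : (harmRep (m + 2) n k).act X z = (k * t) • z := Subtype.ext (glAct_nulPow hX k)
    rw [← map_smul, ← this]
    rfl
  refine ⟨quotRep_isSimple hk, (harmCap (m + 2) n k).mkQ z, fun h => ?_, fun a => ?_, ?_⟩
  · rw [Submodule.mkQ_apply, Submodule.Quotient.mk_eq_zero] at h
    exact nulPow_notMem hI hk ⟨z.2, h⟩
  · rw [hact _ _ (cartan_mulVec_vec a topLabel)]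
    congr 1
    rcases a with ⟨a, ha⟩ | a
    · rcases a with _ | a <;> simp [topLabel, wt, firstWeight]
    · simp [topLabel, wt, firstWeight]
  · intro α hα X hX
    rw [hact X 0 (by rw [zero_smul, mulVec_topLabel_of_isPosRoot hα hX]), mul_zero, zero_smul]

/-! ### Uniqueness of simple highest weight representations -/

namespace OspRep

variable {V W : Type*} [AddCommGroup V] [Module ℂ V] [AddCommGroup W] [Module ℂ W]

/-- The parity shift of a representation. -/
def shift (ρ : OspRep m n V) : OspRep m n V where
  parity := -ρ.parity
  parity_sq := by rw [neg_mul_neg, ρ.parity_sq]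
  act := ρ.act
  parity_act := fun p X hX => by rw [neg_mul, mul_neg, smul_neg, ρ.parity_act p X hX]
  act_bracket := ρ.act_bracket

/-- The direct sum of two representations. -/
def prod (ρ : OspRep m n V) (σ : OspRep m n W) : OspRep m n (V × W) where
  parity := ρ.parity.prodMap σ.parity
  parity_sq := by
    rw [LinearMap.prodMap_mul, ρ.parity_sq, σ.parity_sq, LinearMap.prodMap_one]
  act :=
    { toFun := fun X => (ρ.act X).prodMap (σ.act X)
      map_add' := fun X Y => by rw [map_add, map_add, LinearMap.prodMap_add]
      map_smul' := fun c X => by rw [map_smul, map_smul, LinearMap.prodMap_smul]; rfl }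
  parity_act := fun p X hX => LinearMap.ext fun x => Prod.ext
    (LinearMap.congr_fun (ρ.parity_act p X hX) x.1) (LinearMap.congr_fun (σ.parity_act p X hX) x.2)
  act_bracket := fun p q X Y hX hY => LinearMap.ext fun x => Prod.ext
    (LinearMap.congr_fun (ρ.act_bracket p q X Y hX hY) x.1)
    (LinearMap.congr_fun (σ.act_bracket p q X Y hX hY) x.2)

lemma IsSimple.shift {ρ : OspRep m n V} (h : ρ.IsSimple) : ρ.shift.IsSimple :=
  ⟨h.1, fun U hU => h.2 U ⟨fun v hv => neg_mem_iff.1 (hU.1 v hv), hU.2⟩⟩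

/-- `v` is a vector of weight `Λ` and sign `s` under the parity operator, annihilated by all
homogeneous positive root vectors. -/
structure IsSingular (ρ : OspRep m n V) (Λ : WIdx m n → ℂ) (s : ℂ) (v : V) : Prop where
  parity_eq : ρ.parity v = s • v
  act_cartan : ∀ a, ρ.act ⟨cartan m n a, cartan_mem a⟩ v = Λ a • v
  act_pos : ∀ (X : osp m n) (p : ZMod 2) α, IsPosRoot α → IsRootVector α X →
    IsHomog p (X : SMat m n) → ρ.act X v = 0

lemma parity_act_apply (ρ : OspRep m n V) {p : ZMod 2} {X : osp m n}
    (hX : IsHomog p (X : SMat m n)) (v : V) :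
    ρ.parity (ρ.act X v) = sgn 1 p • ρ.act X (ρ.parity v) :=
  LinearMap.congr_fun (ρ.parity_act p X hX) v

lemma act_act_apply (ρ : OspRep m n V) {p q : ZMod 2} {X Y : osp m n}
    (hX : IsHomog p (X : SMat m n)) (hY : IsHomog q (Y : SMat m n)) (v : V) :
    ρ.act X (ρ.act Y v) = ρ.act ⟨sbracket p q (X : SMat m n) Y, sbracket_mem X.2 Y.2 hX hY⟩ v +
      sgn p q • ρ.act Y (ρ.act X v) := by
  rw [ρ.act_bracket p q X Y hX hY]
  simp

/-- A highest weight vector v need not be homogeneous. With P the parity operator, P v satisfies the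
same equations for homogeneous root vectors, so v + P v serves with sign 1, and if it is zero, v
itself has sign -1. -/
lemma exists_isSingular {ρ : OspRep m n V} {Λ : WIdx m n → ℂ} {v : V}
    (hv : ρ.IsHighestWeightVector Λ v) :
    ∃ u ≠ 0, ρ.IsSingular Λ 1 u ∨ ρ.IsSingular Λ (-1) u := by
  obtain ⟨h0, h1, h2⟩ := hv
  have hsq : ρ.parity (ρ.parity v) = v := LinearMap.congr_fun ρ.parity_sq v
  have h3 : ∀ a, ρ.act ⟨cartan m n a, cartan_mem a⟩ (ρ.parity v) = Λ a • ρ.parity v := fun a => by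
    have := ρ.parity_act_apply (X := ⟨cartan m n a, cartan_mem a⟩) (isHomog_cartan a) v
    rw [sgn_zero_right, one_smul, h1, map_smul] at this
    exact this.symm
  have h4 : ∀ (X : osp m n) (p : ZMod 2) α, IsPosRoot α → IsRootVector α X →
      IsHomog p (X : SMat m n) → ρ.act X (ρ.parity v) = 0 := fun X p α hα hX hp => by
    have := ρ.parity_act_apply hp v
    rw [h2 α hα X hX, map_zero] at this
    have h5 : sgn 1 p ≠ 0 := by unfold sgn; split_ifs <;> norm_num
    exact (smul_eq_zero.1 this.symm).resolve_left h5
  by_cases h : v + ρ.parity v = 0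
  · refine ⟨v, h0, Or.inr ⟨?_, h1, fun X p α hα hX _ => h2 α hα X hX⟩⟩
    rw [neg_one_smul]
    exact eq_neg_of_add_eq_zero_right h
  · refine ⟨_, h, Or.inl ⟨?_, fun a => ?_, fun X p α hα hX hp => ?_⟩⟩
    · rw [map_add, hsq, one_smul, add_comm]
    · rw [map_add, h1, h3, smul_add]
    · rw [map_add, h2 α hα X hX, h4 X p α hα hX hp, add_zero]

/-- The vectors obtained from `u` by elements of negative height. -/
inductive Reach (ρ : OspRep m n V) (u : V) : V → Prop
  | base : Reach ρ u u
  | step (X : osp m n) (p : ZMod 2) (t : ℕ) (ht : 0 < t) (hp : IsHomog p (X : SMat m n))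
    (hX : htMat m n * (X : SMat m n) - (X : SMat m n) * htMat m n = -(t : ℂ) • (X : SMat m n))
    (x : V) (hx : Reach ρ u x) : Reach ρ u (ρ.act X x)

variable {ρ : OspRep m n V} {Λ : WIdx m n → ℂ} {s : ℂ} {u : V}

lemma act_mem_of_negative {X : osp m n} {p : ZMod 2} {t : ℕ} (ht : 0 < t)
    (hp : IsHomog p (X : SMat m n))
    (hX : htMat m n * (X : SMat m n) - (X : SMat m n) * htMat m n = -(t : ℂ) • (X : SMat m n))
    {x : V} (hx : x ∈ Submodule.span ℂ {x | ρ.Reach u x}) :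
    ρ.act X x ∈ Submodule.span ℂ {x | ρ.Reach u x} := by
  have : Submodule.span ℂ {x | ρ.Reach u x} ≤
      (Submodule.span ℂ {x | ρ.Reach u x}).comap (ρ.act X) :=
    Submodule.span_le.2 fun y hy => Submodule.subset_span (Reach.step X p t ht hp hX y hy)
  exact this hx

/-- Induction on the number of negative factors, for all X at once: Z Y x = [Z, Y] x ± Y Z x, and
the hypothesis for x covers both [Z, Y] and Z. Singularity of u is needed only when no factor is
present. -/
lemma act_mem_of_reach (hu : ρ.IsSingular Λ s u) {x : V} (hx : ρ.Reach u x) (X : osp m n) :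
    ρ.act X x ∈ Submodule.span ℂ {x | ρ.Reach u x} := by
  set N := Submodule.span ℂ {x | ρ.Reach u x} with hN
  induction hx generalizing X with
  | base =>
    have huN : u ∈ N := Submodule.subset_span Reach.base
    obtain ⟨Y, hY, hYX⟩ := osp_le_of_generators
      (S := (N.comap (ρ.act.flip u)).map (osp m n).subtype)
      (fun a => ⟨⟨_, cartan_mem a⟩, show ρ.act _ u ∈ N by
        rw [hu.act_cartan]; exact N.smul_mem _ huN, rfl⟩)
      (fun Y p α hα hY hp => ⟨Y, show ρ.act _ u ∈ N by
        rw [hu.act_pos Y p α hα hY hp]; exact N.zero_mem, rfl⟩)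
      (fun Y p t ht hp hY => ⟨Y, act_mem_of_negative ht hp hY huN, rfl⟩) X.2
    rw [← Subtype.ext hYX]
    exact hY
  | step Y q t ht hq hY x hx ih =>
    have key : ∀ (Z : osp m n) (p : ZMod 2), IsHomog p (Z : SMat m n) →
        ρ.act Z (ρ.act Y x) ∈ N := fun Z p hZ => by
      rw [ρ.act_act_apply hZ hq]
      exact N.add_mem (ih _) (N.smul_mem _ (act_mem_of_negative ht hq hY (ih Z)))
    -- The generators serve here only to reduce X to a sum of homogeneous elements.
    obtain ⟨Z, hZ, hZX⟩ := osp_le_of_generators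
      (S := (N.comap (ρ.act.flip (ρ.act Y x))).map (osp m n).subtype)
      (fun a => ⟨⟨_, cartan_mem a⟩, key _ 0 (isHomog_cartan a), rfl⟩)
      (fun Z p α _ _ hp => ⟨Z, key _ p hp, rfl⟩)
      (fun Z p t _ hp _ => ⟨Z, key _ p hp, rfl⟩) X.2
    rw [← Subtype.ext hZX]
    exact hZ

lemma isSubrep_span_reach (hu : ρ.IsSingular Λ s u) :
    ρ.IsSubrep (Submodule.span ℂ {x | ρ.Reach u x}) := by
  set N := Submodule.span ℂ {x | ρ.Reach u x} with hN
  constructor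
  · have h : ∀ x, ρ.Reach u x → ∃ r : ℂ, ρ.parity x = r • x := by
      intro x hx
      induction hx with
      | base => exact ⟨s, hu.parity_eq⟩
      | step X p t ht hp hX x hx ih =>
        obtain ⟨r, hr⟩ := ih
        refine ⟨sgn 1 p * r, ?_⟩
        rw [ρ.parity_act_apply hp, hr, map_smul, smul_smul]
    have : N ≤ N.comap ρ.parity := Submodule.span_le.2 fun x hx => by
      obtain ⟨r, hr⟩ := h x hx
      change ρ.parity x ∈ N
      rw [hr]
      exact N.smul_mem _ (Submodule.subset_span hx)
    exact this
  · intro X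
    have : N ≤ N.comap (ρ.act X) := Submodule.span_le.2 fun x hx => act_mem_of_reach hu hx X
    exact this

lemma act_htMat (hu : ∀ a, ρ.act ⟨cartan m n a, cartan_mem a⟩ u = Λ a • u) :
    ρ.act ⟨htMat m n, htMat_mem⟩ u = (∑ a, (ht m n a : ℂ) * Λ a) • u := by
  have : (⟨htMat m n, htMat_mem⟩ : osp m n) =
      ∑ a, (ht m n a : ℂ) • (⟨cartan m n a, cartan_mem a⟩ : osp m n) := by
    apply Subtype.ext
    simp [htMat]
  rw [this, map_sum, LinearMap.sum_apply, Finset.sum_smul]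
  refine Finset.sum_congr rfl fun a _ => ?_
  rw [map_smul, LinearMap.smul_apply, hu, smul_smul]

/-- Each factor of negative height strictly lowers the eigenvalue of `htMat`. Every vector reached
from u is thus u itself or lies in another eigenspace, and eigenspaces are independent. -/
lemma mem_span_of_mem_span_reach (hu : ρ.IsSingular Λ s u) {x : V}
    (hx : x ∈ Submodule.span ℂ {x | ρ.Reach u x})
    (hxh : ρ.act ⟨htMat m n, htMat_mem⟩ x = (∑ a, (ht m n a : ℂ) * Λ a) • x) :
    ∃ r : ℂ, x = r • u := by
  set H := ρ.act ⟨htMat m n, htMat_mem⟩ with hH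
  set h0 := ∑ a, (ht m n a : ℂ) * Λ a with hh0
  set E := ⨆ μ ≠ h0, H.eigenspace μ with hE
  have h1 : ∀ x, ρ.Reach u x → (x = u ∨ x ∈ E) ∧ ∃ t : ℕ, H x = (h0 - t) • x := by
    intro x hx
    induction hx with
    | base => exact ⟨Or.inl rfl, 0, by rw [Nat.cast_zero, sub_zero]; exact act_htMat hu.act_cartan⟩
    | step X p t ht hp hX x hx ih =>
      obtain ⟨-, r, hr⟩ := ih
      have e : H (ρ.act X x) = (h0 - (r + t : ℕ)) • ρ.act X x := by
        have h2 := ρ.act_act_apply (X := ⟨htMat m n, htMat_mem⟩) isHomog_htMat hp x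
        have h3 : (⟨sbracket 0 p (htMat m n) X, sbracket_mem htMat_mem X.2 isHomog_htMat hp⟩ :
            osp m n) = -(t : ℂ) • X := by
          apply Subtype.ext
          simp only [sbracket, sgn_zero_left, one_smul]
          exact hX
        rw [← hH, h3, sgn_zero_left, one_smul, hr, map_smul, map_smul, LinearMap.smul_apply] at h2
        rw [h2]
        push_cast
        module
      refine ⟨Or.inr ?_, r + t, e⟩
      refine Submodule.mem_iSup_of_mem (h0 - (r + t : ℕ)) (Submodule.mem_iSup_of_mem ?_
        (Module.End.mem_eigenspace_iff.2 e))
      rw [Ne, sub_eq_self, Nat.cast_eq_zero]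
      omega
  have h2 : Submodule.span ℂ {x | ρ.Reach u x} ≤ Submodule.span ℂ {u} ⊔ E :=
    Submodule.span_le.2 fun y hy => by
      rcases (h1 y hy).1 with rfl | h
      · exact Submodule.mem_sup_left (Submodule.mem_span_singleton_self _)
      · exact Submodule.mem_sup_right h
  obtain ⟨y, hy, z, hz, rfl⟩ := Submodule.mem_sup.1 (h2 hx)
  obtain ⟨r, rfl⟩ := Submodule.mem_span_singleton.1 hy
  refine ⟨r, ?_⟩
  have h3 : z ∈ H.eigenspace h0 := by
    rw [Module.End.mem_eigenspace_iff]
    rw [map_add, map_smul, hH, act_htMat hu.act_cartan, ← hH, ← hh0, smul_add, smul_comm r] at hxh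
    exact add_left_cancel hxh
  have h4 := Submodule.disjoint_def.1 (H.eigenspaces_iSupIndep h0) z h3 hz
  rw [h4, add_zero]

lemma IsSingular.prod {σ : OspRep m n W} {w : W} (hu : ρ.IsSingular Λ s u)
    (hw : σ.IsSingular Λ s w) : (ρ.prod σ).IsSingular Λ s (u, w) :=
  ⟨Prod.ext hu.parity_eq hw.parity_eq, fun a => Prod.ext (hu.act_cartan a) (hw.act_cartan a),
    fun X p α hα hX hp => Prod.ext (hu.act_pos X p α hα hX hp) (hw.act_pos X p α hα hX hp)⟩

lemma IsSingular.shift (hu : ρ.IsSingular Λ s u) : ρ.shift.IsSingular Λ (-s) u :=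
  ⟨by rw [neg_smul, ← hu.parity_eq]; rfl, hu.act_cartan, hu.act_pos⟩

/-- Let N be the subrepresentation of the direct sum generated by (u, w). Simplicity makes both
projections of N surjective and leaves N either trivial or full intersection with each summand;
excluding the full ones shows that N is the graph of an isomorphism. -/
lemma exists_equiv_of_isSingular {σ : OspRep m n W} {w : W} (hρ : ρ.IsSimple) (hσ : σ.IsSimple)
    (hu0 : u ≠ 0) (hw0 : w ≠ 0) (hu : ρ.IsSingular Λ s u) (hw : σ.IsSingular Λ s w) :
    ∃ e : V ≃ₗ[ℂ] W, (∀ X v, e (ρ.act X v) = σ.act X (e v)) ∧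
      ∀ v, e (ρ.parity v) = σ.parity (e v) := by
  set N := Submodule.span ℂ {x | (ρ.prod σ).Reach (u, w) x} with hN
  have hsub : (ρ.prod σ).IsSubrep N := isSubrep_span_reach (hu.prod hw)
  have huN : (u, w) ∈ N := Submodule.subset_span Reach.base
  have hfst : N.map (LinearMap.fst ℂ V W) = ⊤ := by
    refine (hρ.2 _ ⟨?_, ?_⟩).resolve_left fun h => ?_
    · rintro _ ⟨x, hx, rfl⟩
      exact ⟨_, hsub.1 x hx, rfl⟩
    · rintro X _ ⟨x, hx, rfl⟩
      exact ⟨_, hsub.2 X x hx, rfl⟩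
    · exact hu0 ((Submodule.eq_bot_iff _).1 h u ⟨_, huN, rfl⟩)
  have hsnd : N.map (LinearMap.snd ℂ V W) = ⊤ := by
    refine (hσ.2 _ ⟨?_, ?_⟩).resolve_left fun h => ?_
    · rintro _ ⟨x, hx, rfl⟩
      exact ⟨_, hsub.1 x hx, rfl⟩
    · rintro X _ ⟨x, hx, rfl⟩
      exact ⟨_, hsub.2 X x hx, rfl⟩
    · exact hw0 ((Submodule.eq_bot_iff _).1 h w ⟨_, huN, rfl⟩)
  -- Were the whole second summand in N, then (0, w) would be too. It has the same height as (u, w),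
  -- so it would be a multiple of (u, w), contradicting u ≠ 0 and w ≠ 0.
  have hinr : N.comap (LinearMap.inr ℂ V W) = ⊥ := by
    refine (hσ.2 _ ⟨fun y hy => ?_, fun X y hy => ?_⟩).resolve_right fun h => ?_
    · have := hsub.1 _ hy
      rwa [show (ρ.prod σ).parity (LinearMap.inr ℂ V W y) = LinearMap.inr ℂ V W (σ.parity y) from
        Prod.ext (map_zero ρ.parity) rfl] at this
    · have := hsub.2 X _ hy
      rwa [show (ρ.prod σ).act X (LinearMap.inr ℂ V W y) = LinearMap.inr ℂ V W (σ.act X y) from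
        Prod.ext (map_zero (ρ.act X)) rfl] at this
    · have h1 : ((0 : V), w) ∈ N := by
        have : w ∈ N.comap (LinearMap.inr ℂ V W) := by rw [h]; trivial
        exact this
      obtain ⟨r, hr⟩ := mem_span_of_mem_span_reach (hu.prod hw) h1
        (Prod.ext ((map_zero (ρ.act _)).trans (smul_zero _).symm) (act_htMat hw.act_cartan))
      have h2 := (smul_eq_zero.1 (congrArg Prod.fst hr).symm).resolve_right hu0
      rw [h2, zero_smul] at hr
      exact hw0 (congrArg Prod.snd hr)
  have hinl : N.comap (LinearMap.inl ℂ V W) = ⊥ := by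
    refine (hρ.2 _ ⟨fun y hy => ?_, fun X y hy => ?_⟩).resolve_right fun h => ?_
    · have := hsub.1 _ hy
      rwa [show (ρ.prod σ).parity (LinearMap.inl ℂ V W y) = LinearMap.inl ℂ V W (ρ.parity y) from
        Prod.ext rfl (map_zero σ.parity)] at this
    · have := hsub.2 X _ hy
      rwa [show (ρ.prod σ).act X (LinearMap.inl ℂ V W y) = LinearMap.inl ℂ V W (ρ.act X y) from
        Prod.ext rfl (map_zero (σ.act X))] at this
    · have h1 : (u, (0 : W)) ∈ N := by
        have : u ∈ N.comap (LinearMap.inl ℂ V W) := by rw [h]; trivial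
        exact this
      obtain ⟨r, hr⟩ := mem_span_of_mem_span_reach (hu.prod hw) h1
        (Prod.ext (act_htMat hu.act_cartan) ((map_zero (σ.act _)).trans (smul_zero _).symm))
      have h2 := (smul_eq_zero.1 (congrArg Prod.snd hr).symm).resolve_right hw0
      rw [h2, zero_smul] at hr
      exact hu0 (congrArg Prod.fst hr)
  have b1 : Function.Bijective ((LinearMap.fst ℂ V W).comp N.subtype) := by
    constructor
    · rw [← LinearMap.ker_eq_bot, LinearMap.ker_eq_bot']
      rintro ⟨⟨x, y⟩, hxy⟩ h
      obtain rfl : x = 0 := h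
      have h1 : y ∈ N.comap (LinearMap.inr ℂ V W) := hxy
      rw [hinr, Submodule.mem_bot] at h1
      exact Subtype.ext (Prod.ext rfl h1)
    · intro v
      have : v ∈ N.map (LinearMap.fst ℂ V W) := by rw [hfst]; trivial
      obtain ⟨x, hx, rfl⟩ := this
      exact ⟨⟨x, hx⟩, rfl⟩
  have b2 : Function.Bijective ((LinearMap.snd ℂ V W).comp N.subtype) := by
    constructor
    · rw [← LinearMap.ker_eq_bot, LinearMap.ker_eq_bot']
      rintro ⟨⟨x, y⟩, hxy⟩ h
      obtain rfl : y = 0 := h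
      have h1 : x ∈ N.comap (LinearMap.inl ℂ V W) := hxy
      rw [hinl, Submodule.mem_bot] at h1
      exact Subtype.ext (Prod.ext h1 rfl)
    · intro v
      have : v ∈ N.map (LinearMap.snd ℂ V W) := by rw [hsnd]; trivial
      obtain ⟨x, hx, rfl⟩ := this
      exact ⟨⟨x, hx⟩, rfl⟩
  set e := (LinearEquiv.ofBijective _ b1).symm.trans (LinearEquiv.ofBijective _ b2) with he
  have hex : ∀ x ∈ N, e x.1 = x.2 := fun x hx => by
    have : (LinearEquiv.ofBijective _ b1).symm x.1 = ⟨x, hx⟩ := by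
      rw [LinearEquiv.symm_apply_eq]; rfl
    rw [he, LinearEquiv.trans_apply, this]
    rfl
  have hsurj : ∀ v : V, ∃ x ∈ N, x.1 = v := fun v => by
    have : v ∈ N.map (LinearMap.fst ℂ V W) := by rw [hfst]; trivial
    exact this
  refine ⟨e, fun X v => ?_, fun v => ?_⟩
  · obtain ⟨x, hx, rfl⟩ := hsurj v
    rw [hex x hx]
    exact hex _ (hsub.2 X x hx)
  · obtain ⟨x, hx, rfl⟩ := hsurj v
    rw [hex x hx]
    exact hex _ (hsub.1 x hx)

theorem IsSimpleHighestWeight.isomorphic {σ : OspRep m n W} (hρ : ρ.IsSimpleHighestWeight Λ)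
    (hσ : σ.IsSimpleHighestWeight Λ) : ρ.Isomorphic σ := by
  obtain ⟨hρ1, v, hv⟩ := hρ
  obtain ⟨hσ1, w, hw⟩ := hσ
  obtain ⟨v', hv0, hv'⟩ := exists_isSingular hv
  obtain ⟨w', hw0, hw'⟩ := exists_isSingular hw
  -- Singular vectors of opposite sign are matched after a parity shift of σ, which yields an
  -- isomorphism reversing parity.
  have key : ∀ s, ρ.IsSingular Λ s v' → σ.IsSingular Λ (-s) w' → ρ.Isomorphic σ := by
    intro s h1 h2
    have h3 := h2.shift
    rw [neg_neg] at h3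
    obtain ⟨e, he1, he2⟩ := exists_equiv_of_isSingular hρ1 hσ1.shift hv0 hw0 h1 h3
    exact ⟨e, he1, Or.inr he2⟩
  have key2 : ∀ s, ρ.IsSingular Λ s v' → σ.IsSingular Λ s w' → ρ.Isomorphic σ := by
    intro s h1 h2
    obtain ⟨e, he1, he2⟩ := exists_equiv_of_isSingular hρ1 hσ1 hv0 hw0 h1 h2
    exact ⟨e, he1, Or.inl he2⟩
  rcases hv' with h1 | h1 <;> rcases hw' with h2 | h2
  · exact key2 _ h1 h2
  · exact key _ h1 h2
  · exact key (-1) h1 (by rwa [neg_neg])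
  · exact key2 _ h1 h2

end OspRep

end

section

variable {m n : ℕ}


/-! ### Dimensions -/

lemma mainDim_eq (k : ℕ) : mainDim m n k = homogDim m n k - homogDim m n (k - 2) := by
  simp only [mainDim, homogDim]
  congr 1
  refine Finset.sum_congr rfl fun i _ => ?_
  congr 4
  ring

/-- Here k - 2j = 2 - M - k, so the correction is minus the dimension of the harmonics of that
degree, which R^{2j} embeds into H_k. -/
lemma correctionDim_eq {j k : ℕ} (hj : 2 * ((j : ℤ) - k) = m - 2 * n - 2) (h : 2 * j ≤ k) :
    correctionDim m n k = -(homogDim m n (k - 2 * j : ℕ) - homogDim m n ((k - 2 * j : ℕ) - 2)) := by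
  have e : ((k - 2 * j : ℕ) : ℤ) = 2 - (m - 2 * n) - k := by omega
  rw [e, neg_sub]
  simp only [correctionDim, homogDim]
  congr 1
  · refine Finset.sum_congr (by congr 2; ring) fun i _ => ?_
    congr 4
    ring
  · refine Finset.sum_congr rfl fun i _ => ?_
    congr 4
    ring

lemma finrank_harmCap (k : ℕ) : Module.finrank ℂ (harmCap m n k) =
    Module.finrank ℂ (harm m n k ⊓ R2homog m n k : Submodule ℂ (SPoly m n)) := by
  rw [← Submodule.map_comap_subtype, harmCap, Submodule.submoduleOf]
  exact (LinearEquiv.finrank_eq (Submodule.equivMapOfInjective _ (Submodule.subtype_injective _) _))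

lemma finrank_quot (hm : 0 < m) (k : ℕ) :
    (Module.finrank ℂ (harm m n k ⧸ harmCap m n k) : ℤ) = mainDim m n k -
      Module.finrank ℂ (harm m n k ⊓ R2homog m n k : Submodule ℂ (SPoly m n)) := by
  obtain ⟨h1, h2⟩ := finiteDimensional_harm_and_finrank (m := m) (n := n) hm k
  rw [mainDim_eq, ← h2, ← finrank_harmCap, ← Submodule.finrank_quotient_add_finrank (harmCap m n k)]
  push_cast
  ring

lemma finrank_quot_of_isExceptional (hm : 0 < m) {k : ℕ} (h : IsExceptional m n k) :
    (Module.finrank ℂ (harm m n k ⧸ harmCap m n k) : ℤ) =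
      mainDim m n k + correctionDim m n k := by
  obtain ⟨j, h0, h1, h2⟩ := exists_of_isExceptional h
  rw [finrank_quot hm, harm_inf_R2homog_eq_map hm h0 h1 h2, correctionDim_eq h1 h2,
    ← (finiteDimensional_harm_and_finrank hm _).2, sub_eq_add_neg,
    ← LinearEquiv.finrank_eq (Submodule.equivMapOfInjective _ (mulR2_pow_injective hm j)
      (harm m n (k - 2 * j)))]

lemma finrank_quot_of_not_isExceptional (hm : 0 < m) {k : ℕ} (h : ¬ IsExceptional m n k) :
    (Module.finrank ℂ (harm m n k ⧸ harmCap m n k) : ℤ) = mainDim m n k := by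
  rw [finrank_quot hm, harm_inf_R2homog_of_not_isExceptional hm h, finrank_bot, Nat.cast_zero,
    sub_zero]

lemma finiteDimensional_quot (hm : 0 < m) (k : ℕ) :
    FiniteDimensional ℂ (harm m n k ⧸ harmCap m n k) := by
  have := (finiteDimensional_harm_and_finrank (m := m) (n := n) hm k).1
  infer_instance

end

end

end SuperHarm

/-! ### Assembly: simplicity, uniqueness and dimensions. -/

theorem mainTheorem2 (m n k : ℕ) (hm : 1 < m) :
    (3 ≤ m ∨ k ≤ n →
      (SuperHarm.quotRep m n k).IsSimpleHighestWeight (SuperHarm.firstWeight m n k) ∧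
      ∀ (L : Type*) [AddCommGroup L] [Module ℂ L] (ρ : SuperHarm.OspRep m n L),
        ρ.IsSimpleHighestWeight (SuperHarm.firstWeight m n k) →
          ρ.Isomorphic (SuperHarm.quotRep m n k) ∧
          FiniteDimensional ℂ L ∧
          (SuperHarm.IsExceptional m n k → (Module.finrank ℂ L : ℤ) =
            SuperHarm.mainDim m n k + SuperHarm.correctionDim m n k) ∧
          (¬ SuperHarm.IsExceptional m n k →
            (Module.finrank ℂ L : ℤ) = SuperHarm.mainDim m n k)) ∧
    FiniteDimensional ℂ (SuperHarm.harm m n k ⧸ SuperHarm.harmCap m n k) ∧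
    (SuperHarm.IsExceptional m n k →
      (Module.finrank ℂ (SuperHarm.harm m n k ⧸ SuperHarm.harmCap m n k) : ℤ) =
        SuperHarm.mainDim m n k + SuperHarm.correctionDim m n k) ∧
    (¬ SuperHarm.IsExceptional m n k →
      SuperHarm.harm m n k ⊓ SuperHarm.R2homog m n k = ⊥ ∧
      (Module.finrank ℂ (SuperHarm.harm m n k ⧸ SuperHarm.harmCap m n k) : ℤ) =
        SuperHarm.mainDim m n k) := by
  -- Two bosonic coordinates are reserved for the null pair, so 3 ≤ m becomes the presence of at
  -- least one more.
  obtain ⟨m, rfl⟩ : ∃ l, m = l + 2 := ⟨m - 2, by omega⟩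
  have hm0 : 0 < m + 2 := by omega
  refine ⟨fun h => ?_, SuperHarm.finiteDimensional_quot hm0 k,
    SuperHarm.finrank_quot_of_isExceptional hm0, fun h =>
    ⟨SuperHarm.harm_inf_R2homog_of_not_isExceptional hm0 h,
      SuperHarm.finrank_quot_of_not_isExceptional hm0 h⟩⟩
  have hQ := SuperHarm.quotRep_isSimpleHighestWeight (m := m) (n := n) (k := k) (by omega)
  refine ⟨hQ, fun L _ _ ρ hρ => ?_⟩
  have hiso := hρ.isomorphic hQ
  obtain ⟨e, -⟩ := id hiso
  have := SuperHarm.finiteDimensional_quot (n := n) hm0 k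
  refine ⟨hiso, Module.Finite.equiv e.symm, fun h => ?_, fun h => ?_⟩
  · rw [LinearEquiv.finrank_eq e, SuperHarm.finrank_quot_of_isExceptional hm0 h]
  · rw [LinearEquiv.finrank_eq e, SuperHarm.finrank_quot_of_not_isExceptional hm0 h]
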